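/- **Setting.** Let $F$ be a connected oriented punctured surface with an ideal triangulation $\Delta$ (finitely many triangles, vertices at the punctures). A *broken hyperbolic structure* $H$ on $(F,\Delta)$ makes every face of $\Delta$ a hyperbolic ideal triangle so that (i) $F$ is the quotient of the disjoint union of these triangles by gluing maps between their sides that are orientation-reversing homotheties, i.e. an arc of the common edge of $f_1,f_2$ of length $\rho_1$ in $f_1$ has length $\rho_2=\sigma(f_1,f_2)\rho_1$ in $f_2$; (ii) the product of the factors $\sigma(f_i,f_{i+1})$ along consecutive faces once around any puncture is $1$; (iii) the structure is complete: near each puncture the leaves of the horocyclic foliation (by arcs of horocycles centered at the vertices of the ideal triangles) are closed. A *decoration* is a choice of a closed horocyclic leaf for each puncture; $\delta_H(t,e)\ge 0$ denotes the distance, in the metric of the face $t$, between the two chosen leaves along the edge $e$ of $t$, and $\lambda_H(t,e)=\sqrt{2\exp\delta_H(t,e)}$ is the $\lambda$-length. Let $\langle\cdot,\cdot\rangle$ be the Minkowski form on $\mathbb R^3$ with quadratic form $x^2+y^2-z^2$, $\mathbf H=\{\langle u,u\rangle=-1,\ z>0\}$ the hyperbolic plane, $L^+=\{\langle u,u\rangle=0,\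 z>0\}$, and $h(u)=\{w\in\mathbf H:\langle w,u\rangle=-1\}$ the horocycle of $u\in L^+$; put $\lambda(h(u),h(v))=\sqrt{-\langle u,v\rangle}$. For $K>1$, a *stretch map with factor $K$* between ideal triangles is a $K$-Lipschitz homeomorphism that multiplies arclength by $K$ on each side and whose Lipschitz constant on every closed disk in the interior is $<K$; for $K=1$ it is an isometry, and for $0<K<1$ the inverse of a stretch map with factor $1/K$. **Development.** Let $p:\widetilde F\to F$ be the universal cover with lifted triangulation $\widetilde\Delta$. Fix a decorated broken hyperbolic structure $H$, a face $T_0$ of $\widetilde\Delta$, and an ideal triangle $t_0$ in $\mathbf H$ with labelled vertices. A *development* consists of a rescaling factor $c(T)>0$ for each face $T$ of $\widetilde\Delta$ and lifts $z(T,v)\in L^+$ of its vertices such that: $c(T_0)=1$; if $T,T'$ are adjacent along an edge then $c(T')\,\sigma(T,T')=c(T)$ (so the rescaled edge metrics agree); the $z(T_0,v)$ lie on the rays of the vertices of $t_0$; for any edge $e$ of $T$ with endpoints $v,w$, $$\lambda\bigl(h(z(T,v)),h(z(T,w))\bigr)=\sqrt{2\exp\bigl(c(T)\,\delta_H(T,e)\bigr)};$$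 adjacent faces have the same lifts of their two common vertices $u,v$, and the lifts of their other vertices lie on opposite sides of the plane through $0$, $z(u)$, $z(v)$. **Proposition.** The development exists and is unique. It is realized by a map $D:\widetilde F\to\mathbf H$, a homeomorphism onto an open subset, that takes every face $T$ of $\widetilde\Delta$ onto the ideal triangle with vertices $z(T,\cdot)$, acts on each side of $T$ as a homothety multiplying the arclength of $H$ by $c(T)$, and takes the points where the decoration meets the edges of $T$ to the horocycles $h(z(T,\cdot))$, such that the hyperbolic structure on $\widetilde F$ pulled back by $D$ is a covering hyperbolic structure: the lifted triangulation is a geodesic triangulation by ideal triangles, and there is a homomorphism $\varphi$ from the group of covering translations of $p$ (that is, $\pi_1(F)$) to $\mathbb R_+$ such that every covering translation $\alpha$ restricts, on each triangle of $\widetilde\Delta$, to a stretch map with factor $\varphi(\alpha)$ onto the image triangle. -/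

import Mathlib

open Topology

noncomputable section

/-! ## The hyperboloid model -/

/-- The Minkowski inner product with quadratic form `x² + y² - z²`. -/
def mink (u v : Fin 3 → ℝ) : ℝ := u 0 * v 0 + u 1 * v 1 - u 2 * v 2

/-- The hyperbolic plane: the upper sheet of the hyperboloid `⟨u, u⟩ = -1`. -/
abbrev HypPlane : Type := {u : Fin 3 → ℝ // mink u u = -1 ∧ 0 < u 2}

/-- The hyperbolic distance. -/
def hdist (u v : HypPlane) : ℝ := Real.arcosh (-mink u.1 v.1)

/-- The open positive light cone; the point `u` stands for the horocycle `horocycle u`. -/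
def lightCone : Set (Fin 3 → ℝ) := {u | mink u u = 0 ∧ 0 < u 2}

/-- The horocycle that corresponds to a point of the light cone. -/
def horocycle (u : Fin 3 → ℝ) : Set HypPlane := {w | mink w.1 u = -1}

/-- The λ-length of the two horocycles `horocycle u` and `horocycle v`. -/
def lambdaCone (u v : Fin 3 → ℝ) : ℝ := Real.sqrt (-mink u v)

/-- The λ-length of two horocycles at signed distance `δ`. -/
def lambdaOfDist (δ : ℝ) : ℝ := Real.sqrt (2 * Real.exp δ)

/-! ## Ideal triangles -/

/-- Three points on the light cone that span three distinct ideal points. -/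
def IsIdealTriple (u : Fin 3 → Fin 3 → ℝ) : Prop :=
  (∀ k, u k ∈ lightCone) ∧ LinearIndependent ℝ u

/-- The ideal triangle (with its sides, without its ideal vertices) whose ideal vertices are the
rays through `u 0`, `u 1`, `u 2`. It depends on the rays only. -/
def idealTriangle (u : Fin 3 → Fin 3 → ℝ) : Set HypPlane :=
  {w | ∃ a : Fin 3 → ℝ, (∀ k, 0 ≤ a k) ∧ w.1 = ∑ k, a k • u k}

/-- The interior of an ideal triangle. -/
def idealInterior (u : Fin 3 → Fin 3 → ℝ) : Set HypPlane :=
  {w | ∃ a : Fin 3 → ℝ, (∀ k, 0 < a k) ∧ w.1 = ∑ k, a k • u k}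

/-- The side of an ideal triangle opposite to the vertex `i`: the complete geodesic that joins
the vertices `i + 1` and `i + 2` (indices modulo 3). -/
def idealSide (u : Fin 3 → Fin 3 → ℝ) (i : Fin 3) : Set HypPlane :=
  {w | ∃ a : Fin 3 → ℝ, (∀ k, 0 ≤ a k) ∧ a i = 0 ∧ w.1 = ∑ k, a k • u k}

/-! ## Stretch maps between ideal triangles -/

/-- `K`-Lipschitz stretch maps for `K > 1`: a `K`-Lipschitz homeomorphism that multiplies arclength
by `K` on every side, and whose Lipschitz constant is strictly less than `K` on every closed disk
in the interior (equivalently, on every compact subset of the interior). -/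
structure IsExpandingStretch (K : ℝ) {u v : Fin 3 → Fin 3 → ℝ}
    (f : idealTriangle u ≃ₜ idealTriangle v) : Prop where
  lipschitz : ∀ x y, hdist (f x) (f y) ≤ K * hdist x y
  side : ∀ i, ∃ j, (∀ x : idealTriangle u, x.1 ∈ idealSide u i ↔ (f x).1 ∈ idealSide v j) ∧
    ∀ x y : idealTriangle u, x.1 ∈ idealSide u i → y.1 ∈ idealSide u i →
      hdist (f x) (f y) = K * hdist x y
  strict : ∀ C : Set (idealTriangle u), IsCompact C → (∀ x ∈ C, x.1 ∈ idealInterior u) →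
    ∃ L < K, ∀ x ∈ C, ∀ y ∈ C, hdist (f x) (f y) ≤ L * hdist x y

/-- Stretch maps between ideal triangles with factor `K > 0`: as above for `K > 1`, isometries for
`K = 1`, and inverses of stretch maps with factor `1 / K` for `K < 1`. -/
def IsStretchMap (K : ℝ) {u v : Fin 3 → Fin 3 → ℝ}
    (f : idealTriangle u ≃ₜ idealTriangle v) : Prop :=
  (1 < K ∧ IsExpandingStretch K f) ∨
  (K = 1 ∧ ∀ x y, hdist (f x) (f y) = hdist x y) ∨
  (0 < K ∧ K < 1 ∧ IsExpandingStretch K⁻¹ f.symm)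

/-! ## The standard ideal triangle -/

/-- Light-like vectors over the third roots of unity, in counterclockwise order, normalized so that
the three horocycles are pairwise tangent, at the distinguished points of the three sides. -/
def stdVertex : Fin 3 → Fin 3 → ℝ :=
  ![![2 / Real.sqrt 3, 0, 2 / Real.sqrt 3],
    ![-(1 / Real.sqrt 3), 1, 2 / Real.sqrt 3],
    ![-(1 / Real.sqrt 3), -1, 2 / Real.sqrt 3]]

/-- The standard ideal triangle. -/
abbrev StdTriangle : Type := idealTriangle stdVertex

lemma mink_stdVertex (i j : Fin 3) :
    mink (stdVertex i) (stdVertex j) = if i = j then 0 else -2 := by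
  have h : Real.sqrt 3 ^ 2 = 3 := Real.sq_sqrt (by norm_num)
  have h0 : Real.sqrt 3 ≠ 0 := by positivity
  fin_cases i <;> fin_cases j <;> simp [mink, stdVertex] <;> field_simp <;>
    nlinarith [h]

/-- The vector of the point with parameter `s` on the side `i` of the standard ideal triangle. -/
def sideVec (i : Fin 3) (s : ℝ) : Fin 3 → ℝ :=
  (Real.exp (-s) / 2) • stdVertex (i + 1) + (Real.exp s / 2) • stdVertex (i + 2)

lemma sideVec_mem (i : Fin 3) (s : ℝ) :
    mink (sideVec i s) (sideVec i s) = -1 ∧ 0 < sideVec i s 2 := by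
  have hz : ∀ k, stdVertex k 2 = 2 / Real.sqrt 3 := by
    intro k; fin_cases k <;> simp [stdVertex]
  have hne : i + 1 ≠ i + 2 := by fin_cases i <;> decide
  have e : Real.exp (-s) * Real.exp s = 1 := by rw [← Real.exp_add]; simp
  have key : ∀ (a b : ℝ) (u v : Fin 3 → ℝ), mink (a • u + b • v) (a • u + b • v)
      = a * a * mink u u + 2 * (a * b) * mink u v + b * b * mink v v := by
    intro a b u v; simp [mink]; ring
  refine ⟨?_, ?_⟩
  · rw [sideVec, key]
    simp only [mink_stdVertex, if_neg hne, if_true]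
    nlinarith [e]
  · simp only [sideVec, Pi.add_apply, Pi.smul_apply, smul_eq_mul, hz]
    positivity

/-- The arclength parametrization of the side `i` of the standard ideal triangle, in the direction
from the vertex `i + 1` to the vertex `i + 2` (the boundary orientation). The parameter vanishes
at the distinguished point of the side, the foot of the perpendicular from the center. -/
def sidePoint (i : Fin 3) (s : ℝ) : StdTriangle :=
  ⟨⟨sideVec i s, sideVec_mem i s⟩,
    fun k => if k = i + 1 then Real.exp (-s) / 2 else if k = i + 2 then Real.exp s / 2 else 0,
    fun k => by dsimp only; split_ifs <;> positivity,
    by fin_cases i <;> simp [sideVec, Fin.sum_univ_three, add_comm]⟩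

/-! ## Broken hyperbolic structures -/

/-- Gluing data for ideal triangles. The faces are copies of the standard ideal triangle; the side
`i` of the face `f` (the triangle-edge pair `(f, i)`) is glued to the side `pair (f, i)`, and the
gluing, expressed in the arclength parameters of the two sides, is the orientation-reversing
homothety `s ↦ -(scale (f, i) * s + shift (f, i))`. -/
structure GluingData where
  Face : Type
  finite_face : Finite Face
  pair : Face × Fin 3 → Face × Fin 3
  pair_pair : ∀ x, pair (pair x) = x
  pair_ne : ∀ x, pair x ≠ x
  /-- the homothetic scaling factor: (length in the face across the edge) / (length in `f`) -/
  scale : Face × Fin 3 → ℝ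
  scale_pos : ∀ x, 0 < scale x
  shift : Face × Fin 3 → ℝ
  /-- the gluing map of `pair x` is inverse to the gluing map of `x` -/
  scale_pair : ∀ x, scale (pair x) * scale x = 1
  shift_pair : ∀ x, shift (pair x) * scale x = shift x

namespace GluingData

variable (G : GluingData)

/-- A corner `(f, k)` is the face `f` at its vertex `k`. `exitSide` is the side that one crosses
when one turns counterclockwise about that vertex. -/
def exitSide (x : G.Face × Fin 3) : G.Face × Fin 3 := (x.1, x.2 + 1)

/-- The next corner, counterclockwise, at the same puncture. -/
def next (x : G.Face × Fin 3) : G.Face × Fin 3 :=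
  ((G.pair (G.exitSide x)).1, (G.pair (G.exitSide x)).2 + 1)

/-- Product of the scaling factors along `n` consecutive faces about a puncture. -/
def holonomy (x : G.Face × Fin 3) : ℕ → ℝ
  | 0 => 1
  | n + 1 => holonomy x n * G.scale (G.exitSide (G.next^[n] x))

/-- In a corner `(f, k)` the horocyclic arc of depth `d` is the arc centered at the vertex `k` that
meets the two sides adjacent to this vertex at distance `d` from their distinguished points, towards
the vertex. The leaf of the horocyclic foliation that contains the arc of depth `d` of the corner `x`
has depth `transport x n d` in the `n`-th following corner. -/
def transport (x : G.Face × Fin 3) : ℕ → ℝ → ℝ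
  | 0, d => d
  | n + 1, d => G.scale (G.exitSide (G.next^[n] x)) * transport x n d
      + G.shift (G.exitSide (G.next^[n] x))

/-- No horocyclic holonomy about the punctures. -/
def NoHorocyclicHolonomy : Prop :=
  ∀ x n, G.next^[n] x = x → G.holonomy x n = 1

/-- Completeness: near every puncture the leaves of the horocyclic foliation close up. -/
def Complete : Prop :=
  ∀ x n, G.next^[n] x = x → ∀ᶠ d in Filter.atTop, G.transport x n d = d

end GluingData

/-- An ideal triangulation of the surface `F` together with a broken hyperbolic structure on it.
For every face `f`, the map `chart f` is the (orientation-preserving) isometry of the standard ideal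
triangle onto the completed face followed by the map of the latter to `F`; the surface is the
quotient of the disjoint union of the ideal triangles by the gluing maps between their sides. -/
structure BrokenHyperbolicStructure (F : Type*) [TopologicalSpace F] extends GluingData where
  chart : Face → StdTriangle → F
  isQuotientMap_chart : IsQuotientMap (fun x : (Σ _ : Face, StdTriangle) => chart x.1 x.2)
  chart_eq_iff : ∀ (f g : Face) (x y : StdTriangle), chart f x = chart g y ↔
    (f = g ∧ x = y) ∨ ∃ (i j : Fin 3) (s : ℝ), pair (f, i) = (g, j) ∧ x = sidePoint i s ∧
      y = sidePoint j (-(scale (f, i) * s + shift (f, i)))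
  noHorocyclicHolonomy : toGluingData.NoHorocyclicHolonomy
  complete : toGluingData.Complete

/-- A decoration: a closed leaf of the horocyclic foliation about every puncture, given by its
depths in the corners. -/
structure Decoration {F : Type*} [TopologicalSpace F] (H : BrokenHyperbolicStructure F) where
  depth : H.Face × Fin 3 → ℝ
  depth_nonneg : ∀ x, 0 ≤ depth x
  depth_next : ∀ x, depth (H.next x) =
    H.scale (H.exitSide x) * depth x + H.shift (H.exitSide x)

/-- The distance, in the metric of the face, between the two horocyclic arcs that meet the side `i`
of the face `f`. The λ-length of the triangle-edge pair `(f, i)` is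
`lambdaOfDist (horoDist dec (f, i))`. -/
def horoDist {F : Type*} [TopologicalSpace F] {H : BrokenHyperbolicStructure F}
    (dec : Decoration H) (x : H.Face × Fin 3) : ℝ :=
  dec.depth (x.1, x.2 + 1) + dec.depth (x.1, x.2 + 2)

/-! ## The universal cover and the lifted triangulation -/

/-- The group of covering translations of `p`. -/
def coveringTranslations {E F : Type*} [TopologicalSpace E] (p : E → F) : Subgroup (E ≃ₜ E) where
  carrier := {α | ∀ x, p (α x) = p x}
  mul_mem' := by
    intro a b ha hb x
    show p (a (b x)) = p x
    rw [ha, hb]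
  one_mem' := fun _ => rfl
  inv_mem' := by
    intro a ha x
    show p (a.symm x) = p x
    rw [← ha (a.symm x), Homeomorph.apply_symm_apply]

/-- A triangle of the lifted triangulation: a face together with a lift of its chart. -/
structure LiftedFace {E F : Type*} [TopologicalSpace E] [TopologicalSpace F]
    (H : BrokenHyperbolicStructure F) (p : E → F) where
  face : H.Face
  lift : StdTriangle → E
  continuous_lift : Continuous lift
  lift_spec : ∀ x, p (lift x) = H.chart face x

/-- The lifted triangle `T` along its side `i` meets the lifted triangle `T'` along its side `j`. -/
def LiftedFace.Adj {E F : Type*} [TopologicalSpace E] [TopologicalSpace F]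
    {H : BrokenHyperbolicStructure F} {p : E → F}
    (T : LiftedFace H p) (i : Fin 3) (T' : LiftedFace H p) (j : Fin 3) : Prop :=
  H.pair (T.face, i) = (T'.face, j) ∧
  ∀ s, T.lift (sidePoint i s) =
    T'.lift (sidePoint j (-(H.scale (T.face, i) * s + H.shift (T.face, i))))

/-! ## The development of a broken hyperbolic structure -/

/-- The development, with the lifted triangle `T₀` normalized to the ideal triangle with vertices on
the rays of `r`. The metric of every lifted triangle `T` is rescaled by a factor `c T` such that the
metrics induced on common edges agree (`c T₀ = 1`); `z T k` is the lift to the light cone of the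
vertex `k` of `T`. The λ-lengths of the rescaled triangles are realized, adjacent triangles share
the lifts of their common vertices, and their remaining vertices are lifted to opposite sides of the
plane through the lifts of the common ones. -/
structure IsDevelopment {E F : Type*} [TopologicalSpace E] [TopologicalSpace F]
    {H : BrokenHyperbolicStructure F} (dec : Decoration H) (p : E → F)
    (T₀ : LiftedFace H p) (r : Fin 3 → Fin 3 → ℝ)
    (c : LiftedFace H p → ℝ) (z : LiftedFace H p → Fin 3 → Fin 3 → ℝ) : Prop where
  scale_base : c T₀ = 1
  scale_adj : ∀ T i T' j, T.Adj i T' j → c T' * H.scale (T.face, i) = c T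
  mem_cone : ∀ T k, z T k ∈ lightCone
  base : ∀ k, ∃ t : ℝ, 0 < t ∧ z T₀ k = t • r k
  lambda : ∀ T i, lambdaCone (z T (i + 1)) (z T (i + 2)) =
    lambdaOfDist (c T * horoDist dec (T.face, i))
  share : ∀ T i T' j, T.Adj i T' j → z T' (j + 1) = z T (i + 2) ∧ z T' (j + 2) = z T (i + 1)
  opposite : ∀ T i T' j, T.Adj i T' j →
    Matrix.det (Matrix.of ![z T (i + 1), z T (i + 2), z T i]) *
      Matrix.det (Matrix.of ![z T (i + 1), z T (i + 2), z T' j]) < 0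

/-- A map from the universal cover to the hyperbolic plane that realizes the development `(c, z)`:
an injection (a homeomorphism onto an open set) that takes every lifted triangle `T` onto the
ideal triangle with vertices `z T`, acts on every side of `T` as a homothety that multiplies the
arclength of the broken structure by `c T`, and takes the points where the decoration meets the
sides to the horocycles of `z T`. -/
structure RealizesDevelopment {E F : Type*} [TopologicalSpace E] [TopologicalSpace F]
    {H : BrokenHyperbolicStructure F} (dec : Decoration H) (p : E → F)
    (c : LiftedFace H p → ℝ) (z : LiftedFace H p → Fin 3 → Fin 3 → ℝ)
    (D : E → HypPlane) : Prop where
  isOpenEmbedding : IsOpenEmbedding D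
  image_face : ∀ T : LiftedFace H p, Set.range (fun x => D (T.lift x)) = idealTriangle (z T)
  image_side : ∀ (T : LiftedFace H p) i,
    Set.range (fun s => D (T.lift (sidePoint i s))) = idealSide (z T) i
  homothety : ∀ (T : LiftedFace H p) i s t,
    hdist (D (T.lift (sidePoint i s))) (D (T.lift (sidePoint i t))) =
      c T * hdist (sidePoint i s).1 (sidePoint i t).1
  horocycle_head : ∀ (T : LiftedFace H p) i,
    D (T.lift (sidePoint i (dec.depth (T.face, i + 2)))) ∈ horocycle (z T (i + 2))
  horocycle_tail : ∀ (T : LiftedFace H p) i,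
    D (T.lift (sidePoint i (-dec.depth (T.face, i + 1)))) ∈ horocycle (z T (i + 1))

/-! ## Covering hyperbolic structures -/

/-- A hyperbolic structure on the simply connected surface `E`, given by its developing map `D` (a
local homeomorphism to the hyperbolic plane, from which the metric is pulled back), is a covering
hyperbolic structure with stretch homomorphism `φ` if the lifted triangulation is a geodesic
triangulation by ideal triangles and every covering translation `α` restricts to a stretch map with
factor `φ α` from each of its triangles to the image triangle. -/
structure IsCoveringHyperbolicStructure {E F : Type*} [TopologicalSpace E] [TopologicalSpace F]
    (H : BrokenHyperbolicStructure F) (p : E → F)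
    (φ : coveringTranslations p →* {t : ℝ // 0 < t}) (D : E → HypPlane) : Prop where
  isLocalHomeomorph : IsLocalHomeomorph D
  geodesic : ∀ T : LiftedFace H p, Function.Injective (fun x => D (T.lift x)) ∧
    ∃ u, IsIdealTriple u ∧ Set.range (fun x => D (T.lift x)) = idealTriangle u ∧
      ∀ i, Set.range (fun s => D (T.lift (sidePoint i s))) = idealSide u i
  stretch : ∀ (α : coveringTranslations p) (T : LiftedFace H p),
    ∃ u v, IsIdealTriple u ∧ IsIdealTriple v ∧
      Set.range (fun x => D (T.lift x)) = idealTriangle u ∧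
      Set.range (fun x => D (α.1 (T.lift x))) = idealTriangle v ∧
      ∃ f : idealTriangle u ≃ₜ idealTriangle v, IsStretchMap (φ α : ℝ) f ∧
        ∀ (x : StdTriangle) (hx : D (T.lift x) ∈ idealTriangle u),
          (f ⟨D (T.lift x), hx⟩ : HypPlane) = D (α.1 (T.lift x))

end

/-!
Rescaling the lifts of the vertices by the decoration turns a development into a rescaling factor
and a normalized triple, that is, light-like vectors with pairwise tangent horocycles, for each
lifted triangle. Both are determined across a side by the gluing of that side: the neighbouring
triple is found by unfolding over the side. Crossing an edge back and forth changes nothing and the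
vertices are punctures, so this transport of labels is a covering space of `F`; over the simply
connected cover it has a unique section through each initial label.

Barycentric coordinates identify all ideal triangles. On them there is a one-parameter group of
homeomorphisms whose time-`t` map is a stretch map with factor `exp t` for `0 ≤ t`. It moves points
only in three disjoint spikes, vertically in the upper half-plane picture with the vertex of the
spike at infinity: the logarithmic height `η` has speed `max 0 (η + f * exp (-2 * η))`, where the
parameter `f` of the vertical geodesic vanishes on the sides, so that `η` is multiplied by `exp t`
there. The time-`log c` map, followed by the identification with the developed triangle, maps a
face with rescaling factor `c`; these maps agree along the sides and glue to the developing map. It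
is injective because a chain of triangles that crosses a side stays in the half-plane beyond it. A
covering translation `α` multiplies all factors `c` by the same number, so by the group law it acts
on each triangle by the flow at the logarithm of this number.
-/

noncomputable section

open Set
open scoped NNReal

/-! ### Flows of Lipschitz vector fields -/

lemma le_exp_mul_of_hasDerivAt_le {y y' : ℝ → ℝ} {k t : ℝ} (ht : 0 ≤ t)
    (hy : ∀ s ∈ Icc 0 t, HasDerivAt y (y' s) s) (hle : ∀ s ∈ Icc 0 t, y' s ≤ k * y s) :
    y t ≤ Real.exp (k * t) * y 0 := by
  have h := le_gronwallBound_of_liminf_deriv_right_le (f := y) (f' := y') (δ := y 0) (K := k)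
    (ε := 0) (fun s hs => (hy s hs).continuousAt.continuousWithinAt)
    (fun s hs _ => (hy s (Ico_subset_Icc_self hs)).hasDerivWithinAt.liminf_right_slope_le) le_rfl
    (fun s hs => (hle s (Ico_subset_Icc_self hs)).trans_eq (add_zero _).symm) t ⟨ht, le_rfl⟩
  rwa [gronwallBound_ε0, sub_zero, mul_comm] at h

section LipschitzFlow

variable {E : Type*} [NormedAddCommGroup E] [NormedSpace ℝ E]

lemma exists_isIntegralCurveOn_iUnion {ι : Type*} {v : ℝ → E → E} {γ : ι → ℝ → E}
    {s : ι → Set ℝ} (hs : ∀ i, IsOpen (s i)) (hγ : ∀ i, IsIntegralCurveOn (γ i) v (s i))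
    (heq : ∀ i j, EqOn (γ i) (γ j) (s i ∩ s j)) :
    ∃ γ' : ℝ → E, IsIntegralCurveOn γ' v (⋃ i, s i) ∧ ∀ i, EqOn γ' (γ i) (s i) := by
  classical
  let γ' : ℝ → E := fun t => if h : ∃ i, t ∈ s i then γ h.choose t else 0
  have hγ' : ∀ i, EqOn γ' (γ i) (s i) := fun i t ht => by
    have h : ∃ i, t ∈ s i := ⟨i, ht⟩
    simp only [γ', dif_pos h]
    exact heq _ _ ⟨h.choose_spec, ht⟩
  refine ⟨γ', fun t ht => ?_, hγ'⟩
  obtain ⟨i, hi⟩ := mem_iUnion.1 ht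
  have hi' : s i ∈ 𝓝 t := (hs i).mem_nhds hi
  rw [hγ' i hi]
  exact (((hγ i t hi).hasDerivAt hi').congr_of_eventuallyEq
    ((hγ' i).eventuallyEq_of_mem hi')).hasDerivWithinAt

variable {v : E → E} {K : ℝ≥0}

lemma eqOn_Ioo_inter_Ioo_of_isIntegralCurveOn (hv : LipschitzWith K v) {a b a' b' t₀ : ℝ}
    {γ γ' : ℝ → E} (hγ : IsIntegralCurveOn γ (fun _ => v) (Ioo a b))
    (hγ' : IsIntegralCurveOn γ' (fun _ => v) (Ioo a' b')) (ht₀ : t₀ ∈ Ioo a b ∩ Ioo a' b')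
    (heq : γ t₀ = γ' t₀) : EqOn γ γ' (Ioo a b ∩ Ioo a' b') := by
  have hasDerivAt : ∀ {c d : ℝ} {β : ℝ → E}, IsIntegralCurveOn β (fun _ => v) (Ioo c d) →
      ∀ t ∈ Ioo c d, HasDerivAt β (v (β t)) t :=
    fun h t ht => (h t ht).hasDerivAt (isOpen_Ioo.mem_nhds ht)
  rw [Ioo_inter_Ioo] at ht₀ ⊢
  have hsub : Ioo (a ⊔ a') (b ⊓ b') ⊆ Ioo a b := Ioo_subset_Ioo le_sup_left inf_le_left
  have hsub' : Ioo (a ⊔ a') (b ⊓ b') ⊆ Ioo a' b' := Ioo_subset_Ioo le_sup_right inf_le_right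
  exact ODE_solution_unique_of_mem_Ioo (v := fun _ => v) (s := fun _ => univ)
    (fun _ _ => hv.lipschitzOnWith) ht₀ (fun t ht => ⟨hasDerivAt hγ t (hsub ht), trivial⟩)
    (fun t ht => ⟨hasDerivAt hγ' t (hsub' ht), trivial⟩) heq

lemma exists_isIntegralCurveOn_Ioo_uniform [CompleteSpace E] (hv : LipschitzWith K v) :
    ∃ T : ℝ, 0 < T ∧
      ∀ x, ∃ γ : ℝ → E, γ 0 = x ∧ IsIntegralCurveOn γ (fun _ => v) (Ioo (-T) T) := by
  set T : ℝ := 1 / (2 * (K + 1)) with hT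
  have hT₀ : 0 < T := by positivity
  refine ⟨T, hT₀, fun x => ?_⟩
  have hpl : IsPicardLindelof (fun _ => v) (⟨0, by linarith, hT₀.le⟩ : Icc (-T) T) x ‖v x‖₊ 0
      (‖v x‖₊ * (1 + K)) K := by
    refine IsPicardLindelof.of_time_independent (fun y hy => ?_) hv.lipschitzOnWith ?_
    · have hy' : ‖y - x‖ ≤ ‖v x‖ := by simpa [dist_eq_norm] using hy
      calc ‖v y‖ ≤ ‖v y - v x‖ + ‖v x‖ := norm_le_norm_sub_add _ _
        _ ≤ K * ‖v x‖ + ‖v x‖ := by gcongr; exact (hv.norm_sub_le y x).trans (by gcongr)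
        _ = (‖v x‖₊ * (1 + K) : ℝ≥0) := by push_cast; ring
    · have hKT : (1 + (K : ℝ)) * T = 1 / 2 := by rw [hT]; field_simp; ring
      simp only [sub_zero, zero_sub, neg_neg, max_self]
      push_cast
      nlinarith [norm_nonneg (v x)]
  obtain ⟨γ, hγ₀, hγ⟩ := hpl.exists_eq_forall_mem_Icc_hasDerivWithinAt₀
  exact ⟨γ, hγ₀, IsIntegralCurveOn.mono hγ Ioo_subset_Icc_self⟩

lemma exists_isIntegralCurveOn_Ioo_shift (hv : LipschitzWith K v) {T : ℝ}
    (h : ∀ x, ∃ γ : ℝ → E, γ 0 = x ∧ IsIntegralCurveOn γ (fun _ => v) (Ioo (-T) T)) {s : ℝ}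
    (hs : s ∈ Ioo (-T) T) (x : E) :
    ∃ γ : ℝ → E, γ 0 = x ∧ IsIntegralCurveOn γ (fun _ => v) (Ioo (s - T) (s + T)) := by
  obtain ⟨α, hα₀, hα⟩ := h x
  obtain ⟨β, hβ₀, hβ⟩ := h (α s)
  have hβ' : IsIntegralCurveOn (β ∘ (· - s)) (fun _ => v) (Ioo (s - T) (s + T)) := by
    refine (hβ.comp_sub s).mono fun t ht => ?_
    rw [mem_vadd_set_iff_neg_vadd_mem, vadd_eq_add]
    exact ⟨by linarith [ht.1], by linarith [ht.2]⟩
  have hT : 0 < T := by linarith [hs.1, hs.2]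
  have heq := eqOn_Ioo_inter_Ioo_of_isIntegralCurveOn hv hβ' hα
    ⟨⟨by linarith, by linarith⟩, hs⟩ (by simp [hβ₀])
  have h0 : (0 : ℝ) ∈ Ioo (s - T) (s + T) ∩ Ioo (-T) T :=
    ⟨⟨by linarith [hs.2], by linarith [hs.1]⟩, by linarith, hT⟩
  exact ⟨_, (heq h0).trans hα₀, hβ'⟩

lemma exists_isIntegralCurveOn_Ioo_enlarge (hv : LipschitzWith K v) {T : ℝ} (hT : 0 < T)
    (h : ∀ x, ∃ γ : ℝ → E, γ 0 = x ∧ IsIntegralCurveOn γ (fun _ => v) (Ioo (-T) T)) (x : E) :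
    ∃ γ : ℝ → E, γ 0 = x ∧
      IsIntegralCurveOn γ (fun _ => v) (Ioo (-(3 / 2 * T)) (3 / 2 * T)) := by
  let s : Bool → ℝ := fun i => if i then T / 2 else -(T / 2)
  have hs : ∀ i, s i ∈ Ioo (-T) T := by
    rintro (_ | _) <;> constructor <;> simp only [s] <;> norm_num <;> linarith
  choose γ hγ₀ hγ using fun i => exists_isIntegralCurveOn_Ioo_shift hv h (hs i) x
  have h0 : ∀ i, (0 : ℝ) ∈ Ioo (s i - T) (s i + T) := fun i =>
    ⟨by linarith [(hs i).2], by linarith [(hs i).1]⟩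
  obtain ⟨γ', hγ', heq⟩ := exists_isIntegralCurveOn_iUnion (fun _ => isOpen_Ioo) hγ fun i j =>
    eqOn_Ioo_inter_Ioo_of_isIntegralCurveOn hv (hγ i) (hγ j) ⟨h0 i, h0 j⟩
      ((hγ₀ i).trans (hγ₀ j).symm)
  refine ⟨γ', (heq true (h0 true)).trans (hγ₀ true), hγ'.mono fun t ht => mem_iUnion.2 ?_⟩
  rcases le_total 0 t with ht₀ | ht₀
  · exact ⟨true, by simp only [s, if_true]; constructor <;> linarith [ht.2]⟩
  · exact ⟨false, by simp only [s, Bool.false_eq_true, if_false]; constructor <;> linarith [ht.1]⟩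

theorem exists_isIntegralCurve_of_lipschitzWith [CompleteSpace E] (hv : LipschitzWith K v)
    (x : E) : ∃ γ : ℝ → E, γ 0 = x ∧ IsIntegralCurve γ (fun _ => v) := by
  obtain ⟨T, hT, h⟩ := exists_isIntegralCurveOn_Ioo_uniform hv
  have hpow : ∀ n : ℕ, ∀ x, ∃ γ : ℝ → E, γ 0 = x ∧
      IsIntegralCurveOn γ (fun _ => v) (Ioo (-((3 / 2) ^ n * T)) ((3 / 2) ^ n * T)) := by
    intro n
    induction n with
    | zero => simpa using h
    | succ n ih =>
      intro x
      simpa only [pow_succ', mul_assoc] using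
        exists_isIntegralCurveOn_Ioo_enlarge hv (by positivity) ih x
  choose γ hγ₀ hγ using fun n => hpow n x
  have h0 : ∀ n : ℕ, (0 : ℝ) ∈ Ioo (-((3 / 2) ^ n * T)) ((3 / 2) ^ n * T) := fun n =>
    ⟨neg_lt_zero.2 (by positivity), by positivity⟩
  obtain ⟨γ', hγ', heq⟩ := exists_isIntegralCurveOn_iUnion (fun _ => isOpen_Ioo) hγ fun m n =>
    eqOn_Ioo_inter_Ioo_of_isIntegralCurveOn hv (hγ m) (hγ n) ⟨h0 m, h0 n⟩
      ((hγ₀ m).trans (hγ₀ n).symm)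
  have hcover : ⋃ n : ℕ, Ioo (-((3 / 2) ^ n * T)) ((3 / 2) ^ n * T) = univ := by
    refine eq_univ_of_forall fun t => mem_iUnion.2 ?_
    obtain ⟨n, hn⟩ := pow_unbounded_of_one_lt (|t| / T) (show (1 : ℝ) < 3 / 2 by norm_num)
    exact ⟨n, abs_lt.1 ((div_lt_iff₀ hT).1 hn)⟩
  rw [hcover, isIntegralCurveOn_univ] at hγ'
  exact ⟨γ', (heq 0 (h0 0)).trans (hγ₀ 0), hγ'⟩

/-- The flow of a Lipschitz vector field on a Banach space: `lipschitzFlow hv x` is the integral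
curve of `v` that passes through `x` at time `0`. -/
def lipschitzFlow [CompleteSpace E] (hv : LipschitzWith K v) (x : E) : ℝ → E :=
  (exists_isIntegralCurve_of_lipschitzWith hv x).choose

namespace lipschitzFlow

variable [CompleteSpace E] (hv : LipschitzWith K v)

@[simp] lemma apply_zero (x : E) : lipschitzFlow hv x 0 = x :=
  (exists_isIntegralCurve_of_lipschitzWith hv x).choose_spec.1

lemma isIntegralCurve (x : E) : IsIntegralCurve (lipschitzFlow hv x) (fun _ => v) :=
  (exists_isIntegralCurve_of_lipschitzWith hv x).choose_spec.2

lemma eq_of_isIntegralCurve {γ : ℝ → E} (hγ : IsIntegralCurve γ (fun _ => v)) :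
    lipschitzFlow hv (γ 0) = γ :=
  ODE_solution_unique_univ (v := fun _ => v) (s := fun _ => univ) (t₀ := 0)
    (fun _ => hv.lipschitzOnWith) (fun t => ⟨isIntegralCurve hv _ t, trivial⟩)
    (fun t => ⟨hγ t, trivial⟩) (apply_zero hv _)

lemma apply_add (x : E) (s t : ℝ) :
    lipschitzFlow hv x (s + t) = lipschitzFlow hv (lipschitzFlow hv x s) t := by
  have h := congrFun (eq_of_isIntegralCurve hv ((isIntegralCurve hv x).comp_add s)) t
  simpa [add_comm t s] using h.symm

lemma apply_of_eq_zero {x : E} (hx : v x = 0) (t : ℝ) : lipschitzFlow hv x t = x :=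
  congrFun (eq_of_isIntegralCurve hv (isIntegralCurve_const fun _ => hx)) t

lemma dist_apply_le (x y : E) (t : ℝ) :
    dist (lipschitzFlow hv x t) (lipschitzFlow hv y t) ≤ dist x y * Real.exp (K * |t|) := by
  suffices h : ∀ {w : E → E} {γ γ' : ℝ → E}, LipschitzWith K w → IsIntegralCurve γ (fun _ => w) →
      IsIntegralCurve γ' (fun _ => w) → ∀ {s : ℝ}, 0 ≤ s →
      dist (γ s) (γ' s) ≤ dist (γ 0) (γ' 0) * Real.exp (K * s) by
    rcases le_total 0 t with ht | ht
    · simpa [abs_of_nonneg ht] using h hv (isIntegralCurve hv x) (isIntegralCurve hv y) ht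
    · have hreverse := fun z => (isIntegralCurve hv z).comp_mul (-1)
      have hneg : LipschitzWith K ((-1 : ℝ) • v) := by simpa using hv.neg
      simpa [abs_of_nonpos ht] using h hneg (hreverse x) (hreverse y) (neg_nonneg.2 ht)
  intro w γ γ' hw hγ hγ' s hs
  simpa using dist_le_of_trajectories_ODE (v := fun _ => w) (fun _ => hw) hγ.continuous.continuousOn
    (fun s _ => (hγ s).hasDerivWithinAt) hγ'.continuous.continuousOn
    (fun s _ => (hγ' s).hasDerivWithinAt) le_rfl s ⟨hs, le_rfl⟩

protected lemma continuous (t : ℝ) : Continuous fun x => lipschitzFlow hv x t :=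
  (LipschitzWith.of_dist_le_mul (K := (Real.exp (K * |t|)).toNNReal) fun x y => by
    rw [Real.coe_toNNReal _ (Real.exp_pos _).le, mul_comm]
    exact dist_apply_le hv x y t).continuous

end lipschitzFlow

end LipschitzFlow

/-! ### The vertical flow in a spike -/

/-- The speed at horocyclic depth `η` of the stretch flow on the leaf with parameter `f`, where it
is not negative. -/
def leafSpeed (f η : ℝ) : ℝ := η + f * Real.exp (-2 * η)

/-- The speed of the stretch flow, the cut-off of `leafSpeed` at `0`. It is used for
`f ∈ [0, 1 / 64]` and `η ≥ -1 / 2`; the arguments are clamped so that it is Lipschitz on the whole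
plane. -/
def spikeSpeed (f η : ℝ) : ℝ :=
  max 0 (η + projIcc 0 (1 / 64) (by norm_num) f * Real.exp (-2 * max η (-1 / 2)))

lemma exp_neg_two_mul_max_le (η : ℝ) : Real.exp (-2 * max η (-1 / 2)) ≤ 3 := by
  have h : -2 * max η (-1 / 2) ≤ 1 := by linarith [le_max_right η (-1 / 2)]
  exact (Real.exp_le_exp.2 h).trans Real.exp_one_lt_three.le

lemma abs_exp_sub_exp_le {a b M : ℝ} (ha : a ≤ M) (hb : b ≤ M) :
    |Real.exp a - Real.exp b| ≤ Real.exp M * |a - b| := by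
  wlog hba : b ≤ a generalizing a b
  · rw [abs_sub_comm, abs_sub_comm a b]
    exact this hb ha (le_of_not_ge hba)
  rw [abs_of_nonneg (sub_nonneg.2 (Real.exp_le_exp.2 hba)), abs_of_nonneg (sub_nonneg.2 hba)]
  calc Real.exp a - Real.exp b = Real.exp a * (1 - Real.exp (b - a)) := by
        rw [mul_sub, mul_one, ← Real.exp_add, add_sub_cancel]
    _ ≤ Real.exp M * (a - b) :=
        mul_le_mul (Real.exp_le_exp.2 ha) (by linarith [Real.add_one_le_exp (b - a)])
          (sub_nonneg.2 (Real.exp_le_one_iff.2 (sub_nonpos.2 hba))) (Real.exp_pos M).le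

lemma abs_exp_neg_two_mul_max_sub_le (η η' : ℝ) :
    |Real.exp (-2 * max η (-1 / 2)) - Real.exp (-2 * max η' (-1 / 2))| ≤ 6 * |η - η'| :=
  calc |Real.exp (-2 * max η (-1 / 2)) - Real.exp (-2 * max η' (-1 / 2))|
      ≤ Real.exp 1 * |-2 * max η (-1 / 2) - -2 * max η' (-1 / 2)| :=
        abs_exp_sub_exp_le (by linarith [le_max_right η (-1 / 2)])
          (by linarith [le_max_right η' (-1 / 2)])
    _ = Real.exp 1 * (2 * |max η (-1 / 2) - max η' (-1 / 2)|) := by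
        rw [← mul_sub, abs_mul, abs_neg, abs_two]
    _ ≤ 3 * (2 * |η - η'|) :=
        mul_le_mul Real.exp_one_lt_three.le
          (mul_le_mul_of_nonneg_left (abs_max_sub_max_le_abs _ _ _) zero_le_two)
          (by positivity) zero_le_three
    _ = 6 * |η - η'| := by ring

lemma abs_spikeSpeed_sub_le (f f' η η' : ℝ) :
    |spikeSpeed f η - spikeSpeed f' η'| ≤ 2 * |η - η'| + 3 * |f - f'| := by
  unfold spikeSpeed
  set I : ℝ → Icc (0 : ℝ) (1 / 64) := projIcc 0 (1 / 64) (by norm_num)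
  set k : ℝ → ℝ := fun η => Real.exp (-2 * max η (-1 / 2))
  have hI : |(I f : ℝ) - I f'| ≤ |f - f'| := by
    simpa [Real.dist_eq, Subtype.dist_eq] using
      (LipschitzWith.projIcc (a := (0 : ℝ)) (b := 1 / 64) (by norm_num)).dist_le_mul f f'
  calc |max 0 (η + I f * k η) - max 0 (η' + I f' * k η')|
      ≤ |(η + I f * k η) - (η' + I f' * k η')| := by
        rw [max_comm 0, max_comm 0]; exact abs_max_sub_max_le_abs _ _ _
    _ = |(η - η') + I f * (k η - k η') + (I f - I f') * k η'| := by ring_nf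
    _ ≤ |η - η'| + |I f * (k η - k η')| + |(I f - I f') * k η'| := abs_add_three _ _ _
    _ ≤ |η - η'| + 1 / 64 * (6 * |η - η'|) + |f - f'| * 3 := by
        rw [abs_mul, abs_mul, abs_of_nonneg (I f).2.1, abs_of_pos (Real.exp_pos _ : 0 < k η')]
        gcongr
        · exact (I f).2.2
        · exact abs_exp_neg_two_mul_max_sub_le η η'
        · exact exp_neg_two_mul_max_le η'
    _ ≤ 2 * |η - η'| + 3 * |f - f'| := by linarith [abs_nonneg (η - η')]

lemma spikeSpeed_eq {f η : ℝ} (hf : f ∈ Icc 0 (1 / 64)) (hη : -1 / 2 ≤ η) :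
    spikeSpeed f η = max 0 (leafSpeed f η) := by
  rw [spikeSpeed, max_eq_left hη, projIcc_of_mem _ hf, leafSpeed]

lemma spikeSpeed_param_zero {η : ℝ} (hη : 0 ≤ η) : spikeSpeed 0 η = η := by
  rw [spikeSpeed_eq ⟨le_rfl, by norm_num⟩ (by linarith), leafSpeed, zero_mul, add_zero,
    max_eq_right hη]

lemma add_clamped_le (f η : ℝ) :
    η + projIcc 0 (1 / 64) (by norm_num) f * Real.exp (-2 * max η (-1 / 2)) ≤ η + 1 / 2 := by
  have hf := (projIcc (0 : ℝ) (1 / 64) (by norm_num) f).2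
  nlinarith [exp_neg_two_mul_max_le η, Real.exp_pos (-2 * max η (-1 / 2)), hf.1, hf.2]

lemma spikeSpeed_of_le {f η : ℝ} (hη : η ≤ -1 / 2) : spikeSpeed f η = 0 :=
  max_eq_left ((add_clamped_le f η).trans (by linarith))

lemma spikeSpeed_le_add_one {f η : ℝ} (hη : -1 / 2 ≤ η) : spikeSpeed f η ≤ η + 1 :=
  max_le (by linarith) ((add_clamped_le f η).trans (by linarith))

/-- The speed of the stretch flow as a vector field on the plane of all pairs of a leaf parameter
and a depth, so that its flow depends continuously on the parameter. -/
def spikeField (p : ℝ × ℝ) : ℝ × ℝ := (0, spikeSpeed p.1 p.2)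

lemma lipschitzWith_spikeField : LipschitzWith 5 spikeField :=
  LipschitzWith.of_dist_le_mul fun p q => by
    rw [Prod.dist_eq, Prod.dist_eq]
    simp only [spikeField, dist_self, dist_nonneg, sup_of_le_right]
    have hspeed := abs_spikeSpeed_sub_le p.1 q.1 p.2 q.2
    have hfst : |p.1 - q.1| ≤ |p.1 - q.1| ⊔ |p.2 - q.2| := le_sup_left
    have hsnd : |p.2 - q.2| ≤ |p.1 - q.1| ⊔ |p.2 - q.2| := le_sup_right
    simp only [Real.dist_eq, NNReal.coe_ofNat]
    linarith

/-- The depth reached at time `t` by the stretch flow from depth `η` on the leaf with parameter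
`f`. -/
def spikeFlow (f η t : ℝ) : ℝ := (lipschitzFlow lipschitzWith_spikeField (f, η) t).2

lemma lipschitzFlow_spikeField (f η t : ℝ) :
    lipschitzFlow lipschitzWith_spikeField (f, η) t = (f, spikeFlow f η t) := by
  have hderiv : ∀ s, HasDerivAt
      (fun s => (lipschitzFlow lipschitzWith_spikeField (f, η) s).1) 0 s := fun s =>
    (ContinuousLinearMap.fst ℝ ℝ ℝ).hasFDerivAt.comp_hasDerivAt s
      (lipschitzFlow.isIntegralCurve lipschitzWith_spikeField (f, η) s)
  have hconst := is_const_of_deriv_eq_zero (fun s => (hderiv s).differentiableAt)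
    (fun s => (hderiv s).deriv) t 0
  rw [lipschitzFlow.apply_zero] at hconst
  exact Prod.ext hconst rfl

lemma hasDerivAt_spikeFlow (f η t : ℝ) :
    HasDerivAt (spikeFlow f η) (spikeSpeed f (spikeFlow f η t)) t := by
  have h := (ContinuousLinearMap.snd ℝ ℝ ℝ).hasFDerivAt.comp_hasDerivAt t
    (lipschitzFlow.isIntegralCurve lipschitzWith_spikeField (f, η) t)
  rwa [lipschitzFlow_spikeField] at h

@[simp] lemma spikeFlow_zero (f η : ℝ) : spikeFlow f η 0 = η := by simp [spikeFlow]

lemma spikeFlow_add (f η s t : ℝ) :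
    spikeFlow f η (s + t) = spikeFlow f (spikeFlow f η s) t := by
  rw [spikeFlow.eq_def f η, lipschitzFlow.apply_add, lipschitzFlow_spikeField f η s]
  rfl

lemma continuous_spikeFlow (t : ℝ) : Continuous fun p : ℝ × ℝ => spikeFlow p.1 p.2 t :=
  continuous_snd.comp (lipschitzFlow.continuous lipschitzWith_spikeField t)

lemma spikeFlow_neg_cancel (f η t : ℝ) : spikeFlow f (spikeFlow f η t) (-t) = η := by
  rw [← spikeFlow_add, add_neg_cancel, spikeFlow_zero]

lemma spikeFlow_injective (f t : ℝ) : Function.Injective (spikeFlow f · t) :=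
  Function.LeftInverse.injective (g := (spikeFlow f · (-t))) (spikeFlow_neg_cancel f · t)

lemma spikeFlow_of_speed_eq_zero {f η : ℝ} (h : spikeSpeed f η = 0) (t : ℝ) :
    spikeFlow f η t = η := by
  have hfield : spikeField (f, η) = 0 := Prod.ext rfl h
  rw [spikeFlow, lipschitzFlow.apply_of_eq_zero _ hfield]

lemma spikeSpeed_spikeFlow_eq_zero_iff (f η t : ℝ) :
    spikeSpeed f (spikeFlow f η t) = 0 ↔ spikeSpeed f η = 0 := by
  refine ⟨fun h => ?_, fun h => by rwa [spikeFlow_of_speed_eq_zero h]⟩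
  have hfixed := spikeFlow_of_speed_eq_zero h (-t)
  rw [spikeFlow_neg_cancel] at hfixed
  rwa [← hfixed] at h

lemma neg_half_le_spikeFlow (f : ℝ) {η : ℝ} (hη : -1 / 2 ≤ η) (t : ℝ) :
    -1 / 2 ≤ spikeFlow f η t := by
  by_contra! h
  have hfixed := spikeFlow_of_speed_eq_zero (spikeSpeed_of_le (f := f) h.le) (-t)
  rw [spikeFlow_neg_cancel] at hfixed
  linarith

lemma spikeFlow_le (f : ℝ) {η t : ℝ} (hη : -1 / 2 ≤ η) (ht : 0 ≤ t) :
    spikeFlow f η t ≤ (η + 1) * Real.exp t := by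
  have h := le_exp_mul_of_hasDerivAt_le (k := 1) ht
    (fun s _ => (hasDerivAt_spikeFlow f η s).add_const 1) fun s _ => by
      linarith [spikeSpeed_le_add_one (f := f) (neg_half_le_spikeFlow f hη s)]
  rw [spikeFlow_zero, one_mul] at h
  linarith

lemma spikeFlow_param_zero {η : ℝ} (hη : 0 ≤ η) (t : ℝ) :
    spikeFlow 0 η t = η * Real.exp t := by
  have hcurve : IsIntegralCurve (fun t => ((0 : ℝ), η * Real.exp t)) fun _ => spikeField :=
    fun t => by
      have hfield : spikeField (0, η * Real.exp t) = (0, η * Real.exp t) :=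
        Prod.ext rfl (spikeSpeed_param_zero (by positivity))
      refine HasDerivAt.congr_deriv ?_ hfield.symm
      exact (hasDerivAt_const t 0).prodMk ((Real.hasDerivAt_exp t).const_mul η)
  have h := congrFun (lipschitzFlow.eq_of_isIntegralCurve lipschitzWith_spikeField hcurve) t
  simp only [Real.exp_zero, mul_one] at h
  rw [spikeFlow, h]

end

noncomputable section

open Set

/-! ### The two-point estimate in a spike -/

lemma sinh_le_mul_cosh {x : ℝ} (hx : 0 ≤ x) : Real.sinh x ≤ x * Real.cosh x := by
  have hderiv : ∀ x, HasDerivAt (fun x => x * Real.cosh x - Real.sinh x)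
      (1 * Real.cosh x + x * Real.sinh x - Real.cosh x) x := fun x =>
    ((hasDerivAt_id x).mul (Real.hasDerivAt_cosh x)).sub (Real.hasDerivAt_sinh x)
  have hmono : MonotoneOn (fun x => x * Real.cosh x - Real.sinh x) (Ici 0) := by
    refine monotoneOn_of_deriv_nonneg (convex_Ici 0)
      (fun x _ => (hderiv x).continuousAt.continuousWithinAt)
      (fun x _ => (hderiv x).differentiableAt.differentiableWithinAt) fun x hx => ?_
    rw [interior_Ici] at hx
    rw [(hderiv x).deriv]
    nlinarith [mul_nonneg (le_of_lt hx) (Real.sinh_nonneg_iff.2 (le_of_lt hx))]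
  simpa using hmono self_mem_Ici (mem_Ici.2 hx) hx

lemma mul_sinh_add_two_mul_cosh_sub_le {l d : ℝ} (hl : 0 ≤ l) (hd : l ≤ d) :
    l * Real.sinh l + 2 * (Real.cosh d - Real.cosh l) ≤ d * Real.sinh d := by
  have hderiv : ∀ x, HasDerivAt (fun x => x * Real.sinh x - 2 * Real.cosh x)
      (1 * Real.sinh x + x * Real.cosh x - 2 * Real.sinh x) x := fun x =>
    ((hasDerivAt_id x).mul (Real.hasDerivAt_sinh x)).sub ((Real.hasDerivAt_cosh x).const_mul 2)
  have hmono : MonotoneOn (fun x => x * Real.sinh x - 2 * Real.cosh x) (Ici 0) := by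
    refine monotoneOn_of_deriv_nonneg (convex_Ici 0)
      (fun x _ => (hderiv x).continuousAt.continuousWithinAt)
      (fun x _ => (hderiv x).differentiableAt.differentiableWithinAt) fun x hx => ?_
    rw [interior_Ici] at hx
    rw [(hderiv x).deriv]
    nlinarith [sinh_le_mul_cosh (le_of_lt hx)]
  have h := hmono (mem_Ici.2 hl) (mem_Ici.2 (hl.trans hd)) hd
  simp only at h
  linarith

-- Twice the left-hand side is `(φ₁ - φ₂) ^ 2 - (2 φ₂ sinh l - (φ₁ - φ₂) exp (-l)) ^ 2`.
lemma sq_mul_exp_sub_mul_sinh_le (φ₁ φ₂ : ℝ) {l : ℝ} (hl : 0 ≤ l) :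
    (φ₁ ^ 2 * Real.exp (-l) - φ₂ ^ 2 * Real.exp l) * Real.sinh l ≤
      (φ₁ - φ₂) ^ 2 - φ₂ ^ 2 * Real.sinh l ^ 2 := by
  have hmul : Real.exp l * Real.exp (-l) = 1 := by
    rw [← Real.exp_add, add_neg_cancel, Real.exp_zero]
  have heq : (φ₁ ^ 2 * Real.exp (-l) - φ₂ ^ 2 * Real.exp l) * Real.sinh l =
      ((φ₁ - φ₂) ^ 2 - (2 * φ₂ * Real.sinh l - (φ₁ - φ₂) * Real.exp (-l)) ^ 2) / 2 := by
    rw [Real.sinh_eq]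
    linear_combination ((φ₁ - φ₂) ^ 2 / 2) * hmul
  have hexp : Real.exp (-l) ^ 2 ≤ 1 :=
    pow_le_one₀ (Real.exp_pos _).le (Real.exp_le_one_iff.2 (neg_nonpos.2 hl))
  have hle : (φ₁ - φ₂) ^ 2 * Real.exp (-l) ^ 2 ≤ (φ₁ - φ₂) ^ 2 :=
    mul_le_of_le_one_right (sq_nonneg _) hexp
  rw [heq]
  nlinarith [sq_nonneg (φ₂ * Real.sinh l - (φ₁ - φ₂) * Real.exp (-l))]

/-- The hyperbolic cosine of the distance of two points in horocyclic coordinates `(x, η)` about an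
ideal vertex, where `η` is the depth and `Δ` is the difference of the coordinates `x`. -/
def horoCosh (Δ η₁ η₂ : ℝ) : ℝ :=
  Real.cosh (η₁ - η₂) + Δ ^ 2 * Real.exp (-η₁ - η₂) / 8

lemma one_le_horoCosh (Δ η₁ η₂ : ℝ) : 1 ≤ horoCosh Δ η₁ η₂ :=
  (Real.one_le_cosh _).trans (le_add_of_nonneg_right (by positivity))

lemma one_lt_horoCosh {Δ η₁ η₂ : ℝ} (h : Δ ≠ 0 ∨ η₁ ≠ η₂) : 1 < horoCosh Δ η₁ η₂ := by
  rcases h with h | h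
  · exact (Real.one_le_cosh _).trans_lt (lt_add_of_pos_right _ (by positivity))
  · exact (Real.one_lt_cosh.2 (sub_ne_zero.2 h)).trans_le
      (le_add_of_nonneg_right (by positivity))

section Derivative

variable {φ₁ φ₂ η₁ η₂ Δ d ε : ℝ}

lemma exp_mul_sq_sub_le (hφ : |φ₁ - φ₂| ≤ |Δ| / 4) :
    Real.exp (-η₁ - η₂) * (φ₁ - φ₂) ^ 2 ≤ Δ ^ 2 * Real.exp (-η₁ - η₂) / 8 / 2 := by
  have hsq : (φ₁ - φ₂) ^ 2 ≤ Δ ^ 2 / 16 := by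
    have h := pow_le_pow_left₀ (abs_nonneg _) hφ 2
    rw [div_pow, sq_abs, sq_abs] at h
    linarith
  linarith [mul_le_mul_of_nonneg_left hsq (Real.exp_pos (-η₁ - η₂)).le]

lemma sinh_mul_leafSpeed_sub_le_of_le (hφ : |φ₁ - φ₂| ≤ |Δ| / 4) (hη : η₂ ≤ η₁) (hd : 0 ≤ d)
    (hcosh : Real.cosh d = horoCosh Δ η₁ η₂) (hε : ε ≤ 1 / 2)
    (hεφ : ε ≤ Real.exp (-η₁ - η₂) * φ₂ ^ 2) :
    Real.sinh (η₁ - η₂) * (leafSpeed (φ₁ ^ 2) η₁ - leafSpeed (φ₂ ^ 2) η₂) ≤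
      (1 - ε) * (d * Real.sinh d) := by
  set l := η₁ - η₂ with hl
  set E := Real.exp (-η₁ - η₂) with hE
  have hl₀ : 0 ≤ l := sub_nonneg.2 hη
  have hδ : 0 ≤ Δ ^ 2 * E / 8 := by positivity
  have hld : l ≤ d := by
    have h := Real.cosh_le_cosh.1 ((le_add_of_nonneg_right hδ).trans_eq hcosh.symm)
    rwa [abs_of_nonneg hl₀, abs_of_nonneg hd] at h
  have hspeed : leafSpeed (φ₁ ^ 2) η₁ - leafSpeed (φ₂ ^ 2) η₂ =
      l + E * (φ₁ ^ 2 * Real.exp (-l) - φ₂ ^ 2 * Real.exp l) := by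
    have h₁ : Real.exp (-2 * η₁) = E * Real.exp (-l) := by rw [hE, ← Real.exp_add, hl]; ring_nf
    have h₂ : Real.exp (-2 * η₂) = E * Real.exp l := by rw [hE, ← Real.exp_add, hl]; ring_nf
    rw [leafSpeed, leafSpeed, h₁, h₂, hl]
    ring
  have hsinh : l * Real.sinh l ≤ Real.sinh l ^ 2 := by
    rw [sq]
    exact mul_le_mul_of_nonneg_right (Real.self_le_sinh_iff.2 hl₀) (Real.sinh_nonneg_iff.2 hl₀)
  calc Real.sinh l * (leafSpeed (φ₁ ^ 2) η₁ - leafSpeed (φ₂ ^ 2) η₂)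
      = l * Real.sinh l +
          E * ((φ₁ ^ 2 * Real.exp (-l) - φ₂ ^ 2 * Real.exp l) * Real.sinh l) := by
        rw [hspeed]; ring
    _ ≤ l * Real.sinh l + E * ((φ₁ - φ₂) ^ 2 - φ₂ ^ 2 * Real.sinh l ^ 2) := by
        gcongr
        exact sq_mul_exp_sub_mul_sinh_le φ₁ φ₂ hl₀
    _ = l * Real.sinh l + E * (φ₁ - φ₂) ^ 2 - E * φ₂ ^ 2 * Real.sinh l ^ 2 := by ring
    _ ≤ l * Real.sinh l + Δ ^ 2 * E / 8 / 2 - ε * (l * Real.sinh l) := by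
        have h := exp_mul_sq_sub_le (η₁ := η₁) (η₂ := η₂) hφ
        gcongr
    _ ≤ (1 - ε) * (l * Real.sinh l + 2 * (Δ ^ 2 * E / 8)) := by nlinarith
    _ ≤ (1 - ε) * (d * Real.sinh d) := by
        refine mul_le_mul_of_nonneg_left ?_ (by linarith)
        have h := mul_sinh_add_two_mul_cosh_sub_le hl₀ hld
        rwa [hcosh, horoCosh, add_sub_cancel_left] at h

lemma sinh_mul_leafSpeed_sub_le (hφ : |φ₁ - φ₂| ≤ |Δ| / 4) (hd : 0 ≤ d)
    (hcosh : Real.cosh d = horoCosh Δ η₁ η₂) (hε : ε ≤ 1 / 2)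
    (hεφ₁ : ε ≤ Real.exp (-η₁ - η₂) * φ₁ ^ 2) (hεφ₂ : ε ≤ Real.exp (-η₁ - η₂) * φ₂ ^ 2) :
    Real.sinh (η₁ - η₂) * (leafSpeed (φ₁ ^ 2) η₁ - leafSpeed (φ₂ ^ 2) η₂) ≤
      (1 - ε) * (d * Real.sinh d) := by
  rcases le_total η₂ η₁ with h | h
  · exact sinh_mul_leafSpeed_sub_le_of_le hφ h hd hcosh hε hεφ₂
  · have hexp : -η₁ - η₂ = -η₂ - η₁ := by ring
    have hsub : η₁ - η₂ = -(η₂ - η₁) := by ring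
    have hcosh' : Real.cosh d = horoCosh Δ η₂ η₁ := by
      rw [hcosh, horoCosh, horoCosh, hexp, hsub, Real.cosh_neg]
    have h' := sinh_mul_leafSpeed_sub_le_of_le (by rwa [abs_sub_comm]) h hd hcosh' hε
      (hexp ▸ hεφ₁)
    rw [hsub, Real.sinh_neg]
    linarith

lemma hasDerivAt_arcosh_horoCosh {a b : ℝ → ℝ} {a' b' s : ℝ} (ha : HasDerivAt a a' s)
    (hb : HasDerivAt b b' s) (h : 1 < horoCosh Δ (a s) (b s)) :
    HasDerivAt (fun s => Real.arcosh (horoCosh Δ (a s) (b s)))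
      ((Real.sinh (Real.arcosh (horoCosh Δ (a s) (b s))))⁻¹ *
        (Real.sinh (a s - b s) * (a' - b') -
          (a' + b') * (Δ ^ 2 * Real.exp (-a s - b s) / 8))) s := by
  have hcosh : HasDerivAt (fun s => horoCosh Δ (a s) (b s)) _ s :=
    (ha.sub hb).cosh.add (((ha.neg.sub hb).exp.const_mul (Δ ^ 2)).div_const 8)
  refine ((Real.hasDerivAt_arcosh h).comp s hcosh).congr_deriv ?_
  rw [Real.sinh_arcosh h.le]
  simp only [Pi.sub_apply, Pi.neg_apply]
  ring

end Derivative

section Flow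

variable {f η : ℝ}

lemma leafSpeed_spikeFlow_nonneg (hf : f ∈ Icc 0 (1 / 64)) (hη : -1 / 2 ≤ η)
    (hv : 0 ≤ leafSpeed f η) (t : ℝ) : 0 ≤ leafSpeed f (spikeFlow f η t) := by
  by_contra! hneg
  have hzero : spikeSpeed f (spikeFlow f η t) = 0 := by
    rw [spikeSpeed_eq hf (neg_half_le_spikeFlow f hη t), max_eq_left hneg.le]
  rw [spikeFlow_of_speed_eq_zero ((spikeSpeed_spikeFlow_eq_zero_iff f η t).1 hzero)] at hneg
  exact hneg.not_ge hv

lemma hasDerivAt_spikeFlow_leafSpeed (hf : f ∈ Icc 0 (1 / 64)) (hη : -1 / 2 ≤ η)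
    (hv : 0 ≤ leafSpeed f η) (t : ℝ) :
    HasDerivAt (spikeFlow f η) (leafSpeed f (spikeFlow f η t)) t := by
  have h := hasDerivAt_spikeFlow f η t
  rwa [spikeSpeed_eq hf (neg_half_le_spikeFlow f hη t),
    max_eq_right (leafSpeed_spikeFlow_nonneg hf hη hv t)] at h

theorem arcosh_horoCosh_spikeFlow_le {φ₁ φ₂ η₁ η₂ Δ ε t : ℝ} (hφ₁ : φ₁ ^ 2 ≤ 1 / 64)
    (hφ₂ : φ₂ ^ 2 ≤ 1 / 64) (hφ : |φ₁ - φ₂| ≤ |Δ| / 4) (hη₁ : -1 / 2 ≤ η₁) (hη₂ : -1 / 2 ≤ η₂)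
    (hv₁ : 0 ≤ leafSpeed (φ₁ ^ 2) η₁) (hv₂ : 0 ≤ leafSpeed (φ₂ ^ 2) η₂)
    (ht : 0 ≤ t) (hε : ε ≤ 1 / 2)
    (hε₁ : ∀ s ∈ Icc 0 t, ε ≤
      Real.exp (-spikeFlow (φ₁ ^ 2) η₁ s - spikeFlow (φ₂ ^ 2) η₂ s) * φ₁ ^ 2)
    (hε₂ : ∀ s ∈ Icc 0 t, ε ≤
      Real.exp (-spikeFlow (φ₁ ^ 2) η₁ s - spikeFlow (φ₂ ^ 2) η₂ s) * φ₂ ^ 2) :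
    Real.arcosh (horoCosh Δ (spikeFlow (φ₁ ^ 2) η₁ t) (spikeFlow (φ₂ ^ 2) η₂ t)) ≤
      Real.exp ((1 - ε) * t) * Real.arcosh (horoCosh Δ η₁ η₂) := by
  have hf₁ : φ₁ ^ 2 ∈ Icc (0 : ℝ) (1 / 64) := ⟨sq_nonneg _, hφ₁⟩
  have hf₂ : φ₂ ^ 2 ∈ Icc (0 : ℝ) (1 / 64) := ⟨sq_nonneg _, hφ₂⟩
  have hleaf : Δ = 0 → φ₁ = φ₂ := by rintro rfl; simpa [sub_eq_zero] using hφ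
  by_cases hne : Δ ≠ 0 ∨ η₁ ≠ η₂
  swap
  · push Not at hne
    obtain ⟨rfl, rfl⟩ := hne
    simp [horoCosh, hleaf rfl]
  have hlt : ∀ s, 1 < horoCosh Δ (spikeFlow (φ₁ ^ 2) η₁ s) (spikeFlow (φ₂ ^ 2) η₂ s) := by
    refine fun s => one_lt_horoCosh (or_iff_not_imp_left.2 fun hΔ heq => ?_)
    rw [hleaf (not_not.1 hΔ)] at heq
    exact (hne.resolve_left hΔ) (spikeFlow_injective _ _ heq)
  have h := le_exp_mul_of_hasDerivAt_le (k := 1 - ε) ht (fun s _ => hasDerivAt_arcosh_horoCosh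
    (hasDerivAt_spikeFlow_leafSpeed hf₁ hη₁ hv₁ s)
    (hasDerivAt_spikeFlow_leafSpeed hf₂ hη₂ hv₂ s) (hlt s)) fun s hs => by
      have hd : 0 < Real.arcosh (horoCosh Δ (spikeFlow (φ₁ ^ 2) η₁ s) (spikeFlow (φ₂ ^ 2) η₂ s)) :=
        Real.arcosh_pos (hlt s)
      have hcross := mul_nonneg (add_nonneg (leafSpeed_spikeFlow_nonneg hf₁ hη₁ hv₁ s)
        (leafSpeed_spikeFlow_nonneg hf₂ hη₂ hv₂ s)) (show 0 ≤ Δ ^ 2 *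
          Real.exp (-spikeFlow (φ₁ ^ 2) η₁ s - spikeFlow (φ₂ ^ 2) η₂ s) / 8 by positivity)
      rw [inv_mul_le_iff₀ (Real.sinh_pos_iff.2 hd)]
      linarith [sinh_mul_leafSpeed_sub_le hφ hd.le (Real.cosh_arcosh (hlt s).le) hε
        (hε₁ s hs) (hε₂ s hs)]
  simpa only [spikeFlow_zero] using h

end Flow

end

noncomputable section

open Set

/-! ### Barycentric coordinates of the points of an ideal triangle -/

lemma fin_three_forall_iff {P : Fin 3 → Prop} (i : Fin 3) :
    (∀ k, P k) ↔ P i ∧ P (i + 1) ∧ P (i + 2) := by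
  refine ⟨fun h => ⟨h _, h _, h _⟩, fun ⟨hself, hone, htwo⟩ k => ?_⟩
  fin_cases i <;> fin_cases k <;> assumption

lemma sum_fin_three_cyclic {M : Type*} [AddCommMonoid M] (f : Fin 3 → M) (i : Fin 3) :
    ∑ k, f k = f i + f (i + 1) + f (i + 2) := by
  rw [Fin.sum_univ_three]
  fin_cases i <;> simp only [Fin.reduceFinMk, Fin.reduceAdd, Fin.zero_eta, Fin.mk_one, zero_add] <;>
    abel

lemma fin_three_add_add (k : Fin 3) :
    k + 1 + 1 = k + 2 ∧ k + 1 + 2 = k ∧ k + 2 + 1 = k ∧ k + 2 + 2 = k + 1 := by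
  decide +revert

lemma fin_three_ne_add (k : Fin 3) : k + 1 ≠ k ∧ k + 2 ≠ k ∧ k + 2 ≠ k + 1 := by
  decide +revert

lemma fin_three_eq_add_of_ne {k l : Fin 3} (h : l ≠ k) : l = k + 1 ∨ l = k + 2 := by
  decide +revert

/-- Coordinates of the points of an ideal triangle with respect to null vectors `u k` that span its
ideal vertices and satisfy `⟨u i, u j⟩ = -2` for `i ≠ j`. -/
abbrev Bary : Type :=
  {a : Fin 3 → ℝ // (∀ k, 0 ≤ a k) ∧ 4 * (a 0 * a 1 + a 1 * a 2 + a 2 * a 0) = 1}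

namespace Bary

lemma nonneg (a : Bary) (k : Fin 3) : 0 ≤ a.1 k := a.2.1 k

lemma norm_eq (a : Bary) (k : Fin 3) :
    4 * (a.1 k * (a.1 (k + 1) + a.1 (k + 2)) + a.1 (k + 1) * a.1 (k + 2)) = 1 := by
  have h := a.2.2
  fin_cases k <;> simp only [Fin.reduceFinMk, Fin.reduceAdd] <;> linarith

lemma norm_of_cyclic {a : Fin 3 → ℝ} (k : Fin 3)
    (h : 4 * (a k * (a (k + 1) + a (k + 2)) + a (k + 1) * a (k + 2)) = 1) :
    4 * (a 0 * a 1 + a 1 * a 2 + a 2 * a 0) = 1 := by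
  fin_cases k <;> simp only [Fin.reduceFinMk, Fin.reduceAdd] at h <;> linarith

lemma ext_cyclic {a b : Bary} (k : Fin 3) (hself : a.1 k = b.1 k)
    (hone : a.1 (k + 1) = b.1 (k + 1)) (htwo : a.1 (k + 2) = b.1 (k + 2)) : a = b := by
  refine Subtype.ext (funext fun j => ?_)
  obtain rfl | hj := eq_or_ne j k
  · exact hself
  · obtain rfl | rfl := fin_three_eq_add_of_ne hj
    exacts [hone, htwo]

/-- The hyperbolic cosine of the distance of two points of the triangle. -/
def coshDist (a b : Bary) : ℝ :=
  2 * (a.1 0 * b.1 1 + a.1 1 * b.1 0 + a.1 1 * b.1 2 + a.1 2 * b.1 1 + a.1 2 * b.1 0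
    + a.1 0 * b.1 2)

lemma coshDist_eq (a b : Bary) (k : Fin 3) : coshDist a b =
    2 * (a.1 k * (b.1 (k + 1) + b.1 (k + 2)) + b.1 k * (a.1 (k + 1) + a.1 (k + 2))
      + a.1 (k + 1) * b.1 (k + 2) + a.1 (k + 2) * b.1 (k + 1)) := by
  fin_cases k <;> simp only [Fin.reduceFinMk, Fin.reduceAdd, coshDist] <;> ring

/-- The hyperbolic distance of two points of the triangle. -/
def hypDist (a b : Bary) : ℝ := Real.arcosh (coshDist a b)

/-- The size of the horocycle about the vertex `k` through a point: half the length of its arc in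
the triangle. -/
def size (k : Fin 3) (a : Bary) : ℝ := a.1 (k + 1) + a.1 (k + 2)

lemma size_pos (k : Fin 3) (a : Bary) : 0 < size k a := by
  refine (add_nonneg (a.nonneg _) (a.nonneg _)).lt_of_ne fun hzero => ?_
  obtain ⟨hone, htwo⟩ :=
    (add_eq_zero_iff_of_nonneg (a.nonneg (k + 1)) (a.nonneg (k + 2))).1 hzero.symm
  have h := a.norm_eq k
  rw [hone, htwo] at h
  norm_num at h

/-- The horizontal coordinate in the spike at the vertex `k`: it takes values in `[-1, 1]` and is
constant along the geodesics to `k`. -/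
def horo (k : Fin 3) (a : Bary) : ℝ := (a.1 (k + 1) - a.1 (k + 2)) / size k a

/-- The depth of a point in the spike at the vertex `k`: its signed distance, towards `k`, from the
horocycle about `k` through the distinguished points of the two sides. -/
def depth (k : Fin 3) (a : Bary) : ℝ := -Real.log (2 * size k a)

lemma exp_depth (k : Fin 3) (a : Bary) : Real.exp (depth k a) = (2 * size k a)⁻¹ := by
  rw [depth, Real.exp_neg, Real.exp_log (mul_pos two_pos (size_pos k a))]

lemma exp_neg_depth (k : Fin 3) (a : Bary) : Real.exp (-depth k a) = 2 * size k a := by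
  rw [Real.exp_neg, exp_depth, inv_inv]

lemma exp_depth_sub_depth (k : Fin 3) (a b : Bary) :
    Real.exp (depth k a - depth k b) = size k b / size k a := by
  have ha := size_pos k a
  rw [sub_eq_add_neg, Real.exp_add, exp_depth, exp_neg_depth]
  field_simp

lemma exp_neg_depth_sub_depth (k : Fin 3) (a b : Bary) :
    Real.exp (-depth k a - depth k b) = 4 * size k a * size k b := by
  rw [sub_eq_add_neg, Real.exp_add, exp_neg_depth, exp_neg_depth]
  ring

lemma horoCosh_horo_depth (k : Fin 3) (a b : Bary) :
    horoCosh (horo k a - horo k b) (depth k a) (depth k b) =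
      (size k b / size k a + size k a / size k b) / 2 +
        (horo k a - horo k b) ^ 2 * (size k a * size k b) / 2 := by
  rw [horoCosh, Real.cosh_eq, neg_sub, exp_depth_sub_depth, exp_depth_sub_depth,
    exp_neg_depth_sub_depth]
  ring

lemma coord_add_one (k : Fin 3) (a : Bary) : a.1 (k + 1) = size k a * (1 + horo k a) / 2 := by
  have := (size_pos k a).ne'
  rw [horo]; field_simp; rw [size]; ring

lemma coord_add_two (k : Fin 3) (a : Bary) : a.1 (k + 2) = size k a * (1 - horo k a) / 2 := by
  have := (size_pos k a).ne'
  rw [horo]; field_simp; rw [size]; ring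

lemma coord_self (k : Fin 3) (a : Bary) :
    a.1 k = (4 * size k a)⁻¹ - size k a * (1 - horo k a ^ 2) / 4 := by
  have h := a.norm_eq k
  have hs := (size_pos k a).ne'
  have e : a.1 (k + 1) + a.1 (k + 2) = size k a := rfl
  rw [e, coord_add_one, coord_add_two] at h
  field_simp
  linarith

lemma abs_horo_le (k : Fin 3) (a : Bary) : |horo k a| ≤ 1 := by
  have hs := size_pos k a
  have h1 := a.nonneg (k + 1)
  have h2 := a.nonneg (k + 2)
  rw [horo, abs_div, abs_of_pos hs, div_le_one hs, abs_le, size]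
  constructor <;> linarith

lemma coshDist_eq_horoCosh (k : Fin 3) (a b : Bary) :
    coshDist a b = horoCosh (horo k a - horo k b) (depth k a) (depth k b) := by
  have ha := size_pos k a
  have hb := size_pos k b
  rw [horoCosh_horo_depth, coshDist_eq a b k, coord_add_one k a, coord_add_two k a, coord_self k a,
    coord_add_one k b, coord_add_two k b, coord_self k b]
  field_simp
  ring

lemma one_le_coshDist (a b : Bary) : 1 ≤ coshDist a b := by
  rw [coshDist_eq_horoCosh 0]; exact one_le_horoCosh _ _ _

lemma cosh_hypDist (a b : Bary) : Real.cosh (hypDist a b) = coshDist a b :=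
  Real.cosh_arcosh (one_le_coshDist a b)

lemma hypDist_nonneg (a b : Bary) : 0 ≤ hypDist a b := Real.arcosh_nonneg (one_le_coshDist a b)

lemma hypDist_eq_of_cosh {a b : Bary} {d : ℝ} (hd : 0 ≤ d) (h : Real.cosh d = coshDist a b) :
    hypDist a b = d := by rw [hypDist, ← h, Real.arcosh_cosh hd]

lemma hypDist_comm (a b : Bary) : hypDist a b = hypDist b a := by
  rw [hypDist, hypDist, coshDist, coshDist]; congr 1; ring

/-- The isometry onto the ideal triangle with vertices `∞`, `1`, `-1` of the upper half-plane, where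
the vertex `0` lies at infinity. -/
def toHalfPlane (a : Bary) : UpperHalfPlane :=
  ⟨⟨horo 0 a, (size 0 a)⁻¹⟩, inv_pos.2 (size_pos 0 a)⟩

lemma hypDist_eq_dist (a b : Bary) : hypDist a b = dist (toHalfPlane a) (toHalfPlane b) := by
  refine hypDist_eq_of_cosh dist_nonneg ?_
  have ha := size_pos 0 a
  have hb := size_pos 0 b
  rw [UpperHalfPlane.cosh_dist', coshDist_eq_horoCosh 0, horoCosh_horo_depth]
  simp only [toHalfPlane, UpperHalfPlane.re, UpperHalfPlane.im]
  field_simp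
  ring

lemma hypDist_triangle (a b c : Bary) : hypDist a c ≤ hypDist a b + hypDist b c := by
  simp only [hypDist_eq_dist]; exact dist_triangle _ _ _

lemma continuous_coord (k : Fin 3) : Continuous fun a : Bary => a.1 k :=
  (continuous_apply k).comp continuous_subtype_val

lemma continuous_size (k : Fin 3) : Continuous (size k) :=
  (continuous_coord _).add (continuous_coord _)

lemma continuous_horo (k : Fin 3) : Continuous (horo k) :=
  ((continuous_coord _).sub (continuous_coord _)).div (continuous_size k)
    fun a => (size_pos k a).ne'

lemma continuous_depth (k : Fin 3) : Continuous (depth k) :=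
  (((continuous_size k).const_mul 2).log fun a => (mul_pos two_pos (size_pos k a)).ne').neg

/-- The point with given horocyclic coordinates in the spike at the vertex `k`. -/
def ofHoro (k : Fin 3) (x η : ℝ) (hx : |x| ≤ 1) (hη : (1 - x ^ 2) / 4 ≤ Real.exp (2 * η)) :
    Bary :=
  ⟨fun j => if j = k then Real.exp η / 2 - Real.exp (-η) * (1 - x ^ 2) / 8
    else if j = k + 1 then Real.exp (-η) * (1 + x) / 4 else Real.exp (-η) * (1 - x) / 4, by
    have hmul : Real.exp η * Real.exp (-η) = 1 := by simp [← Real.exp_add]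
    have hself : Real.exp (-η) * (1 - x ^ 2) / 8 ≤ Real.exp η / 2 := by
      have h := mul_le_mul_of_nonneg_right hη (Real.exp_pos (-η)).le
      rw [← Real.exp_add, show 2 * η + -η = η by ring] at h
      linarith
    have hone : 0 ≤ 1 + x := by linarith [(abs_le.1 hx).1]
    have htwo : 0 ≤ 1 - x := by linarith [(abs_le.1 hx).2]
    have hk := fin_three_ne_add k
    refine ⟨fun j => ?_, ?_⟩
    · dsimp only
      split_ifs
      exacts [sub_nonneg.2 hself, by positivity, by positivity]
    · refine norm_of_cyclic (a := fun j => if j = k then _ else if j = k + 1 then _ else _) k ?_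
      simp only [if_true, if_neg hk.1, if_neg hk.2.1, if_neg hk.2.2]
      linear_combination hmul⟩

section OfHoro

variable {k : Fin 3} {x η : ℝ} {hx : |x| ≤ 1} {hη : (1 - x ^ 2) / 4 ≤ Real.exp (2 * η)}

lemma ofHoro_add_one : (ofHoro k x η hx hη).1 (k + 1) = Real.exp (-η) * (1 + x) / 4 := by
  simp [ofHoro]

lemma ofHoro_add_two : (ofHoro k x η hx hη).1 (k + 2) = Real.exp (-η) * (1 - x) / 4 := by
  obtain ⟨-, hself, hone⟩ := fin_three_ne_add k
  simp only [ofHoro, if_neg hself, if_neg hone]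

lemma size_ofHoro : size k (ofHoro k x η hx hη) = Real.exp (-η) / 2 := by
  rw [size, ofHoro_add_one, ofHoro_add_two]; ring

lemma horo_ofHoro : horo k (ofHoro k x η hx hη) = x := by
  have := Real.exp_pos (-η)
  rw [horo, size_ofHoro, ofHoro_add_one, ofHoro_add_two]; field_simp; ring

lemma depth_ofHoro : depth k (ofHoro k x η hx hη) = η := by
  rw [depth, size_ofHoro, mul_div_cancel₀ _ two_ne_zero, Real.log_exp, neg_neg]

end OfHoro

lemma ext_horo {a b : Bary} (k : Fin 3) (hhoro : horo k a = horo k b)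
    (hdepth : depth k a = depth k b) : a = b := by
  have hsize : size k a = size k b := by
    have h := exp_neg_depth k a
    rw [hdepth, exp_neg_depth] at h
    linarith
  refine ext_cyclic k ?_ ?_ ?_
  · rw [coord_self, coord_self k b, hhoro, hsize]
  · rw [coord_add_one, coord_add_one k b, hhoro, hsize]
  · rw [coord_add_two, coord_add_two k b, hhoro, hsize]

/-! ### The stretch flow in a spike -/

/-- The square root of the parameter of the flow on a leaf `horo k = const`. It vanishes on the
sides of the triangle and is positive in between. -/
def leafParam (k : Fin 3) (a : Bary) : ℝ := (1 - horo k a ^ 2) / 16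

lemma horo_sq_le (k : Fin 3) (a : Bary) : horo k a ^ 2 ≤ 1 :=
  (sq_le_one_iff_abs_le_one _).2 (abs_horo_le k a)

lemma leafParam_nonneg (k : Fin 3) (a : Bary) : 0 ≤ leafParam k a :=
  div_nonneg (sub_nonneg.2 (horo_sq_le k a)) (by norm_num)

lemma leafParam_sq_mem (k : Fin 3) (a : Bary) : leafParam k a ^ 2 ∈ Icc (0 : ℝ) (1 / 64) := by
  have hle : leafParam k a ≤ 1 / 16 :=
    div_le_div_of_nonneg_right (sub_le_self _ (sq_nonneg _)) (by norm_num)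
  exact ⟨sq_nonneg _, by nlinarith [leafParam_nonneg k a]⟩

lemma abs_leafParam_sub_le (k : Fin 3) (a b : Bary) :
    |leafParam k a - leafParam k b| ≤ |horo k a - horo k b| / 4 := by
  have heq : leafParam k a - leafParam k b =
      -((horo k a + horo k b) * (horo k a - horo k b) / 16) := by unfold leafParam; ring
  have hsum : |horo k a + horo k b| ≤ 2 :=
    (abs_add_le _ _).trans (by linarith [abs_horo_le k a, abs_horo_le k b])
  rw [heq, abs_neg, abs_div, abs_mul, abs_of_pos (show (0 : ℝ) < 16 by norm_num)]
  linarith [mul_le_mul_of_nonneg_right hsum (abs_nonneg (horo k a - horo k b)),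
    abs_nonneg (horo k a - horo k b)]

/-- The depth that the stretch flow reaches from a point in time `t`. -/
def flowDepth (k : Fin 3) (t : ℝ) (a : Bary) : ℝ := spikeFlow (leafParam k a ^ 2) (depth k a) t

lemma exp_two_mul_depth (k : Fin 3) (a : Bary) :
    Real.exp (2 * depth k a) = (4 * size k a)⁻¹ * (size k a)⁻¹ := by
  rw [two_mul, Real.exp_add, exp_depth]
  field_simp
  norm_num

lemma coord_self_eq_size_mul (k : Fin 3) (a : Bary) :
    a.1 k = size k a * (Real.exp (2 * depth k a) - (1 - horo k a ^ 2) / 4) := by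
  have hs := (size_pos k a).ne'
  rw [coord_self, exp_two_mul_depth]
  field_simp

lemma le_exp_two_mul_depth (k : Fin 3) (a : Bary) :
    (1 - horo k a ^ 2) / 4 ≤ Real.exp (2 * depth k a) :=
  sub_nonneg.1 (nonneg_of_mul_nonneg_right (coord_self_eq_size_mul k a ▸ a.nonneg k)
    (size_pos k a))

lemma one_third_le_exp_two_mul {η : ℝ} (hη : -1 / 2 ≤ η) : 1 / 3 ≤ Real.exp (2 * η) := by
  have h : Real.exp (-1) ≤ Real.exp (2 * η) := Real.exp_le_exp.2 (by linarith)
  linarith [Real.exp_neg_one_gt_d9]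

lemma le_exp_two_mul_flowDepth (k : Fin 3) (t : ℝ) (a : Bary) :
    (1 - horo k a ^ 2) / 4 ≤ Real.exp (2 * flowDepth k t a) := by
  rcases le_total (-1 / 2) (depth k a) with h | h
  · have hexp := one_third_le_exp_two_mul (neg_half_le_spikeFlow (leafParam k a ^ 2) h t)
    rw [flowDepth]
    linarith [sq_nonneg (horo k a)]
  · rw [flowDepth, spikeFlow_of_speed_eq_zero (spikeSpeed_of_le h)]
    exact le_exp_two_mul_depth k a

/-- The time `t` map of the stretch flow in the spike at the vertex `k`. It is the identity off
that spike. -/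
def spikeMap (k : Fin 3) (t : ℝ) (a : Bary) : Bary :=
  ofHoro k (horo k a) (flowDepth k t a) (abs_horo_le k a) (le_exp_two_mul_flowDepth k t a)

@[simp] lemma horo_spikeMap (k : Fin 3) (t : ℝ) (a : Bary) :
    horo k (spikeMap k t a) = horo k a := horo_ofHoro

@[simp] lemma depth_spikeMap (k : Fin 3) (t : ℝ) (a : Bary) :
    depth k (spikeMap k t a) = flowDepth k t a := depth_ofHoro

@[simp] lemma leafParam_spikeMap (k : Fin 3) (t : ℝ) (a : Bary) :
    leafParam k (spikeMap k t a) = leafParam k a := by simp [leafParam]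

lemma spikeMap_zero (k : Fin 3) (a : Bary) : spikeMap k 0 a = a :=
  ext_horo k (by simp) (by simp [flowDepth])

lemma spikeMap_add (k : Fin 3) (s t : ℝ) (a : Bary) :
    spikeMap k (s + t) a = spikeMap k t (spikeMap k s a) :=
  ext_horo k (by simp) (by simp [flowDepth, spikeFlow_add])

lemma continuous_leafParam (k : Fin 3) : Continuous (leafParam k) :=
  (continuous_const.sub ((continuous_horo k).pow 2)).div_const 16

lemma continuous_flowDepth (k : Fin 3) (t : ℝ) : Continuous (flowDepth k t) :=
  (continuous_spikeFlow t).comp (((continuous_leafParam k).pow 2).prodMk (continuous_depth k))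

lemma continuous_spikeMap (k : Fin 3) (t : ℝ) : Continuous (spikeMap k t) := by
  refine Continuous.subtype_mk (continuous_pi fun j => ?_) _
  have hdepth := continuous_flowDepth k t
  have hhoro := continuous_horo k
  split_ifs <;> fun_prop

/-- The map `spikeMap k t` as a homeomorphism. -/
def spikeHomeo (k : Fin 3) (t : ℝ) : Bary ≃ₜ Bary where
  toFun := spikeMap k t
  invFun := spikeMap k (-t)
  left_inv a := by rw [← spikeMap_add, add_neg_cancel, spikeMap_zero]
  right_inv a := by rw [← spikeMap_add, neg_add_cancel, spikeMap_zero]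
  continuous_toFun := continuous_spikeMap k t
  continuous_invFun := continuous_spikeMap k (-t)

/-- The speed, at a point of the triangle, of the stretch flow in the spike at the vertex `k`. -/
def speed (k : Fin 3) (a : Bary) : ℝ := spikeSpeed (leafParam k a ^ 2) (depth k a)

lemma spikeMap_of_speed_eq_zero {k : Fin 3} {a : Bary} (h : speed k a = 0) (t : ℝ) :
    spikeMap k t a = a :=
  ext_horo k (by simp) (by rw [depth_spikeMap, flowDepth, spikeFlow_of_speed_eq_zero h])

lemma speed_spikeMap_eq_zero_iff {k : Fin 3} {a : Bary} {t : ℝ} :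
    speed k (spikeMap k t a) = 0 ↔ speed k a = 0 := by
  simp only [speed, leafParam_spikeMap, depth_spikeMap, flowDepth]
  exact spikeSpeed_spikeFlow_eq_zero_iff _ _ _

/-- The closed region of the spike at the vertex `k` in which the flow is not cut off. -/
def InSpike (k : Fin 3) (a : Bary) : Prop :=
  -1 / 2 ≤ depth k a ∧ 0 ≤ leafSpeed (leafParam k a ^ 2) (depth k a)

lemma leafSpeed_pos_of_speed_ne_zero {k : Fin 3} {a : Bary} (h : speed k a ≠ 0) :
    -1 / 2 ≤ depth k a ∧ 0 < leafSpeed (leafParam k a ^ 2) (depth k a) := by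
  have hdepth : -1 / 2 ≤ depth k a := by
    by_contra! hlt
    exact h (spikeSpeed_of_le hlt.le)
  refine ⟨hdepth, ?_⟩
  by_contra! hle
  rw [speed, spikeSpeed_eq (leafParam_sq_mem k a) hdepth] at h
  exact h (max_eq_left hle)

lemma two_mul_leafSpeed_le {y η : ℝ} (hy : |y| ≤ 1) (hη : -1 / 2 ≤ η) :
    2 * leafSpeed (((1 - y ^ 2) / 16) ^ 2) η ≤
      Real.exp (2 * η) - (1 - y ^ 2) / 4 - (1 + y) / 2 := by
  obtain ⟨hy₁, hy₂⟩ := abs_le.1 hy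
  have hlog : 2 * η ≤ Real.exp (2 * η) - 1 := by linarith [Real.add_one_le_exp (2 * η)]
  have hparam : ((1 - y ^ 2) / 16) ^ 2 ≤ (1 - y) ^ 2 / 64 := by
    have h : (1 + y) ^ 2 ≤ 4 := by nlinarith
    nlinarith [mul_le_mul_of_nonneg_left h (sq_nonneg (1 - y))]
  have hexp : Real.exp (-2 * η) ≤ 3 := by
    rw [neg_mul, Real.exp_neg]
    exact inv_le_of_inv_le₀ three_pos (by linarith [one_third_le_exp_two_mul hη])
  have hmul := mul_le_mul hparam hexp (Real.exp_pos _).le (by positivity)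
  unfold leafSpeed
  linarith [sq_nonneg (1 - y)]

lemma leafSpeed_mul_size_le {k : Fin 3} {a : Bary} (hdepth : -1 / 2 ≤ depth k a) :
    2 * leafSpeed (leafParam k a ^ 2) (depth k a) * size k a ≤ a.1 k - a.1 (k + 1) ∧
      2 * leafSpeed (leafParam k a ^ 2) (depth k a) * size k a ≤ a.1 k - a.1 (k + 2) := by
  have hsize := (size_pos k a).le
  have hone := two_mul_leafSpeed_le (abs_horo_le k a) hdepth
  have htwo := two_mul_leafSpeed_le ((abs_neg (horo k a)).trans_le (abs_horo_le k a)) hdepth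
  rw [neg_sq, ← sub_eq_add_neg] at htwo
  rw [coord_add_one, coord_add_two, coord_self_eq_size_mul]
  exact ⟨(mul_le_mul_of_nonneg_right hone hsize).trans_eq (by ring),
    (mul_le_mul_of_nonneg_right htwo hsize).trans_eq (by ring)⟩

lemma InSpike.le {k l : Fin 3} {a : Bary} (h : InSpike k a) (hl : l ≠ k) : a.1 l ≤ a.1 k := by
  have hnonneg := mul_nonneg (mul_nonneg zero_le_two h.2) (size_pos k a).le
  obtain ⟨hone, htwo⟩ := leafSpeed_mul_size_le h.1
  obtain rfl | rfl := fin_three_eq_add_of_ne hl <;> linarith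

lemma lt_of_speed_ne_zero {k l : Fin 3} {a : Bary} (h : speed k a ≠ 0) (hl : l ≠ k) :
    a.1 l < a.1 k := by
  obtain ⟨hdepth, hspeed⟩ := leafSpeed_pos_of_speed_ne_zero h
  have hpos := mul_pos (mul_pos two_pos hspeed) (size_pos k a)
  obtain ⟨hone, htwo⟩ := leafSpeed_mul_size_le hdepth
  obtain rfl | rfl := fin_three_eq_add_of_ne hl <;> linarith

-- The bisectors of the triangle separate the supports of the three spike flows.
lemma InSpike.speed_eq_zero {k l : Fin 3} {a : Bary} (h : InSpike k a) (hl : l ≠ k) :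
    speed l a = 0 := by
  by_contra hspeed
  exact (h.le hl).not_gt (lt_of_speed_ne_zero hspeed hl.symm)

lemma inSpike_of_speed_ne_zero {k : Fin 3} {a : Bary} (h : speed k a ≠ 0) : InSpike k a :=
  ⟨(leafSpeed_pos_of_speed_ne_zero h).1, (leafSpeed_pos_of_speed_ne_zero h).2.le⟩

lemma speed_eq_zero_of_ne {k l : Fin 3} {a : Bary} (h : speed k a ≠ 0) (hl : l ≠ k) :
    speed l a = 0 :=
  (inSpike_of_speed_ne_zero h).speed_eq_zero hl

/-- The time `t` map of the stretch flow on an ideal triangle. It multiplies the arclength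
parameters of the sides by `exp t`. The three factors have disjoint supports. -/
def stretch (t : ℝ) : Bary ≃ₜ Bary :=
  (spikeHomeo 0 t).trans ((spikeHomeo 1 t).trans (spikeHomeo 2 t))

lemma stretch_apply (t : ℝ) (a : Bary) :
    stretch t a = spikeMap 2 t (spikeMap 1 t (spikeMap 0 t a)) := rfl

lemma stretch_of_speed_ne_zero {k : Fin 3} {a : Bary} (h : speed k a ≠ 0) (t : ℝ) :
    stretch t a = spikeMap k t a := by
  have h' : speed k (spikeMap k t a) ≠ 0 := fun h0 => h (speed_spikeMap_eq_zero_iff.1 h0)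
  rw [stretch_apply]
  fin_cases k <;> simp only [Fin.zero_eta, Fin.mk_one, Fin.reduceFinMk] at *
  · rw [spikeMap_of_speed_eq_zero (k := 1) (speed_eq_zero_of_ne h' (by decide)),
      spikeMap_of_speed_eq_zero (k := 2) (speed_eq_zero_of_ne h' (by decide))]
  · rw [spikeMap_of_speed_eq_zero (k := 0) (speed_eq_zero_of_ne h (by decide)),
      spikeMap_of_speed_eq_zero (k := 2) (speed_eq_zero_of_ne h' (by decide))]
  · rw [spikeMap_of_speed_eq_zero (k := 0) (speed_eq_zero_of_ne h (by decide)),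
      spikeMap_of_speed_eq_zero (k := 1) (speed_eq_zero_of_ne h (by decide))]

lemma stretch_of_speed_eq_zero {a : Bary} (h : ∀ k, speed k a = 0) (t : ℝ) : stretch t a = a := by
  rw [stretch_apply, spikeMap_of_speed_eq_zero (h 0), spikeMap_of_speed_eq_zero (h 1),
    spikeMap_of_speed_eq_zero (h 2)]

lemma stretch_add (s t : ℝ) (a : Bary) : stretch (s + t) a = stretch t (stretch s a) := by
  by_cases h : ∀ k, speed k a = 0
  · simp only [stretch_of_speed_eq_zero h]
  · push Not at h
    obtain ⟨k, hk⟩ := h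
    rw [stretch_of_speed_ne_zero hk, stretch_of_speed_ne_zero hk, stretch_of_speed_ne_zero (k := k)
      (fun h0 => hk (speed_spikeMap_eq_zero_iff.1 h0)), spikeMap_add]

lemma stretch_zero (a : Bary) : stretch 0 a = a := by
  simp [stretch_apply, spikeMap_zero]

lemma stretch_symm_apply (t : ℝ) (a : Bary) : (stretch t).symm a = stretch (-t) a := by
  rw [Homeomorph.symm_apply_eq, ← stretch_add, neg_add_cancel, stretch_zero]

end Bary

end

noncomputable section

open Set

namespace Bary

/-! ### Geodesic segments -/

lemma norm_convexCombination (a b : Bary) (u : ℝ) :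
    4 * (((1 - u) * a.1 0 + u * b.1 0) * ((1 - u) * a.1 1 + u * b.1 1)
      + ((1 - u) * a.1 1 + u * b.1 1) * ((1 - u) * a.1 2 + u * b.1 2)
      + ((1 - u) * a.1 2 + u * b.1 2) * ((1 - u) * a.1 0 + u * b.1 0))
      = 1 + 2 * (u * (1 - u)) * (coshDist a b - 1) := by
  rw [coshDist]
  linear_combination (1 - u) ^ 2 * a.2.2 + u ^ 2 * b.2.2

/-- The Lorentzian length of the convex combination `(1 - u) a + u b`. -/
def segNorm (a b : Bary) (u : ℝ) : ℝ := √(1 + 2 * (u * (1 - u)) * (coshDist a b - 1))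

lemma add_eq_of_cosh_eq {p q d₁ d₂ d : ℝ} (hd₁ : 0 ≤ d₁) (hd₂ : 0 ≤ d₂) (hd : 0 ≤ d)
    (hp : 0 ≤ p) (hq : 0 ≤ q) (h₁ : Real.cosh d₁ = p + q * Real.cosh d)
    (h₂ : Real.cosh d₂ = p * Real.cosh d + q)
    (hnorm : p ^ 2 + q ^ 2 + 2 * (p * q) * Real.cosh d = 1) : d₁ + d₂ = d := by
  have hcosh := Real.cosh_sq d
  have hsinh {r x : ℝ} (hr : 0 ≤ r) (hx : 0 ≤ x)
      (hsq : Real.cosh x ^ 2 - 1 = r ^ 2 * (Real.cosh d ^ 2 - 1)) :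
      Real.sinh x = r * Real.sinh d := by
    refine (sq_eq_sq₀ (Real.sinh_nonneg_iff.2 hx)
      (mul_nonneg hr (Real.sinh_nonneg_iff.2 hd))).1 ?_
    rw [mul_pow, Real.sinh_sq, Real.sinh_sq, hsq]
  have hsinh₁ := hsinh hq hd₁ (by rw [h₁]; linear_combination hnorm)
  have hsinh₂ := hsinh hp hd₂ (by rw [h₂]; linear_combination hnorm)
  refine Real.cosh_strictMonoOn.injOn (mem_Ici.2 (add_nonneg hd₁ hd₂)) (mem_Ici.2 hd) ?_
  rw [Real.cosh_add, hsinh₁, hsinh₂, h₁, h₂]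
  linear_combination Real.cosh d * hnorm - p * q * hcosh

section Segment

variable (a b : Bary) (u : Icc (0 : ℝ) 1)

lemma segNorm_sq_pos : 0 < 1 + 2 * (u.1 * (1 - u.1)) * (coshDist a b - 1) := by
  have h := mul_nonneg (mul_nonneg u.2.1 (sub_nonneg.2 u.2.2)) (sub_nonneg.2 (one_le_coshDist a b))
  linarith

lemma segNorm_pos : 0 < segNorm a b u := Real.sqrt_pos.2 (segNorm_sq_pos a b u)

lemma segNorm_sq : segNorm a b u ^ 2 = 1 + 2 * (u.1 * (1 - u.1)) * (coshDist a b - 1) :=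
  Real.sq_sqrt (segNorm_sq_pos a b u).le

/-- The geodesic segment from `a` to `b`. -/
def seg : Bary :=
  ⟨fun k => ((1 - u.1) * a.1 k + u.1 * b.1 k) / segNorm a b u, by
    have hnorm := segNorm_pos a b u
    have hu : 0 ≤ 1 - u.1 := sub_nonneg.2 u.2.2
    refine ⟨fun k => div_nonneg (add_nonneg (mul_nonneg hu (a.nonneg k))
      (mul_nonneg u.2.1 (b.nonneg k))) hnorm.le, ?_⟩
    have hsq := segNorm_sq a b u
    rw [← norm_convexCombination] at hsq
    field_simp
    rw [hsq]
    ring⟩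

lemma seg_zero : seg a b ⟨0, by simp⟩ = a := Subtype.ext (by funext k; simp [seg, segNorm])

lemma seg_one : seg a b ⟨1, by simp⟩ = b := Subtype.ext (by funext k; simp [seg, segNorm])

lemma continuous_seg : Continuous (seg a b) := by
  have hcont : Continuous fun u : Icc (0 : ℝ) 1 => segNorm a b u := by
    unfold segNorm
    fun_prop
  exact Continuous.subtype_mk (continuous_pi fun k =>
    Continuous.div (by fun_prop) hcont fun u => (segNorm_pos a b u).ne') _

lemma hypDist_seg : hypDist a (seg a b u) + hypDist (seg a b u) b = hypDist a b := by
  have hnorm := segNorm_pos a b u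
  have hsq := segNorm_sq a b u
  refine add_eq_of_cosh_eq (p := (1 - u.1) / segNorm a b u) (q := u.1 / segNorm a b u)
    (hypDist_nonneg _ _) (hypDist_nonneg _ _) (hypDist_nonneg _ _)
    (div_nonneg (sub_nonneg.2 u.2.2) hnorm.le) (div_nonneg u.2.1 hnorm.le) ?_ ?_ ?_
  all_goals
    simp only [cosh_hypDist, coshDist, seg] at hsq ⊢
    field_simp
  · linear_combination (1 - u.1) * a.2.2
  · linear_combination u.1 * b.2.2
  · rw [hsq]
    ring

lemma exists_seg_eq_zero {g : Bary → ℝ} (hg : Continuous g) {a b : Bary} (ha : 0 ≤ g a)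
    (hb : g b ≤ 0) : ∃ u, g (seg a b u) = 0 :=
  mem_range_of_exists_le_of_exists_ge (hg.comp (continuous_seg a b))
    ⟨⟨1, by simp⟩, by simpa only [Function.comp_apply, seg_one]⟩
    ⟨⟨0, by simp⟩, by simpa only [Function.comp_apply, seg_zero]⟩

end Segment

/-! ### Lipschitz estimates for the stretch flow -/

lemma hypDist_spikeMap_le {k : Fin 3} {a b : Bary} (ha : InSpike k a) (hb : InSpike k b)
    {t ε : ℝ} (ht : 0 ≤ t) (hε : ε ≤ 1 / 2)
    (hε₁ : ∀ s ∈ Icc 0 t,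
      ε ≤ Real.exp (-flowDepth k s a - flowDepth k s b) * leafParam k a ^ 2)
    (hε₂ : ∀ s ∈ Icc 0 t,
      ε ≤ Real.exp (-flowDepth k s a - flowDepth k s b) * leafParam k b ^ 2) :
    hypDist (spikeMap k t a) (spikeMap k t b) ≤ Real.exp ((1 - ε) * t) * hypDist a b := by
  rw [hypDist, hypDist, coshDist_eq_horoCosh k, coshDist_eq_horoCosh k]
  simp only [horo_spikeMap, depth_spikeMap]
  exact arcosh_horoCosh_spikeFlow_le (leafParam_sq_mem k a).2 (leafParam_sq_mem k b).2
    (abs_leafParam_sub_le k a b) ha.1 hb.1 ha.2 hb.2 ht hε hε₁ hε₂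

lemma flowDepth_le {k : Fin 3} {a : Bary} {s t M : ℝ} (ha : -1 / 2 ≤ depth k a)
    (haM : depth k a ≤ M) (hs : s ∈ Icc 0 t) : flowDepth k s a ≤ (M + 1) * Real.exp t :=
  (spikeFlow_le _ ha hs.1).trans <| mul_le_mul (by linarith) (Real.exp_le_exp.2 hs.2)
    (Real.exp_pos _).le (by linarith)

lemma hypDist_spikeMap_le_of_depth_le {k : Fin 3} {a b : Bary} (ha : InSpike k a)
    (hb : InSpike k b) {t ε c M : ℝ} (ht : 0 ≤ t) (hε : ε ≤ 1 / 2) (hc : 0 ≤ c)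
    (hca : c ≤ leafParam k a) (hcb : c ≤ leafParam k b) (haM : depth k a ≤ M)
    (hbM : depth k b ≤ M) (hεM : ε ≤ Real.exp (-(2 * ((M + 1) * Real.exp t))) * c ^ 2) :
    hypDist (spikeMap k t a) (spikeMap k t b) ≤ Real.exp ((1 - ε) * t) * hypDist a b := by
  have hbound : ∀ s ∈ Icc 0 t, ∀ x, c ≤ x →
      ε ≤ Real.exp (-flowDepth k s a - flowDepth k s b) * x ^ 2 := fun s hs x hx =>
    hεM.trans <| mul_le_mul
      (Real.exp_le_exp.2 (by linarith [flowDepth_le ha.1 haM hs, flowDepth_le hb.1 hbM hs]))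
      (pow_le_pow_left₀ hc hx 2) (sq_nonneg _) (Real.exp_pos _).le
  exact hypDist_spikeMap_le ha hb ht hε (fun s hs => hbound s hs _ hca)
    fun s hs => hbound s hs _ hcb

-- A segment that leaves the support of the flow crosses its boundary.
lemma exists_seg_speed_eq_zero {k : Fin 3} {a b : Bary} (ha : speed k a ≠ 0)
    (hb : speed k b = 0) :
    ∃ u, InSpike k (seg a b u) ∧ ∀ j, speed j (seg a b u) = 0 := by
  let g : Bary → ℝ := fun x => depth k x +
    projIcc (0 : ℝ) (1 / 64) (by norm_num) (leafParam k x ^ 2) *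
      Real.exp (-2 * max (depth k x) (-1 / 2))
  have hspeed : ∀ x, speed k x = max 0 (g x) := fun x => rfl
  have hg : Continuous g := by
    have hdepth := continuous_depth k
    have hparam : Continuous fun x => (projIcc (0 : ℝ) (1 / 64) (by norm_num)
      (leafParam k x ^ 2)).1 :=
      continuous_subtype_val.comp (continuous_projIcc.comp ((continuous_leafParam k).pow 2))
    fun_prop
  have hga : 0 ≤ g a := by
    by_contra! hlt
    exact ha ((hspeed a).trans (max_eq_left hlt.le))
  have hgb : g b ≤ 0 := max_eq_left_iff.1 ((hspeed b).symm.trans hb)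
  obtain ⟨u, hu⟩ := exists_seg_eq_zero hg hga hgb
  have hzero : speed k (seg a b u) = 0 := by rw [hspeed, hu, max_self]
  have hdepth : -1 / 2 ≤ depth k (seg a b u) := by
    have hle : g (seg a b u) ≤ depth k (seg a b u) + 1 / 2 := add_clamped_le _ _
    linarith
  have hin : InSpike k (seg a b u) := by
    refine ⟨hdepth, hu.ge.trans_eq ?_⟩
    simp only [g, leafSpeed, projIcc_of_mem _ (leafParam_sq_mem k _), max_eq_left hdepth]
  refine ⟨u, hin, fun j => ?_⟩
  obtain rfl | hj := eq_or_ne j k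
  exacts [hzero, hin.speed_eq_zero hj]

section LipschitzOn

variable {W : Set Bary} (hW : ∀ a ∈ W, ∀ b ∈ W, ∀ u, seg a b u ∈ W) {t L : ℝ} (hL : 1 ≤ L)
  (hlip : ∀ k, ∀ a ∈ W, ∀ b ∈ W, InSpike k a → InSpike k b →
    hypDist (spikeMap k t a) (spikeMap k t b) ≤ L * hypDist a b)
include hW hL hlip

lemma hypDist_spikeMap_le_of_speed_eq_zero {k : Fin 3} {a b : Bary} (haW : a ∈ W) (hbW : b ∈ W)
    (ha : speed k a ≠ 0) (hb : speed k b = 0) :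
    hypDist (spikeMap k t a) b ≤ L * hypDist a b := by
  obtain ⟨u, hin, hzero⟩ := exists_seg_speed_eq_zero ha hb
  have hfirst := hlip k a haW _ (hW a haW b hbW u) (inSpike_of_speed_ne_zero ha) hin
  rw [spikeMap_of_speed_eq_zero (hzero k)] at hfirst
  have hsecond := le_mul_of_one_le_left (hypDist_nonneg (seg a b u) b) hL
  rw [← hypDist_seg a b u]
  linarith [hypDist_triangle (spikeMap k t a) (seg a b u) b]

lemma hypDist_spikeMap_spikeMap_le {k l : Fin 3} {a b : Bary} (haW : a ∈ W) (hbW : b ∈ W)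
    (ha : speed k a ≠ 0) (hb : speed l b ≠ 0) :
    hypDist (spikeMap k t a) (spikeMap l t b) ≤ L * hypDist a b := by
  obtain rfl | hkl := eq_or_ne k l
  · exact hlip k a haW b hbW (inSpike_of_speed_ne_zero ha) (inSpike_of_speed_ne_zero hb)
  obtain ⟨u, -, hzero⟩ := exists_seg_speed_eq_zero ha (speed_eq_zero_of_ne hb hkl)
  have huW := hW a haW b hbW u
  have hfirst := hypDist_spikeMap_le_of_speed_eq_zero hW hL hlip haW huW ha (hzero k)
  have hsecond := hypDist_spikeMap_le_of_speed_eq_zero hW hL hlip hbW huW hb (hzero l)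
  rw [hypDist_comm, hypDist_comm b] at hsecond
  rw [← hypDist_seg a b u]
  linarith [hypDist_triangle (spikeMap k t a) (seg a b u) (spikeMap l t b)]

lemma hypDist_stretch_le_of_spikes {a b : Bary} (haW : a ∈ W) (hbW : b ∈ W) :
    hypDist (stretch t a) (stretch t b) ≤ L * hypDist a b := by
  by_cases ha : ∀ k, speed k a = 0 <;> by_cases hb : ∀ k, speed k b = 0
  · rw [stretch_of_speed_eq_zero ha, stretch_of_speed_eq_zero hb]
    exact le_mul_of_one_le_left (hypDist_nonneg _ _) hL
  · obtain ⟨l, hl⟩ := not_forall.1 hb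
    rw [stretch_of_speed_eq_zero ha, stretch_of_speed_ne_zero hl, hypDist_comm, hypDist_comm a]
    exact hypDist_spikeMap_le_of_speed_eq_zero hW hL hlip hbW haW hl (ha l)
  · obtain ⟨k, hk⟩ := not_forall.1 ha
    rw [stretch_of_speed_ne_zero hk, stretch_of_speed_eq_zero hb]
    exact hypDist_spikeMap_le_of_speed_eq_zero hW hL hlip haW hbW hk (hb k)
  · obtain ⟨k, hk⟩ := not_forall.1 ha
    obtain ⟨l, hl⟩ := not_forall.1 hb
    rw [stretch_of_speed_ne_zero hk, stretch_of_speed_ne_zero hl]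
    exact hypDist_spikeMap_spikeMap_le hW hL hlip haW hbW hk hl

end LipschitzOn

theorem hypDist_stretch_le {t : ℝ} (ht : 0 ≤ t) (a b : Bary) :
    hypDist (stretch t a) (stretch t b) ≤ Real.exp t * hypDist a b := by
  refine hypDist_stretch_le_of_spikes (W := univ) (fun _ _ _ _ _ => mem_univ _)
    (Real.one_le_exp ht) (fun k a _ b _ ha hb => ?_) (mem_univ a) (mem_univ b)
  have h := hypDist_spikeMap_le ha hb ht (ε := 0) (by norm_num) (fun s _ => by positivity)
    fun s _ => by positivity
  rwa [sub_zero, one_mul] at h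

/-- The points of the triangle at which every coordinate is at least the fraction `ε` of the sum of
the coordinates. These convex sets exhaust the interior. -/
def thick (ε : ℝ) : Set Bary := {a | ∀ k, ε * (a.1 0 + a.1 1 + a.1 2) ≤ a.1 k}

lemma coord_add_size (k : Fin 3) (a : Bary) : a.1 k + size k a = a.1 0 + a.1 1 + a.1 2 := by
  fin_cases k <;> simp only [size, Fin.reduceFinMk, Fin.reduceAdd, Fin.zero_eta, Fin.mk_one,
    zero_add] <;> ring

lemma half_le_coord_sum (a : Bary) : 1 / 2 ≤ a.1 0 + a.1 1 + a.1 2 := by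
  nlinarith [a.2.2, a.nonneg 0, a.nonneg 1, a.nonneg 2, sq_nonneg (a.1 0), sq_nonneg (a.1 1),
    sq_nonneg (a.1 2)]

lemma exists_subset_thick {C : Set Bary} (hC : IsCompact C) (hpos : ∀ a ∈ C, ∀ k, 0 < a.1 k) :
    ∃ ε > 0, C ⊆ thick ε := by
  have hsum (a : Bary) : 0 < a.1 0 + a.1 1 + a.1 2 := by linarith [half_le_coord_sum a]
  have hfrac (k : Fin 3) : ∃ ε > 0, ∀ a ∈ C, ε * (a.1 0 + a.1 1 + a.1 2) ≤ a.1 k := by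
    have hcont : Continuous fun a : Bary => a.1 k / (a.1 0 + a.1 1 + a.1 2) :=
      (continuous_coord k).div (((continuous_coord 0).add (continuous_coord 1)).add
        (continuous_coord 2)) fun a => (hsum a).ne'
    obtain ⟨ε, hε, hle⟩ := hC.exists_forall_le' hcont.continuousOn (a := 0)
      fun a ha => div_pos (hpos a ha k) (hsum a)
    exact ⟨ε, hε, fun a ha => (le_div_iff₀ (hsum a)).1 (hle a ha)⟩
  choose ε hε hle using hfrac
  refine ⟨Finset.univ.inf' Finset.univ_nonempty ε, (Finset.lt_inf'_iff _).2 fun k _ => hε k,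
    fun a ha k => ?_⟩
  exact (mul_le_mul_of_nonneg_right (Finset.inf'_le ε (Finset.mem_univ k)) (hsum a).le).trans
    (hle k a ha)

lemma seg_mem_thick {ε : ℝ} {a b : Bary} (ha : a ∈ thick ε) (hb : b ∈ thick ε)
    (u : Icc (0 : ℝ) 1) : seg a b u ∈ thick ε := fun k => by
  have hka := mul_le_mul_of_nonneg_left (ha k) (sub_nonneg.2 u.2.2)
  have hkb := mul_le_mul_of_nonneg_left (hb k) u.2.1
  simp only [seg]
  rw [← add_div, ← add_div, ← mul_div_assoc]
  exact div_le_div_of_nonneg_right (by linarith) (segNorm_pos a b u).le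

section Thick

variable {ε : ℝ} (hε : 0 < ε) {a : Bary} (ha : a ∈ thick ε) (k : Fin 3)
include hε ha

lemma depth_le_of_mem_thick : depth k a ≤ -Real.log (2 * ε) := by
  have hsize : ε ≤ size k a := by
    rw [size]
    nlinarith [ha (k + 1), ha (k + 2), half_le_coord_sum a]
  exact neg_le_neg (Real.log_le_log (by positivity) (by linarith))

lemma le_leafParam_of_mem_thick : ε ^ 2 / 4 ≤ leafParam k a := by
  have hsize := size_pos k a
  have hle : ε * size k a ≤ ε * (a.1 0 + a.1 1 + a.1 2) :=
    mul_le_mul_of_nonneg_left (by linarith [coord_add_size k a, a.nonneg k]) hε.le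
  have hmul := mul_le_mul (hle.trans (ha (k + 1))) (hle.trans (ha (k + 2)))
    (mul_pos hε hsize).le (a.nonneg _)
  have hparam : leafParam k a * (4 * size k a ^ 2) = a.1 (k + 1) * a.1 (k + 2) := by
    rw [leafParam, coord_add_one, coord_add_two]
    ring
  refine le_of_mul_le_mul_right ?_ (show 0 < 4 * size k a ^ 2 by positivity)
  linarith

end Thick

theorem exists_hypDist_stretch_le_of_isCompact {t : ℝ} (ht : 0 < t) {C : Set Bary}
    (hC : IsCompact C) (hpos : ∀ a ∈ C, ∀ k, 0 < a.1 k) :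
    ∃ L < Real.exp t, ∀ a ∈ C, ∀ b ∈ C,
      hypDist (stretch t a) (stretch t b) ≤ L * hypDist a b := by
  obtain ⟨ε, hε, hCε⟩ := exists_subset_thick hC hpos
  let M := -Real.log (2 * ε)
  let δ := min (1 / 2) (Real.exp (-(2 * ((M + 1) * Real.exp t))) * (ε ^ 2 / 4) ^ 2)
  have hδ : 0 < δ := lt_min (by norm_num) (by positivity)
  have hδ' : δ ≤ 1 / 2 := min_le_left _ _
  refine ⟨Real.exp ((1 - δ) * t), Real.exp_lt_exp.2 (by nlinarith), fun a ha b hb => ?_⟩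
  refine hypDist_stretch_le_of_spikes (W := thick ε) (fun a ha b hb => seg_mem_thick ha hb)
    (Real.one_le_exp (by nlinarith)) (fun k a ha b hb hka hkb => ?_) (hCε ha) (hCε hb)
  exact hypDist_spikeMap_le_of_depth_le hka hkb ht.le hδ' (by positivity)
    (le_leafParam_of_mem_thick hε ha k) (le_leafParam_of_mem_thick hε hb k)
    (depth_le_of_mem_thick hε ha k) (depth_le_of_mem_thick hε hb k) (min_le_right _ _)

/-! ### The sides -/

/-- The point with arclength parameter `s` on the side opposite to the vertex `k`. -/
def side (k : Fin 3) (s : ℝ) : Bary :=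
  ⟨fun j => if j = k then 0 else if j = k + 1 then Real.exp (-s) / 2 else Real.exp s / 2, by
    have hmul : Real.exp (-s) * Real.exp s = 1 := by simp [← Real.exp_add]
    have hk := fin_three_ne_add k
    refine ⟨fun j => ?_, ?_⟩
    · dsimp only
      split_ifs <;> positivity
    · refine norm_of_cyclic (a := fun j => if j = k then _ else if j = k + 1 then _ else _) k ?_
      simp only [if_true, if_neg hk.1, if_neg hk.2.1, if_neg hk.2.2]
      linear_combination hmul⟩

section Side

variable (k : Fin 3) (s : ℝ)

lemma side_self : (side k s).1 k = 0 := by simp [side]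

lemma side_add_one : (side k s).1 (k + 1) = Real.exp (-s) / 2 := by simp [side]

lemma side_add_two : (side k s).1 (k + 2) = Real.exp s / 2 := by
  obtain ⟨-, hself, hone⟩ := fin_three_ne_add k
  simp only [side, if_neg hself, if_neg hone]

lemma size_side_add_one : size (k + 1) (side k s) = Real.exp s / 2 := by
  obtain ⟨hone, htwo, -⟩ := fin_three_add_add k
  rw [size, hone, htwo, side_self, side_add_two, add_zero]

lemma size_side_add_two : size (k + 2) (side k s) = Real.exp (-s) / 2 := by
  obtain ⟨-, -, hone, htwo⟩ := fin_three_add_add k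
  rw [size, hone, htwo, side_self, side_add_one, zero_add]

lemma horo_side_add_one : horo (k + 1) (side k s) = 1 := by
  obtain ⟨hone, htwo, -⟩ := fin_three_add_add k
  rw [horo, size_side_add_one, hone, htwo, side_self, side_add_two, sub_zero,
    div_self (by positivity)]

lemma horo_side_add_two : horo (k + 2) (side k s) = -1 := by
  obtain ⟨-, -, hone, htwo⟩ := fin_three_add_add k
  rw [horo, size_side_add_two, hone, htwo, side_self, side_add_one, zero_sub, neg_div,
    div_self (by positivity)]

lemma depth_side_add_one : depth (k + 1) (side k s) = -s := by
  rw [depth, size_side_add_one, mul_div_cancel₀ _ two_ne_zero, Real.log_exp]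

lemma depth_side_add_two : depth (k + 2) (side k s) = s := by
  rw [depth, size_side_add_two, mul_div_cancel₀ _ two_ne_zero, Real.log_exp, neg_neg]

lemma leafParam_side_add_one : leafParam (k + 1) (side k s) = 0 := by
  rw [leafParam, horo_side_add_one]
  norm_num

lemma leafParam_side_add_two : leafParam (k + 2) (side k s) = 0 := by
  rw [leafParam, horo_side_add_two]
  norm_num

lemma hypDist_side (t : ℝ) : hypDist (side k s) (side k t) = |s - t| := by
  refine hypDist_eq_of_cosh (abs_nonneg _) ?_
  rw [coshDist_eq _ _ k, side_self, side_self, side_add_one, side_add_one, side_add_two,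
    side_add_two, Real.cosh_abs, Real.cosh_eq, neg_sub, sub_eq_add_neg s, sub_eq_add_neg t,
    Real.exp_add, Real.exp_add]
  ring

end Side

lemma eq_side {k : Fin 3} {a : Bary} (h : a.1 k = 0) : a = side k (Real.log (2 * a.1 (k + 2))) := by
  have hnorm := a.norm_eq k
  rw [h] at hnorm
  have hpos : 0 < a.1 (k + 2) := by
    refine (a.nonneg _).lt_of_ne fun hzero => ?_
    rw [← hzero] at hnorm
    norm_num at hnorm
  refine ext_cyclic k (by rw [h, side_self]) ?_ ?_
  · rw [side_add_one, Real.exp_neg, Real.exp_log (by positivity)]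
    field_simp
    linarith
  · rw [side_add_two, Real.exp_log (by positivity)]
    ring

lemma coord_eq_zero_iff {k : Fin 3} {a : Bary} : a.1 k = 0 ↔ ∃ s, a = side k s :=
  ⟨fun h => ⟨_, eq_side h⟩, by rintro ⟨s, rfl⟩; exact side_self k s⟩

lemma speed_side_add_one (k : Fin 3) {s : ℝ} (hs : s ≤ 0) : speed (k + 1) (side k s) = -s := by
  rw [speed, leafParam_side_add_one, depth_side_add_one, zero_pow two_ne_zero,
    spikeSpeed_param_zero (neg_nonneg.2 hs)]

lemma speed_side_add_two (k : Fin 3) {s : ℝ} (hs : 0 ≤ s) : speed (k + 2) (side k s) = s := by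
  rw [speed, leafParam_side_add_two, depth_side_add_two, zero_pow two_ne_zero,
    spikeSpeed_param_zero hs]

lemma speed_side_zero (k j : Fin 3) : speed j (side k 0) = 0 := by
  obtain rfl | hj := eq_or_ne j k
  · by_contra hspeed
    have hlt := lt_of_speed_ne_zero hspeed (fin_three_ne_add j).1
    rw [side_self] at hlt
    exact hlt.not_ge (nonneg _ _)
  · obtain rfl | rfl := fin_three_eq_add_of_ne hj
    · rw [speed_side_add_one k le_rfl, neg_zero]
    · rw [speed_side_add_two k le_rfl]

theorem stretch_side (t : ℝ) (k : Fin 3) (s : ℝ) :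
    stretch t (side k s) = side k (Real.exp t * s) := by
  rcases lt_trichotomy s 0 with hs | rfl | hs
  · have hspeed := speed_side_add_one k hs.le
    rw [stretch_of_speed_ne_zero (hspeed.trans_ne (neg_ne_zero.2 hs.ne))]
    refine ext_horo (k + 1) (by simp only [horo_spikeMap, horo_side_add_one]) ?_
    rw [depth_spikeMap, flowDepth, leafParam_side_add_one, depth_side_add_one, depth_side_add_one,
      zero_pow two_ne_zero, spikeFlow_param_zero (by linarith)]
    ring
  · rw [mul_zero, stretch_of_speed_eq_zero (speed_side_zero k)]
  · have hspeed := speed_side_add_two k hs.le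
    rw [stretch_of_speed_ne_zero (hspeed.trans_ne hs.ne')]
    refine ext_horo (k + 2) (by simp only [horo_spikeMap, horo_side_add_two]) ?_
    rw [depth_spikeMap, flowDepth, leafParam_side_add_two, depth_side_add_two, depth_side_add_two,
      zero_pow two_ne_zero, spikeFlow_param_zero hs.le]
    ring

lemma stretch_coord_eq_zero {k : Fin 3} {a : Bary} (h : a.1 k = 0) (t : ℝ) :
    (stretch t a).1 k = 0 := by
  obtain ⟨s, rfl⟩ := coord_eq_zero_iff.1 h
  rw [stretch_side, side_self]

lemma stretch_coord_eq_zero_iff {t : ℝ} {k : Fin 3} {a : Bary} :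
    (stretch t a).1 k = 0 ↔ a.1 k = 0 := by
  refine ⟨fun h => ?_, fun h => stretch_coord_eq_zero h t⟩
  have hback := stretch_coord_eq_zero h (-t)
  rwa [← stretch_add, add_neg_cancel, stretch_zero] at hback

end Bary

end

noncomputable section

/-! ### Light-like vectors -/

lemma mink_comm (u v : Fin 3 → ℝ) : mink u v = mink v u := by simp only [mink]; ring

lemma mink_smul_left (a : ℝ) (u v : Fin 3 → ℝ) : mink (a • u) v = a * mink u v := by
  simp only [mink, Pi.smul_apply, smul_eq_mul]; ring

lemma mink_smul_right (a : ℝ) (u v : Fin 3 → ℝ) : mink u (a • v) = a * mink u v := by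
  simp only [mink, Pi.smul_apply, smul_eq_mul]; ring

lemma mink_add_left (u v w : Fin 3 → ℝ) : mink (u + v) w = mink u w + mink v w := by
  simp only [mink, Pi.add_apply]; ring

lemma smul_mem_lightCone {t : ℝ} (ht : 0 < t) {u : Fin 3 → ℝ} (hu : u ∈ lightCone) :
    t • u ∈ lightCone := by
  refine ⟨?_, mul_pos ht hu.2⟩
  rw [mink_smul_left, mink_smul_right, hu.1, mul_zero, mul_zero]

lemma sq_add_sq_eq_mul_mink {u v : Fin 3 → ℝ} (hu : mink u u = 0) (hv : mink v v = 0) :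
    (u 0 * v 2 - v 0 * u 2) ^ 2 + (u 1 * v 2 - v 1 * u 2) ^ 2 = -(2 * (u 2 * v 2)) * mink u v := by
  simp only [mink] at *
  linear_combination v 2 ^ 2 * hu + u 2 ^ 2 * hv

lemma mink_nonpos {u v : Fin 3 → ℝ} (hu : u ∈ lightCone) (hv : v ∈ lightCone) : mink u v ≤ 0 := by
  have hsq := sq_add_sq_eq_mul_mink hu.1 hv.1
  by_contra! hpos
  linarith [mul_pos (mul_pos hu.2 hv.2) hpos, sq_nonneg (u 0 * v 2 - v 0 * u 2),
    sq_nonneg (u 1 * v 2 - v 1 * u 2)]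

lemma mink_neg_of_linearIndependent {u v : Fin 3 → ℝ} (hu : u ∈ lightCone) (hv : v ∈ lightCone)
    (hli : LinearIndependent ℝ ![u, v]) : mink u v < 0 := by
  refine (mink_nonpos hu hv).lt_of_ne fun hzero => hv.2.ne' ?_
  have hsq := sq_add_sq_eq_mul_mink hu.1 hv.1
  rw [hzero, mul_zero, add_eq_zero_iff_of_nonneg (sq_nonneg _) (sq_nonneg _),
    sq_eq_zero_iff, sq_eq_zero_iff] at hsq
  refine (LinearIndependent.pair_iff.1 hli (v 2) (-u 2) (funext fun k => ?_)).1
  fin_cases k <;>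
    simp only [Fin.zero_eta, Fin.mk_one, Fin.reduceFinMk, Pi.add_apply, Pi.smul_apply, smul_eq_mul,
      Pi.zero_apply] <;>
    linarith

lemma mem_lightCone_of_mink_neg {u v : Fin 3 → ℝ} (hu : mink u u = 0) (hv : v ∈ lightCone)
    (hneg : mink u v < 0) : u ∈ lightCone := by
  refine ⟨hu, ?_⟩
  have hsq := sq_add_sq_eq_mul_mink hu hv.1
  have hprod : 0 ≤ u 2 * v 2 := nonneg_of_mul_nonneg_left
    (by linarith [sq_nonneg (u 0 * v 2 - v 0 * u 2), sq_nonneg (u 1 * v 2 - v 1 * u 2)])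
    (neg_pos.2 hneg)
  refine (nonneg_of_mul_nonneg_left hprod hv.2).lt_of_ne fun hzero => hneg.ne ?_
  have hnull : u 0 ^ 2 + u 1 ^ 2 = 0 := by
    simp only [mink, ← hzero] at hu
    linarith
  rw [add_eq_zero_iff_of_nonneg (sq_nonneg _) (sq_nonneg _), sq_eq_zero_iff,
    sq_eq_zero_iff] at hnull
  rw [mink, hnull.1, hnull.2, ← hzero]
  ring

lemma HypPlane.mink_neg (w : HypPlane) {v : Fin 3 → ℝ} (hv : v ∈ lightCone) : mink w.1 v < 0 := by
  obtain ⟨w, hw, hwpos⟩ := w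
  obtain ⟨hnull, hvpos⟩ := hv
  simp only [mink] at hw hnull ⊢
  have hsq : (w 0 * v 0 + w 1 * v 1) ^ 2 < (w 2 * v 2) ^ 2 := by
    have hw₂ : w 2 ^ 2 = w 0 ^ 2 + w 1 ^ 2 + 1 := by linear_combination -hw
    rw [mul_pow, hw₂]
    nlinarith [sq_nonneg (w 0 * v 1 - w 1 * v 0), mul_pos hvpos hvpos]
  linarith [(abs_lt_of_sq_lt_sq' hsq (mul_pos hwpos hvpos).le).2]

lemma det_eq (u v w : Fin 3 → ℝ) : Matrix.det (Matrix.of ![u, v, w]) =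
    u 0 * (v 1 * w 2 - v 2 * w 1) - u 1 * (v 0 * w 2 - v 2 * w 0)
      + u 2 * (v 0 * w 1 - v 1 * w 0) := by
  simp only [Matrix.det_fin_three, Matrix.of_apply, Matrix.cons_val]
  ring

lemma eq_of_mink_eq_of_det {v w x y : Fin 3 → ℝ} {d : ℝ} (hx : mink x x = 0) (hy : mink y y = 0)
    (hv : mink x v = mink y v) (hw : mink x w = mink y w)
    (hdx : d * Matrix.det (Matrix.of ![v, w, x]) < 0)
    (hdy : d * Matrix.det (Matrix.of ![v, w, y]) < 0) : x = y := by
  have hdet : Matrix.det (Matrix.of ![v, w, x]) + Matrix.det (Matrix.of ![v, w, y]) ≠ 0 :=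
    right_ne_zero_of_mul ((mul_add d _ _).trans_ne (add_neg hdx hdy).ne)
  rw [det_eq, det_eq] at hdet
  simp only [mink] at hx hy hv hw
  funext k
  refine sub_eq_zero.1 ((mul_eq_zero.1 ?_).resolve_left hdet)
  fin_cases k <;> simp only [Fin.zero_eta, Fin.mk_one, Fin.reduceFinMk]
  · linear_combination (v 1 * w 2 - v 2 * w 1) * (hx - hy)
      - ((x 1 + y 1) * w 2 - (x 2 + y 2) * w 1) * hv + ((x 1 + y 1) * v 2 - (x 2 + y 2) * v 1) * hw
  · linear_combination (v 2 * w 0 - v 0 * w 2) * (hx - hy)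
      - ((x 2 + y 2) * w 0 - (x 0 + y 0) * w 2) * hv + ((x 2 + y 2) * v 0 - (x 0 + y 0) * v 2) * hw
  · linear_combination -(v 0 * w 1 - v 1 * w 0) * (hx - hy)
      + ((x 0 + y 0) * w 1 - (x 1 + y 1) * w 0) * hv - ((x 0 + y 0) * v 1 - (x 1 + y 1) * v 0) * hw

lemma det_sq_eq (u v w : Fin 3 → ℝ) : Matrix.det (Matrix.of ![u, v, w]) ^ 2 =
    -(mink u u * (mink v v * mink w w - mink v w ^ 2)
      - mink u v * (mink u v * mink w w - mink v w * mink u w)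
      + mink u w * (mink u v * mink v w - mink v v * mink u w)) := by
  rw [det_eq]
  simp only [mink]
  ring

/-! ### Normalized triples -/

/-- The triple `Z` consists of light-like vectors whose horocycles are pairwise tangent. -/
def IsNormalized (Z : Fin 3 → Fin 3 → ℝ) : Prop :=
  (∀ k, Z k ∈ lightCone) ∧ ∀ i j, i ≠ j → mink (Z i) (Z j) = -2

/-- The vector with coordinates `a` with respect to the triple `Z`. -/
def comb (Z : Fin 3 → Fin 3 → ℝ) (a : Fin 3 → ℝ) : Fin 3 → ℝ := ∑ k, a k • Z k

/-- The coordinates of a vector with respect to a normalized triple. -/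
def coord (Z : Fin 3 → Fin 3 → ℝ) (w : Fin 3 → ℝ) (k : Fin 3) : ℝ :=
  (mink w (Z k) - mink w (Z (k + 1)) - mink w (Z (k + 2))) / 4

lemma mink_comb (Z : Fin 3 → Fin 3 → ℝ) (a v : Fin 3 → ℝ) :
    mink (comb Z a) v = a 0 * mink (Z 0) v + a 1 * mink (Z 1) v + a 2 * mink (Z 2) v := by
  simp only [comb, Fin.sum_univ_three, mink_add_left, mink_smul_left]

lemma comb_cyclic (Z : Fin 3 → Fin 3 → ℝ) (a : Fin 3 → ℝ) (i : Fin 3) :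
    comb Z a = a i • Z i + a (i + 1) • Z (i + 1) + a (i + 2) • Z (i + 2) :=
  sum_fin_three_cyclic _ i

namespace IsNormalized

variable {Z : Fin 3 → Fin 3 → ℝ} (hZ : IsNormalized Z)
include hZ

lemma mink_eq (i j : Fin 3) : mink (Z i) (Z j) = if i = j then 0 else -2 := by
  split_ifs with h
  · rw [h]; exact (hZ.1 j).1
  · exact hZ.2 i j h

lemma mink_comb_vertex (a : Fin 3 → ℝ) (i : Fin 3) :
    mink (comb Z a) (Z i) = -2 * (a (i + 1) + a (i + 2)) := by
  rw [mink_comb, hZ.mink_eq, hZ.mink_eq, hZ.mink_eq]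
  fin_cases i <;> simp only [Fin.reduceFinMk, Fin.reduceAdd, Fin.reduceEq, if_true, if_false,
    Fin.zero_eta, Fin.mk_one, zero_add] <;> ring

lemma mink_comb_comb (a b : Fin 3 → ℝ) : mink (comb Z a) (comb Z b) =
    -(2 * (a 0 * b 1 + a 1 * b 0 + a 1 * b 2 + a 2 * b 1 + a 2 * b 0 + a 0 * b 2)) := by
  rw [mink_comb, mink_comm, mink_comm (Z 1), mink_comm (Z 2), hZ.mink_comb_vertex,
    hZ.mink_comb_vertex, hZ.mink_comb_vertex]
  simp only [Fin.reduceAdd, zero_add]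
  ring

lemma coord_comb (a : Fin 3 → ℝ) : coord Z (comb Z a) = a := by
  funext k
  rw [coord, hZ.mink_comb_vertex, hZ.mink_comb_vertex, hZ.mink_comb_vertex]
  fin_cases k <;> simp only [Fin.reduceFinMk, Fin.reduceAdd, Fin.zero_eta, Fin.mk_one, zero_add] <;>
    ring

lemma comb_injective : Function.Injective (comb Z) :=
  Function.LeftInverse.injective hZ.coord_comb

lemma linearIndependent : LinearIndependent ℝ Z := by
  rw [Fintype.linearIndependent_iff]
  intro g hg
  have hzero : comb Z g = comb Z 0 := hg.trans (by simp [comb])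
  exact congrFun (hZ.comb_injective hzero)

lemma isIdealTriple : IsIdealTriple Z := ⟨hZ.1, hZ.linearIndependent⟩

lemma comb_coord (w : Fin 3 → ℝ) : comb Z (coord Z w) = w := by
  have hspan := hZ.linearIndependent.span_eq_top_of_card_eq_finrank' (by simp)
  have hw : w ∈ Submodule.span ℝ (Set.range Z) := hspan ▸ Submodule.mem_top
  obtain ⟨a, rfl⟩ := (Submodule.mem_span_range_iff_exists_fun ℝ).1 hw
  exact congrArg (comb Z) (hZ.coord_comb a)

lemma det_ne_zero (i : Fin 3) :
    Matrix.det (Matrix.of ![Z (i + 1), Z (i + 2), Z i]) ≠ 0 := by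
  obtain ⟨hone, htwo, hne⟩ := fin_three_ne_add i
  have hsq := det_sq_eq (Z (i + 1)) (Z (i + 2)) (Z i)
  rw [(hZ.1 _).1, (hZ.1 _).1, (hZ.1 _).1, hZ.2 _ _ hne.symm, hZ.2 _ _ hone, hZ.2 _ _ htwo] at hsq
  intro hzero
  rw [hzero] at hsq
  norm_num at hsq

lemma comb_mem (a : Bary) : mink (comb Z a.1) (comb Z a.1) = -1 ∧ 0 < comb Z a.1 2 := by
  constructor
  · rw [hZ.mink_comb_comb]
    linarith [a.2.2]
  · obtain ⟨k, hk⟩ : ∃ k, 0 < a.1 k := by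
      by_contra! hle
      linarith [a.half_le_coord_sum, hle 0, hle 1, hle 2]
    rw [comb, Finset.sum_apply]
    exact Finset.sum_pos' (fun j _ => mul_nonneg (a.nonneg j) (hZ.1 j).2.le)
      ⟨k, Finset.mem_univ k, mul_pos hk (hZ.1 k).2⟩

lemma norm_coord {w : Fin 3 → ℝ} (hw : mink w w = -1) : 4 * (coord Z w 0 * coord Z w 1
    + coord Z w 1 * coord Z w 2 + coord Z w 2 * coord Z w 0) = 1 := by
  rw [← hZ.comb_coord w, hZ.mink_comb_comb] at hw
  linarith

lemma coord_nonneg {w : HypPlane} (hw : w ∈ idealTriangle Z) (k : Fin 3) :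
    0 ≤ coord Z w.1 k := by
  obtain ⟨a, ha, hwa⟩ := hw
  rw [hwa]
  exact (ha k).trans_eq (congrFun (hZ.coord_comb a) k).symm

/-- The parametrization of the ideal triangle with vertices `Z` by its coordinates. -/
def baryHomeo : Bary ≃ₜ idealTriangle Z where
  toFun a := ⟨⟨comb Z a.1, hZ.comb_mem a⟩, a.1, a.nonneg, rfl⟩
  invFun w := ⟨coord Z w.1.1, hZ.coord_nonneg w.2, hZ.norm_coord w.1.2.1⟩
  left_inv a := Subtype.ext (hZ.coord_comb a.1)
  right_inv w := Subtype.ext (Subtype.ext (hZ.comb_coord w.1.1))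
  continuous_toFun := by
    refine Continuous.subtype_mk (Continuous.subtype_mk ?_ _) _
    exact continuous_finsetSum _ fun k _ => (Bary.continuous_coord k).smul continuous_const
  continuous_invFun := by
    refine Continuous.subtype_mk (continuous_pi fun k => ?_) _
    have hcoord : ∀ j, Continuous fun w : idealTriangle Z => w.1.1 j := fun j =>
      (continuous_apply j).comp (continuous_subtype_val.comp continuous_subtype_val)
    unfold coord mink
    fun_prop

lemma baryHomeo_coe (a : Bary) : (hZ.baryHomeo a).1.1 = comb Z a.1 := rfl

lemma baryHomeo_symm_coe (w : idealTriangle Z) : (hZ.baryHomeo.symm w).1 = coord Z w.1.1 := rfl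

lemma hdist_baryHomeo (a b : Bary) :
    hdist (hZ.baryHomeo a).1 (hZ.baryHomeo b).1 = Bary.hypDist a b := by
  rw [hdist, Bary.hypDist, baryHomeo_coe, baryHomeo_coe, hZ.mink_comb_comb, neg_neg, Bary.coshDist]

lemma hypDist_baryHomeo_symm (x y : idealTriangle Z) :
    Bary.hypDist (hZ.baryHomeo.symm x) (hZ.baryHomeo.symm y) = hdist x.1 y.1 := by
  rw [← hZ.hdist_baryHomeo, Homeomorph.apply_symm_apply, Homeomorph.apply_symm_apply]

lemma mem_idealSide_iff {w : idealTriangle Z} {i : Fin 3} :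
    w.1 ∈ idealSide Z i ↔ (hZ.baryHomeo.symm w).1 i = 0 := by
  rw [hZ.baryHomeo_symm_coe]
  constructor
  · rintro ⟨a, -, hi, hwa⟩
    rw [hwa]
    exact (congrFun (hZ.coord_comb a) i).trans hi
  · exact fun h => ⟨coord Z w.1.1, hZ.coord_nonneg w.2, h, (hZ.comb_coord _).symm⟩

lemma baryHomeo_mem_idealSide {a : Bary} {i : Fin 3} :
    (hZ.baryHomeo a).1 ∈ idealSide Z i ↔ a.1 i = 0 := by
  rw [hZ.mem_idealSide_iff, Homeomorph.symm_apply_apply]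

lemma coord_pos_of_mem_idealInterior {w : idealTriangle Z} (h : w.1 ∈ idealInterior Z)
    (k : Fin 3) : 0 < (hZ.baryHomeo.symm w).1 k := by
  rw [hZ.baryHomeo_symm_coe]
  obtain ⟨a, ha, hwa⟩ := h
  rw [hwa]
  exact (ha k).trans_eq (congrFun (hZ.coord_comb a) k).symm

end IsNormalized

lemma idealSide_subset_idealTriangle (Z : Fin 3 → Fin 3 → ℝ) (i : Fin 3) :
    idealSide Z i ⊆ idealTriangle Z := fun _ ⟨a, ha, _, h⟩ => ⟨a, ha, h⟩

lemma isNormalized_stdVertex : IsNormalized stdVertex := by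
  refine ⟨fun k => ⟨by simp [mink_stdVertex], ?_⟩, fun i j h => by simp [mink_stdVertex, h]⟩
  fin_cases k <;> simp [stdVertex]

/-- The coordinates on the standard ideal triangle. -/
def stdBary : StdTriangle ≃ₜ Bary := isNormalized_stdVertex.baryHomeo.symm

lemma stdBary_sidePoint (i : Fin 3) (s : ℝ) : stdBary (sidePoint i s) = Bary.side i s := by
  rw [stdBary, Homeomorph.symm_apply_eq]
  refine Subtype.ext (Subtype.ext ?_)
  rw [IsNormalized.baryHomeo_coe, comb_cyclic _ _ i, Bary.side_self, Bary.side_add_one,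
    Bary.side_add_two, zero_smul, zero_add]
  rfl

lemma stdBary_symm_side (i : Fin 3) (s : ℝ) : stdBary.symm (Bary.side i s) = sidePoint i s := by
  rw [← stdBary_sidePoint, Homeomorph.symm_apply_apply]

lemma hdist_sidePoint (i : Fin 3) (s t : ℝ) :
    hdist (sidePoint i s).1 (sidePoint i t).1 = |s - t| := by
  rw [← isNormalized_stdVertex.hypDist_baryHomeo_symm]
  change Bary.hypDist (stdBary _) (stdBary _) = _
  rw [stdBary_sidePoint, stdBary_sidePoint, Bary.hypDist_side]

/-! ### Stretch maps -/

section StretchMap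

variable {Z Z' : Fin 3 → Fin 3 → ℝ} (hZ : IsNormalized Z) (hZ' : IsNormalized Z')

/-- The stretch map with factor `exp t` between the ideal triangles with vertices `Z` and `Z'`. -/
def stretchMap (t : ℝ) : idealTriangle Z ≃ₜ idealTriangle Z' :=
  hZ.baryHomeo.symm.trans ((Bary.stretch t).trans hZ'.baryHomeo)

lemma hdist_stretchMap (t : ℝ) (x y : idealTriangle Z) :
    hdist (stretchMap hZ hZ' t x).1 (stretchMap hZ hZ' t y).1 =
      Bary.hypDist (Bary.stretch t (hZ.baryHomeo.symm x)) (Bary.stretch t (hZ.baryHomeo.symm y)) :=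
  hZ'.hdist_baryHomeo _ _

lemma isExpandingStretch_stretchMap {t : ℝ} (ht : 0 < t) :
    IsExpandingStretch (Real.exp t) (stretchMap hZ hZ' t) where
  lipschitz x y := by
    rw [hdist_stretchMap, ← hZ.hypDist_baryHomeo_symm]
    exact Bary.hypDist_stretch_le ht.le _ _
  side i := by
    refine ⟨i, fun x => ?_, fun x y hx hy => ?_⟩
    · rw [hZ.mem_idealSide_iff, stretchMap, Homeomorph.trans_apply, Homeomorph.trans_apply,
        hZ'.baryHomeo_mem_idealSide, Bary.stretch_coord_eq_zero_iff]
    · obtain ⟨s, hs⟩ := Bary.coord_eq_zero_iff.1 (hZ.mem_idealSide_iff.1 hx)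
      obtain ⟨s', hs'⟩ := Bary.coord_eq_zero_iff.1 (hZ.mem_idealSide_iff.1 hy)
      rw [hdist_stretchMap, ← hZ.hypDist_baryHomeo_symm, hs, hs', Bary.stretch_side,
        Bary.stretch_side, Bary.hypDist_side, Bary.hypDist_side, ← mul_sub, abs_mul,
        abs_of_pos (Real.exp_pos t)]
  strict C hC hint := by
    obtain ⟨L, hL, hle⟩ := Bary.exists_hypDist_stretch_le_of_isCompact ht
      (hC.image hZ.baryHomeo.symm.continuous) (by
        rintro _ ⟨x, hx, rfl⟩ k
        exact hZ.coord_pos_of_mem_idealInterior (hint x hx) k)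
    refine ⟨L, hL, fun x hx y hy => ?_⟩
    rw [hdist_stretchMap, ← hZ.hypDist_baryHomeo_symm]
    exact hle _ (Set.mem_image_of_mem _ hx) _ (Set.mem_image_of_mem _ hy)

lemma stretchMap_symm (t : ℝ) : (stretchMap hZ hZ' t).symm = stretchMap hZ' hZ (-t) := by
  ext1 x
  change hZ.baryHomeo ((Bary.stretch t).symm _) = _
  rw [Bary.stretch_symm_apply]
  rfl

theorem isStretchMap_stretchMap (t : ℝ) : IsStretchMap (Real.exp t) (stretchMap hZ hZ' t) := by
  rcases lt_trichotomy t 0 with ht | rfl | ht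
  · refine Or.inr (Or.inr ⟨Real.exp_pos t, Real.exp_lt_one_iff.2 ht, ?_⟩)
    rw [stretchMap_symm, ← Real.exp_neg]
    exact isExpandingStretch_stretchMap hZ' hZ (by linarith)
  · refine Or.inr (Or.inl ⟨Real.exp_zero, fun x y => ?_⟩)
    rw [hdist_stretchMap, Bary.stretch_zero, Bary.stretch_zero, hZ.hypDist_baryHomeo_symm]
  · exact Or.inl ⟨Real.one_lt_exp_iff.2 ht, isExpandingStretch_stretchMap hZ hZ' ht⟩

end StretchMap

end

noncomputable section

/-! ### Ideal triples -/

lemma idealTriangle_smul {Z : Fin 3 → Fin 3 → ℝ} {t : Fin 3 → ℝ} (ht : ∀ k, 0 < t k) :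
    idealTriangle (fun k => t k • Z k) = idealTriangle Z := by
  ext w
  constructor
  · rintro ⟨a, ha, hw⟩
    exact ⟨fun k => a k * t k, fun k => mul_nonneg (ha k) (ht k).le,
      by simpa only [smul_smul] using hw⟩
  · rintro ⟨a, ha, hw⟩
    refine ⟨fun k => a k / t k, fun k => div_nonneg (ha k) (ht k).le, hw.trans ?_⟩
    exact Finset.sum_congr rfl fun k _ => by rw [smul_smul, div_mul_cancel₀ _ (ht k).ne']

lemma idealSide_smul {Z : Fin 3 → Fin 3 → ℝ} {t : Fin 3 → ℝ} (ht : ∀ k, 0 < t k) (i : Fin 3) :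
    idealSide (fun k => t k • Z k) i = idealSide Z i := by
  ext w
  constructor
  · rintro ⟨a, ha, hi, hw⟩
    exact ⟨fun k => a k * t k, fun k => mul_nonneg (ha k) (ht k).le, mul_eq_zero_of_left hi _,
      by simpa only [smul_smul] using hw⟩
  · rintro ⟨a, ha, hi, hw⟩
    refine ⟨fun k => a k / t k, fun k => div_nonneg (ha k) (ht k).le,
      div_eq_zero_iff.2 (Or.inl hi), hw.trans ?_⟩
    exact Finset.sum_congr rfl fun k _ => by rw [smul_smul, div_mul_cancel₀ _ (ht k).ne']

lemma IsIdealTriple.mink_neg {r : Fin 3 → Fin 3 → ℝ} (hr : IsIdealTriple r) {i j : Fin 3}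
    (hij : i ≠ j) : mink (r i) (r j) < 0 := by
  have hinj : Function.Injective ![i, j] := injective_pair_iff_ne.2 hij
  have hli := hr.2.comp _ hinj
  rw [← FinVec.map_eq] at hli
  exact mink_neg_of_linearIndependent (hr.1 i) (hr.1 j) hli

lemma isNormalized_of_forall_mink_eq {Z : Fin 3 → Fin 3 → ℝ} (hmem : ∀ k, Z k ∈ lightCone)
    (hmink : ∀ k, mink (Z (k + 1)) (Z (k + 2)) = -2) : IsNormalized Z := by
  refine ⟨hmem, fun i j hij => ?_⟩
  obtain ⟨add_one_add_one, add_one_add_two, add_two_add_one, add_two_add_two⟩ := fin_three_add_add i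
  obtain rfl | rfl := fin_three_eq_add_of_ne hij.symm
  · have h := hmink (i + 2)
    rwa [add_two_add_one, add_two_add_two] at h
  · have h := hmink (i + 1)
    rwa [add_one_add_one, add_one_add_two, mink_comm] at h

lemma sqrt_div_mul_sqrt_div_mul {p q s : ℝ} (hp : 0 < p) (hq : 0 < q) (hs : 0 < s) :
    √(2 * p / (q * s)) * √(2 * q / (s * p)) * s = 2 := by
  have hsq : 2 * p / (q * s) * (2 * q / (s * p)) = (2 / s) ^ 2 := by field_simp
  rw [← Real.sqrt_mul (by positivity), hsq, Real.sqrt_sq (by positivity), div_mul_cancel₀ _ hs.ne']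

lemma IsIdealTriple.exists_normalized {r : Fin 3 → Fin 3 → ℝ} (hr : IsIdealTriple r) :
    ∃ t : Fin 3 → ℝ, (∀ k, 0 < t k) ∧ IsNormalized fun k => t k • r k := by
  let p (k : Fin 3) : ℝ := -mink (r (k + 1)) (r (k + 2))
  let t (k : Fin 3) : ℝ := √(2 * p k / (p (k + 1) * p (k + 2)))
  have hp (k : Fin 3) : 0 < p k := neg_pos.2 (hr.mink_neg (fin_three_ne_add k).2.2.symm)
  have ht (k : Fin 3) : 0 < t k :=
    Real.sqrt_pos.2 (div_pos (mul_pos two_pos (hp k)) (mul_pos (hp (k + 1)) (hp (k + 2))))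
  refine ⟨t, ht, isNormalized_of_forall_mink_eq (fun k => smul_mem_lightCone (ht k) (hr.1 k))
    fun k => ?_⟩
  obtain ⟨add_one_add_one, add_one_add_two, add_two_add_one, add_two_add_two⟩ := fin_three_add_add k
  have hprod : t (k + 1) * t (k + 2) * p k = 2 := by
    simp only [t, add_one_add_one, add_one_add_two, add_two_add_one, add_two_add_two]
    exact sqrt_div_mul_sqrt_div_mul (hp (k + 1)) (hp (k + 2)) (hp k)
  rw [mink_smul_left, mink_smul_right]
  linear_combination -hprod

lemma eq_of_pairwise_mul_eq {s t : Fin 3 → ℝ} (hs : ∀ k, 0 < s k) (ht : ∀ k, 0 < t k)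
    (hst : ∀ k : Fin 3, s (k + 1) * s (k + 2) = t (k + 1) * t (k + 2)) (k : Fin 3) :
    s k = t k := by
  obtain ⟨add_one_add_one, add_one_add_two, add_two_add_one, add_two_add_two⟩ := fin_three_add_add k
  have hk := hst k
  have hk_add_one := hst (k + 1)
  have hk_add_two := hst (k + 2)
  rw [add_one_add_one, add_one_add_two] at hk_add_one
  rw [add_two_add_one, add_two_add_two] at hk_add_two
  have hsq : s k ^ 2 * (t (k + 1) * t (k + 2)) = t k ^ 2 * (t (k + 1) * t (k + 2)) := by
    calc s k ^ 2 * (t (k + 1) * t (k + 2)) = s (k + 2) * s k * (s k * s (k + 1)) := by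
          rw [← hk]; ring
      _ = t k ^ 2 * (t (k + 1) * t (k + 2)) := by rw [hk_add_one, hk_add_two]; ring
  exact (sq_eq_sq₀ (hs k).le (ht k).le).1
    (mul_right_cancel₀ (mul_pos (ht (k + 1)) (ht (k + 2))).ne' hsq)

/-! ### Unfolding an ideal triangle over a side -/

/-- The normalized triple of the ideal triangle glued along its side `j` to the side `i` of the
triangle of `Z`, where `log m` is the shift between the distinguished points of the two sides. -/
def unfold (m : ℝ) (i j : Fin 3) (Z : Fin 3 → Fin 3 → ℝ) (k : Fin 3) : Fin 3 → ℝ :=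
  if k = j then -Z i + (1 + m) • Z (i + 1) + (1 + m⁻¹) • Z (i + 2)
  else if k = j + 1 then m⁻¹ • Z (i + 2) else m • Z (i + 1)

section
variable (m : ℝ) (i j : Fin 3) (Z : Fin 3 → Fin 3 → ℝ)

lemma unfold_self : unfold m i j Z j =
    -Z i + (1 + m) • Z (i + 1) + (1 + m⁻¹) • Z (i + 2) := if_pos rfl

lemma unfold_add_one : unfold m i j Z (j + 1) = m⁻¹ • Z (i + 2) := by
  rw [unfold, if_neg (fin_three_ne_add j).1, if_pos rfl]

lemma unfold_add_two : unfold m i j Z (j + 2) = m • Z (i + 1) := by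
  rw [unfold, if_neg (fin_three_ne_add j).2.1, if_neg (fin_three_ne_add j).2.2]

lemma mink_unfold_self (w : Fin 3 → ℝ) : mink w (unfold m i j Z j) =
    -mink w (Z i) + (1 + m) * mink w (Z (i + 1)) + (1 + m⁻¹) * mink w (Z (i + 2)) := by
  rw [unfold_self]
  simp only [mink, Pi.add_apply, Pi.neg_apply, Pi.smul_apply, smul_eq_mul]
  ring

lemma coord_unfold (w : Fin 3 → ℝ) : coord (unfold m i j Z) w j = -coord Z w i := by
  rw [coord, coord, mink_unfold_self, unfold_add_one, unfold_add_two, mink_smul_right,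
    mink_smul_right]
  ring

lemma det_unfold : Matrix.det (Matrix.of ![Z (i + 1), Z (i + 2), unfold m i j Z j]) =
    -Matrix.det (Matrix.of ![Z (i + 1), Z (i + 2), Z i]) := by
  rw [unfold_self, det_eq, det_eq]
  simp only [Pi.add_apply, Pi.neg_apply, Pi.smul_apply, smul_eq_mul]
  ring

end

lemma unfold_unfold {m : ℝ} (hm : m ≠ 0) (i j : Fin 3) (Z : Fin 3 → Fin 3 → ℝ) :
    unfold m j i (unfold m i j Z) = Z := by
  refine funext ((fin_three_forall_iff i).2 ⟨?_, ?_, ?_⟩)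
  · rw [unfold_self, unfold_self, unfold_add_one, unfold_add_two]
    funext k
    simp only [Pi.add_apply, Pi.neg_apply, Pi.smul_apply, smul_eq_mul]
    field_simp
    ring
  · rw [unfold_add_one, unfold_add_two, smul_smul, inv_mul_cancel₀ hm, one_smul]
  · rw [unfold_add_two, unfold_add_one, smul_smul, mul_inv_cancel₀ hm, one_smul]

lemma det_smul (a b c : ℝ) (u v w : Fin 3 → ℝ) :
    Matrix.det (Matrix.of ![a • u, b • v, c • w]) =
      a * b * c * Matrix.det (Matrix.of ![u, v, w]) := by
  rw [det_eq, det_eq]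
  simp only [Pi.smul_apply, smul_eq_mul]
  ring

namespace IsNormalized

variable {Z : Fin 3 → Fin 3 → ℝ} (hZ : IsNormalized Z) {m : ℝ}
include hZ

lemma mink_unfold_self_add_one (hm : m ≠ 0) (i j : Fin 3) :
    mink (unfold m i j Z j) (unfold m i j Z (j + 1)) = -2 := by
  obtain ⟨-, ne_add_two, ne_add_one_add_two⟩ := fin_three_ne_add i
  rw [mink_comm, mink_unfold_self, unfold_add_one]
  simp only [mink_smul_left, hZ.2 _ _ ne_add_two, hZ.2 _ _ ne_add_one_add_two, (hZ.1 (i + 2)).1]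
  field_simp
  ring

lemma mink_unfold_self_add_two (hm : m ≠ 0) (i j : Fin 3) :
    mink (unfold m i j Z j) (unfold m i j Z (j + 2)) = -2 := by
  obtain ⟨ne_add_one, -, ne_add_one_add_two⟩ := fin_three_ne_add i
  rw [mink_comm, mink_unfold_self, unfold_add_two]
  simp only [mink_smul_left, hZ.2 _ _ ne_add_one, hZ.2 _ _ ne_add_one_add_two.symm,
    (hZ.1 (i + 1)).1]
  field_simp
  ring

lemma mink_unfold_add_one_add_two (hm : m ≠ 0) (i j : Fin 3) :
    mink (unfold m i j Z (j + 1)) (unfold m i j Z (j + 2)) = -2 := by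
  rw [unfold_add_one, unfold_add_two, mink_smul_left, mink_smul_right,
    hZ.2 _ _ (fin_three_ne_add i).2.2, inv_mul_cancel_left₀ hm]

lemma mink_unfold_self_self (hm : m ≠ 0) (i j : Fin 3) :
    mink (unfold m i j Z j) (unfold m i j Z j) = 0 := by
  obtain ⟨ne_add_one, ne_add_two, -⟩ := fin_three_ne_add i
  have hadd_one := hZ.mink_unfold_self_add_two hm i j
  have hadd_two := hZ.mink_unfold_self_add_one hm i j
  rw [unfold_add_two, mink_smul_right] at hadd_one
  rw [unfold_add_one, mink_smul_right, inv_mul_eq_iff_eq_mul₀ hm] at hadd_two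
  have hself : mink (unfold m i j Z j) (Z i) = -2 * ((1 + m) + (1 + m⁻¹)) := by
    rw [mink_comm, mink_unfold_self, (hZ.1 i).1, hZ.2 _ _ ne_add_one.symm,
      hZ.2 _ _ ne_add_two.symm]
    ring
  rw [mink_unfold_self, hself, hadd_two, eq_div_of_mul_eq hm ((mul_comm _ _).trans hadd_one)]
  field_simp
  ring

lemma isNormalized_unfold (hm : 0 < m) (i j : Fin 3) : IsNormalized (unfold m i j Z) := by
  have hmem_add_one : unfold m i j Z (j + 1) ∈ lightCone := by
    rw [unfold_add_one]
    exact smul_mem_lightCone (inv_pos.2 hm) (hZ.1 (i + 2))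
  have hmem_add_two : unfold m i j Z (j + 2) ∈ lightCone := by
    rw [unfold_add_two]
    exact smul_mem_lightCone hm (hZ.1 (i + 1))
  have hadd_one := hZ.mink_unfold_self_add_one hm.ne' i j
  have hmem_self : unfold m i j Z j ∈ lightCone :=
    mem_lightCone_of_mink_neg (hZ.mink_unfold_self_self hm.ne' i j) hmem_add_one
      (hadd_one.trans_lt (by norm_num))
  obtain ⟨add_one_add_one, add_one_add_two, add_two_add_one, add_two_add_two⟩ := fin_three_add_add j
  refine isNormalized_of_forall_mink_eq
    ((fin_three_forall_iff j).2 ⟨hmem_self, hmem_add_one, hmem_add_two⟩)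
    ((fin_three_forall_iff j).2 ⟨hZ.mink_unfold_add_one_add_two hm.ne' i j, ?_, ?_⟩)
  · rw [add_one_add_one, add_one_add_two, mink_comm]
    exact hZ.mink_unfold_self_add_two hm.ne' i j
  · rwa [add_two_add_one, add_two_add_two]

end IsNormalized

end

noncomputable section

open Set Function

/-! ### Parallel sections of locally constant systems -/

/-- Locally constant permutation-valued functions on an open cover of `S`, such that the transition
functions between them descend to the quotient `F`: the gluing data of a covering space of `F` with
fibre `X`. -/
structure TransitionSystem {S F : Type*} [TopologicalSpace S] (π : S → F) (ι X : Type*) where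
  dom : ι → Set S
  saturated : ∀ k r r', π r = π r' → r ∈ dom k → r' ∈ dom k
  exists_mem : ∀ r, ∃ k, r ∈ dom k
  perm : ι → S → Equiv.Perm X
  isOpen_perm : ∀ k e, IsOpen {r | r ∈ dom k ∧ perm k r = e}
  compat : ∀ k l r r', π r = π r' → r ∈ dom k → r ∈ dom l →
    perm l r * (perm k r)⁻¹ = perm l r' * (perm k r')⁻¹

namespace TransitionSystem

variable {S F ι X : Type*} [TopologicalSpace S] {π : S → F} (A : TransitionSystem π ι X)

lemma isOpen_setOf_perm_perm (k l : ι) (P : Equiv.Perm X → Equiv.Perm X → Prop) :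
    IsOpen {r | r ∈ A.dom k ∧ r ∈ A.dom l ∧ P (A.perm k r) (A.perm l r)} := by
  have hunion : {r | r ∈ A.dom k ∧ r ∈ A.dom l ∧ P (A.perm k r) (A.perm l r)} =
      ⋃ (e : Equiv.Perm X) (e' : Equiv.Perm X) (_ : P e e'),
        {r | r ∈ A.dom k ∧ A.perm k r = e} ∩ {r | r ∈ A.dom l ∧ A.perm l r = e'} := by
    ext r
    simp only [mem_iUnion, mem_inter_iff, mem_ofPred_eq]
    constructor
    · rintro ⟨hk, hl, hP⟩
      exact ⟨_, _, hP, ⟨hk, rfl⟩, hl, rfl⟩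
    · rintro ⟨e, e', hP, ⟨hk, rfl⟩, hl, rfl⟩
      exact ⟨hk, hl, hP⟩
  rw [hunion]
  exact isOpen_iUnion fun e => isOpen_iUnion fun e' => isOpen_iUnion fun _ =>
    (A.isOpen_perm k e).inter (A.isOpen_perm l e')

variable [TopologicalSpace F] (hπ : IsQuotientMap π)

lemma isOpen_setOf_transition (k l : ι) (P : Equiv.Perm X → Prop) :
    IsOpen {b | surjInv hπ.surjective b ∈ A.dom k ∧ surjInv hπ.surjective b ∈ A.dom l ∧
      P (A.perm l (surjInv hπ.surjective b) * (A.perm k (surjInv hπ.surjective b))⁻¹)} := by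
  rw [← hπ.isOpen_preimage]
  convert A.isOpen_setOf_perm_perm k l fun e e' => P (e' * e⁻¹) using 1
  ext r
  have hr := surjInv_eq hπ.surjective (π r)
  refine ⟨fun ⟨hk, hl, hP⟩ => ⟨A.saturated k _ _ hr hk, A.saturated l _ _ hr hl, ?_⟩,
    fun ⟨hk, hl, hP⟩ => ⟨A.saturated k _ _ hr.symm hk, A.saturated l _ _ hr.symm hl, ?_⟩⟩
  · rwa [← A.compat k l _ _ hr hk hl]
  · rwa [← A.compat k l _ _ hr.symm hk hl]

/-- A chart about a point of the quotient. -/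
def index (b : F) : ι := (A.exists_mem (surjInv hπ.surjective b)).choose

lemma mem_dom_index {r : S} {b : F} (hr : π r = b) : r ∈ A.dom (A.index hπ b) :=
  A.saturated _ _ _ ((surjInv_eq hπ.surjective b).trans hr.symm)
    (A.exists_mem (surjInv hπ.surjective b)).choose_spec

variable [TopologicalSpace X] [DiscreteTopology X]

lemma continuousOn_transition (k l : ι) :
    ContinuousOn (fun x : F × X => (A.perm l (surjInv hπ.surjective x.1) *
        (A.perm k (surjInv hπ.surjective x.1))⁻¹) x.2)
      ({b | surjInv hπ.surjective b ∈ A.dom k ∧ surjInv hπ.surjective b ∈ A.dom l} ×ˢ univ) := by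
  rw [continuousOn_prod_of_discrete_right]
  intro v
  rintro b ⟨⟨hk, hl⟩, -⟩
  refine ContinuousAt.continuousWithinAt ?_
  rw [ContinuousAt, nhds_discrete X, Filter.tendsto_pure]
  have hopen := A.isOpen_setOf_transition hπ k l fun e => e v =
    (A.perm l (surjInv hπ.surjective b) * (A.perm k (surjInv hπ.surjective b))⁻¹) v
  exact Filter.mem_of_superset (hopen.mem_nhds ⟨hk, hl, rfl⟩) fun b' hb' => hb'.2.2

/-- The covering space of the quotient with fibre `X` that is defined by the transition functions,
as a fibre bundle. -/
def core : FiberBundleCore ι F X where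
  baseSet k := {b | surjInv hπ.surjective b ∈ A.dom k}
  isOpen_baseSet k := by
    simpa only [and_true, and_self] using A.isOpen_setOf_transition hπ k k fun _ => True
  indexAt := A.index hπ
  mem_baseSet_at b := A.mem_dom_index hπ (surjInv_eq hπ.surjective b)
  coordChange k l b v :=
    (A.perm l (surjInv hπ.surjective b) * (A.perm k (surjInv hπ.surjective b))⁻¹) v
  coordChange_self k b _ v := by rw [mul_inv_cancel, Equiv.Perm.one_apply]
  continuousOn_coordChange k l := A.continuousOn_transition hπ k l
  coordChange_comp i j k b _ v := by
    rw [← Equiv.Perm.mul_apply, mul_assoc, inv_mul_cancel_left]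

lemma mem_localTriv_source {r : S} {x : (A.core hπ).TotalSpace} (hr : π r = x.1) {k : ι}
    (hk : r ∈ A.dom k) : x ∈ ((A.core hπ).localTriv k).source :=
  ((A.core hπ).mem_localTriv_source k x).2
    (A.saturated k _ _ (hr.trans (surjInv_eq hπ.surjective x.1).symm) hk)

lemma perm_inv_localTriv {r : S} {x : (A.core hπ).TotalSpace} (hr : π r = x.1) {k : ι}
    (hk : r ∈ A.dom k) : (A.perm k r)⁻¹ ((A.core hπ).localTriv k x).2 =
      (A.perm (A.index hπ x.1) r)⁻¹ x.2 := by
  have hcoord : ((A.core hπ).localTriv k x).2 =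
      (A.perm k r * (A.perm (A.index hπ x.1) r)⁻¹) x.2 := by
    rw [A.compat _ k _ _ (hr.trans (surjInv_eq hπ.surjective x.1).symm) (A.mem_dom_index hπ hr) hk,
      FiberBundleCore.localTriv_apply]
    rfl
  rw [hcoord]
  exact Equiv.symm_apply_apply (A.perm k r) _

lemma isLocallyConstant_perm_inv {B : Type*} [TopologicalSpace B] {f : B → S} (hf : Continuous f)
    {x : B → (A.core hπ).TotalSpace} (hx : Continuous x) (hfx : ∀ b, π (f b) = (x b).1) :
    IsLocallyConstant fun b => (A.perm (A.index hπ (x b).1) (f b))⁻¹ (x b).2 := by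
  rw [IsLocallyConstant.iff_eventually_eq]
  intro b
  let k := A.index hπ (x b).1
  have hk : f b ∈ A.dom k := A.mem_dom_index hπ (hfx b)
  have htriv : ContinuousAt ((A.core hπ).localTriv k) (x b) :=
    ((A.core hπ).localTriv k).continuousOn.continuousAt
      (((A.core hπ).localTriv k).open_source.mem_nhds (A.mem_localTriv_source hπ (hfx b) hk))
  have hcoord : ContinuousAt (fun b' => ((A.core hπ).localTriv k (x b')).2) b :=
    continuous_snd.continuousAt.comp (htriv.comp hx.continuousAt)
  rw [ContinuousAt, nhds_discrete X, Filter.tendsto_pure] at hcoord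
  have hopen : IsOpen (f ⁻¹' {r | r ∈ A.dom k ∧ A.perm k r = A.perm k (f b)}) :=
    (A.isOpen_perm k _).preimage hf
  filter_upwards [hopen.mem_nhds ⟨hk, rfl⟩, hcoord] with b' ⟨hk', hperm⟩ hcoord'
  rw [← A.perm_inv_localTriv hπ (hfx b') hk', ← A.perm_inv_localTriv hπ (hfx b) hk, hperm, hcoord']

variable {E : Type*} [TopologicalSpace E] [SimplyConnectedSpace E] [LocallyPathConnectedSpace E]

theorem exists_section {p : E → F} (hp : Continuous p) (e₀ : E) (v₀ : X) :
    ∃ q : E → X, q e₀ = v₀ ∧ ∀ {B : Type} [TopologicalSpace B] (f : B → S) (h : B → E),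
      Continuous f → Continuous h → (∀ b, p (h b) = π (f b)) →
      IsLocallyConstant fun b => (A.perm (A.index hπ (p (h b))) (f b))⁻¹ (q (h b)) := by
  have hcov : IsCoveringMap (A.core hπ).proj :=
    FiberBundle.isCoveringMap (F := X) (E := (A.core hπ).Fiber)
  obtain ⟨x, ⟨hx₀, hx⟩, -⟩ := hcov.existsUnique_continuousMap_lifts ⟨p, hp⟩ e₀
    (⟨p e₀, v₀⟩ : (A.core hπ).TotalSpace) rfl
  have hproj (e : E) : (x e).1 = p e := congrFun hx e
  refine ⟨fun e => (x e).2, congrArg (fun y => y.2) hx₀, fun f h hf hh hfh => ?_⟩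
  have hconst := A.isLocallyConstant_perm_inv hπ hf (x.continuous.comp hh)
    fun b => (hfh b).symm.trans (hproj (h b)).symm
  simpa only [comp_apply, hproj] using hconst

end TransitionSystem

end

noncomputable section

/-! ### Topology of the ideal triangle -/

namespace Bary

/-- The convex cone over the ideal triangle, in the coordinates of `Bary`: it retracts radially
onto the triangle. -/
def cone : Set (Fin 3 → ℝ) := {a | (∀ k, 0 ≤ a k) ∧ 0 < a 0 * a 1 + a 1 * a 2 + a 2 * a 0}

lemma convex_cone : Convex ℝ cone := by
  rintro x ⟨hx, hxx⟩ y ⟨hy, hyy⟩ s t hs ht hst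
  refine ⟨fun k => add_nonneg (mul_nonneg hs (hx k)) (mul_nonneg ht (hy k)), ?_⟩
  simp only [Pi.add_apply, Pi.smul_apply, smul_eq_mul]
  set xx := x 0 * x 1 + x 1 * x 2 + x 2 * x 0
  set yy := y 0 * y 1 + y 1 * y 2 + y 2 * y 0
  have hxy : 0 ≤ x 0 * (y 1 + y 2) + x 1 * (y 2 + y 0) + x 2 * (y 0 + y 1) :=
    add_nonneg (add_nonneg (mul_nonneg (hx 0) (add_nonneg (hy 1) (hy 2)))
      (mul_nonneg (hx 1) (add_nonneg (hy 2) (hy 0)))) (mul_nonneg (hx 2) (add_nonneg (hy 0) (hy 1)))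
  have hsq : 0 < s ^ 2 * xx + t ^ 2 * yy := by
    obtain rfl | hs := hs.eq_or_lt
    · rw [zero_add] at hst
      simpa [hst] using hyy
    · positivity
  have hst := mul_nonneg (mul_nonneg hs ht) hxy
  simp only [xx, yy] at hsq
  linarith

lemma coe_mem_cone (a : Bary) : a.1 ∈ cone := ⟨a.2.1, by linarith [a.2.2]⟩

/-- The radial projection of the cone onto the ideal triangle. -/
def normalize (a : cone) : Bary :=
  ⟨fun k => a.1 k / (2 * √(a.1 0 * a.1 1 + a.1 1 * a.1 2 + a.1 2 * a.1 0)),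
    fun k => div_nonneg (a.2.1 k) (by positivity), by
      have hsq := Real.sq_sqrt a.2.2.le
      have hne := (Real.sqrt_pos.2 a.2.2).ne'
      generalize √(a.1 0 * a.1 1 + a.1 1 * a.1 2 + a.1 2 * a.1 0) = s at hsq hne
      field_simp
      linear_combination -4 * hsq⟩

lemma continuous_normalize : Continuous normalize := by
  have hcoord (k : Fin 3) : Continuous fun a : cone => a.1 k :=
    (continuous_apply k).comp continuous_subtype_val
  refine Continuous.subtype_mk (continuous_pi fun k => (hcoord k).div (continuous_const.mul
    ((((hcoord 0).mul (hcoord 1)).add ((hcoord 1).mul (hcoord 2))).add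
      ((hcoord 2).mul (hcoord 0))).sqrt) fun a => ?_) _
  exact (mul_pos two_pos (Real.sqrt_pos.2 a.2.2)).ne'

lemma continuous_toCone : Continuous fun a : Bary => (⟨a.1, a.coe_mem_cone⟩ : cone) :=
  continuous_subtype_val.subtype_mk _

lemma normalize_coe (a : Bary) : normalize ⟨a.1, a.coe_mem_cone⟩ = a := by
  have hsqrt : √(a.1 0 * a.1 1 + a.1 1 * a.1 2 + a.1 2 * a.1 0) = 1 / 2 := by
    rw [Real.sqrt_eq_iff_mul_self_eq_of_pos (by norm_num)]
    linarith [a.2.2]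
  refine Subtype.ext (funext fun k => ?_)
  simp only [normalize, hsqrt]
  ring

instance : ContractibleSpace Bary := by
  have : ContractibleSpace cone := convex_cone.contractibleSpace ⟨_, (side 0 0).coe_mem_cone⟩
  rw [contractible_iff_id_nullhomotopic]
  have hid : ContinuousMap.id Bary =
      (⟨normalize, continuous_normalize⟩ : C(cone, Bary)).comp
        ((ContinuousMap.id cone).comp ⟨_, continuous_toCone⟩) :=
    ContinuousMap.ext fun a => a.normalize_coe.symm
  rw [hid]
  exact ((id_nullhomotopic cone).comp_left _).comp_right _

instance : LocallyPathConnectedSpace Bary := by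
  have := convex_cone.locallyPathConnectedSpace
  exact (IsQuotientMap.of_inverse continuous_toCone continuous_normalize
    normalize_coe).locallyPathConnectedSpace

end Bary

instance : ContractibleSpace StdTriangle := stdBary.contractibleSpace

instance : LocallyPathConnectedSpace StdTriangle :=
  stdBary.symm.isQuotientMap.locallyPathConnectedSpace

lemma continuous_sidePoint (i : Fin 3) : Continuous (sidePoint i) := by
  refine Continuous.subtype_mk (Continuous.subtype_mk ?_ _) _
  unfold sideVec
  fun_prop

/-! ### Lifted triangles -/

namespace GluingData

variable (G : GluingData)

/-- The gluing map of the side `x`, in the arclength parameters. -/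
def glue (x : G.Face × Fin 3) (s : ℝ) : ℝ := -(G.scale x * s + G.shift x)

lemma glue_pair_glue (x : G.Face × Fin 3) (s : ℝ) : G.glue (G.pair x) (G.glue x s) = s := by
  have hshift : G.shift (G.pair x) = G.shift x * G.scale (G.pair x) := by
    rw [← G.shift_pair x, mul_assoc, mul_comm (G.scale x), G.scale_pair, mul_one]
  rw [glue, glue]
  linear_combination s * G.scale_pair x - hshift

lemma glue_glue_pair (x : G.Face × Fin 3) (s : ℝ) : G.glue x (G.glue (G.pair x) s) = s := by
  have h := G.glue_pair_glue (G.pair x) s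
  rwa [G.pair_pair] at h

lemma continuous_glue (x : G.Face × Fin 3) : Continuous (G.glue x) := by
  unfold glue
  fun_prop

end GluingData

namespace BrokenHyperbolicStructure

variable {F : Type*} [TopologicalSpace F] (H : BrokenHyperbolicStructure F)

/-- The disjoint union of the faces, of which the surface is a quotient. -/
abbrev FacePoint : Type := Σ _ : H.Face, StdTriangle

lemma continuous_chart (f : H.Face) : Continuous (H.chart f) :=
  H.isQuotientMap_chart.continuous.comp (continuous_sigmaMk (σ := fun _ : H.Face => StdTriangle))

variable {H}

lemma chart_sidePoint {f g : H.Face} {i j : Fin 3} (hpair : H.pair (f, i) = (g, j)) (s : ℝ) :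
    H.chart f (sidePoint i s) = H.chart g (sidePoint j (H.glue (f, i) s)) :=
  (H.chart_eq_iff _ _ _ _).2 (Or.inr ⟨i, j, s, hpair, rfl, rfl⟩)

lemma eq_or_sidePoint_of_chart_eq {r r' : H.FacePoint} (h : H.chart r.1 r.2 = H.chart r'.1 r'.2) :
    r = r' ∨ ∃ f f' i j s, H.pair (f, i) = (f', j) ∧ r = ⟨f, sidePoint i s⟩ ∧
      r' = ⟨f', sidePoint j (H.glue (f, i) s)⟩ := by
  obtain ⟨f, y⟩ := r
  obtain ⟨f', y'⟩ := r'
  obtain ⟨hf, hy⟩ | ⟨i, j, s, hpair, hy, hy'⟩ := (H.chart_eq_iff _ _ _ _).1 h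
  · exact Or.inl (Sigma.ext hf (heq_of_eq hy))
  · exact Or.inr ⟨f, f', i, j, s, hpair, Sigma.ext rfl (heq_of_eq hy),
      Sigma.ext rfl (heq_of_eq hy')⟩

end BrokenHyperbolicStructure

namespace LiftedFace

variable {E F : Type*} [TopologicalSpace E] [TopologicalSpace F] {H : BrokenHyperbolicStructure F}
  {p : E → F}

lemma Adj.lift_eq {T T' : LiftedFace H p} {i j : Fin 3} (h : T.Adj i T' j) (s : ℝ) :
    T.lift (sidePoint i s) = T'.lift (sidePoint j (H.glue (T.face, i) s)) := h.2 s

lemma Adj.symm {T T' : LiftedFace H p} {i j : Fin 3} (h : T.Adj i T' j) : T'.Adj j T i := by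
  refine ⟨by rw [← h.1, H.pair_pair], fun s => ?_⟩
  have hglue := H.glue_glue_pair (T.face, i) s
  rw [h.1] at hglue
  have hlift := h.lift_eq (H.glue (T'.face, j) s)
  rw [hglue] at hlift
  exact hlift.symm

variable (hp : IsCoveringMap p)
include hp

lemma exists_lift {f : H.Face} {y : StdTriangle} {e : E} (he : p e = H.chart f y) :
    ∃ T : LiftedFace H p, T.face = f ∧ T.lift y = e := by
  obtain ⟨L, ⟨hLy, hL⟩, -⟩ := hp.existsUnique_continuousMap_lifts
    ⟨H.chart f, H.continuous_chart f⟩ y e he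
  exact ⟨⟨f, L, L.continuous, congrFun hL⟩, rfl, hLy⟩

lemma exists_lift_eq (e : E) : ∃ (T : LiftedFace H p) (y : StdTriangle), T.lift y = e := by
  obtain ⟨⟨f, y⟩, hfy⟩ := H.isQuotientMap_chart.surjective (p e)
  obtain ⟨T, -, hT⟩ := exists_lift hp hfy.symm
  exact ⟨T, y, hT⟩

lemma ext_of_lift_eq {T T' : LiftedFace H p} (hface : T.face = T'.face) {y : StdTriangle}
    (hy : T.lift y = T'.lift y) : T = T' := by
  have hlift : T.lift = T'.lift := hp.eq_of_comp_eq T.continuous_lift T'.continuous_lift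
    (funext fun x => by simp only [Function.comp_apply, lift_spec, hface]) y hy
  cases T
  cases T'
  simp_all only

lemma adj_of_lift_eq {T T' : LiftedFace H p} {i j : Fin 3}
    (hpair : H.pair (T.face, i) = (T'.face, j)) {s : ℝ}
    (hs : T.lift (sidePoint i s) = T'.lift (sidePoint j (H.glue (T.face, i) s))) :
    T.Adj i T' j := by
  refine ⟨hpair, congrFun (hp.eq_of_comp_eq (T.continuous_lift.comp (continuous_sidePoint i))
    (T'.continuous_lift.comp ((continuous_sidePoint j).comp (H.continuous_glue (T.face, i))))
    (funext fun t => ?_) s hs)⟩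
  simp only [Function.comp_apply, lift_spec]
  exact H.chart_sidePoint hpair t

lemma exists_adj (T : LiftedFace H p) (i : Fin 3) : ∃ T' j, T.Adj i T' j := by
  obtain ⟨⟨g, j⟩, hpair⟩ : ∃ x, H.pair (T.face, i) = x := ⟨_, rfl⟩
  obtain ⟨T', rfl, hT'⟩ := exists_lift hp
    ((T.lift_spec (sidePoint i 0)).trans (H.chart_sidePoint hpair 0))
  exact ⟨T', j, adj_of_lift_eq hp hpair hT'.symm⟩

lemma Adj.unique {T T' T'' : LiftedFace H p} {i j k : Fin 3} (h : T.Adj i T' j)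
    (h' : T.Adj i T'' k) : T' = T'' ∧ j = k := by
  obtain ⟨hface, rfl⟩ := Prod.mk.inj (h.1.symm.trans h'.1)
  exact ⟨ext_of_lift_eq hp hface ((h.lift_eq 0).symm.trans (h'.lift_eq 0)), rfl⟩

lemma lift_eq_lift {T T' : LiftedFace H p} {y y' : StdTriangle} (h : T.lift y = T'.lift y') :
    (T = T' ∧ y = y') ∨ ∃ i j s, T.Adj i T' j ∧ y = sidePoint i s ∧
      y' = sidePoint j (H.glue (T.face, i) s) := by
  have hchart : H.chart T.face y = H.chart T'.face y' := by
    rw [← T.lift_spec, h, T'.lift_spec]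
  obtain ⟨hface, rfl⟩ | ⟨i, j, s, hpair, rfl, rfl⟩ := (H.chart_eq_iff _ _ _ _).1 hchart
  · exact Or.inl ⟨ext_of_lift_eq hp hface h, rfl⟩
  · exact Or.inr ⟨i, j, s, adj_of_lift_eq hp hpair h, rfl, rfl⟩

lemma isOpen_image_of_isOpen_preimage_lift {U : Set E}
    (hU : ∀ T : LiftedFace H p, IsOpen (T.lift ⁻¹' U)) : IsOpen (p '' U) := by
  rw [← H.isQuotientMap_chart.isOpen_preimage, isOpen_sigma_iff]
  intro f
  rw [isOpen_iff_mem_nhds]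
  rintro y ⟨e, he, hy⟩
  obtain ⟨T, rfl, rfl⟩ := exists_lift hp hy
  exact Filter.mem_of_superset ((hU T).mem_nhds he) fun x hx => ⟨T.lift x, hx, T.lift_spec x⟩

lemma isQuotientMap_lift : IsQuotientMap fun x : Σ _ : LiftedFace H p, StdTriangle =>
    x.1.lift x.2 := by
  have hcont : Continuous fun x : Σ _ : LiftedFace H p, StdTriangle => x.1.lift x.2 :=
    continuous_sigma fun T => T.continuous_lift
  refine ⟨.of_isOpen_preimage_iff_isOpen fun U => ⟨fun hU => ?_, fun hU => hU.preimage hcont⟩,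
    fun e => ?_⟩
  swap
  · obtain ⟨T, y, hy⟩ := exists_lift_eq (H := H) hp e
    exact ⟨⟨T, y⟩, hy⟩
  rw [isOpen_sigma_iff] at hU
  rw [isOpen_iff_mem_nhds]
  intro e he
  obtain ⟨φ, heφ, rfl⟩ := hp.isLocalHomeomorph e
  have himage : IsOpen (φ '' (U ∩ φ.source)) := isOpen_image_of_isOpen_preimage_lift hp fun T =>
    (hU T).inter (φ.open_source.preimage T.continuous_lift)
  refine Filter.mem_of_superset (Filter.inter_mem
    ((φ.continuousAt heφ) (himage.mem_nhds ⟨e, ⟨he, heφ⟩, rfl⟩)) (φ.open_source.mem_nhds heφ)) ?_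
  rintro x ⟨⟨x', ⟨hx', hx's⟩, hxx'⟩, hxs⟩
  rwa [← φ.injOn hx's hxs hxx']

lemma exists_glued {Y : Type*} [TopologicalSpace Y] (A : LiftedFace H p → StdTriangle → Y)
    (hA : ∀ T, Continuous (A T)) (hadj : ∀ T i T' j, T.Adj i T' j → ∀ s,
      A T (sidePoint i s) = A T' (sidePoint j (H.glue (T.face, i) s))) :
    ∃ D : E → Y, Continuous D ∧ ∀ T y, D (T.lift y) = A T y := by
  have hq := isQuotientMap_lift (H := H) hp
  let f : C(Σ _ : LiftedFace H p, StdTriangle, Y) := ⟨fun x => A x.1 x.2, continuous_sigma hA⟩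
  have hf : ∀ x x' : Σ _ : LiftedFace H p, StdTriangle, x.1.lift x.2 = x'.1.lift x'.2 →
      f x = f x' := by
    rintro ⟨T, y⟩ ⟨T', y'⟩ h
    obtain ⟨rfl, rfl⟩ | ⟨i, j, s, hTT', rfl, rfl⟩ := lift_eq_lift hp h
    · rfl
    · exact hadj T i T' j hTT' s
  choose x hx using hq.surjective
  have hD (T : LiftedFace H p) (y : StdTriangle) : f (x (T.lift y)) = A T y := hf _ ⟨T, y⟩ (hx _)
  refine ⟨fun e => f (x e), hq.continuous_iff.2 ?_, hD⟩
  exact f.continuous.congr fun x' => (hD x'.1 x'.2).symm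

/-- A property of lifted triangles that is preserved by adjacency is a locally constant function
on the connected covering space. -/
theorem induction_adj [PreconnectedSpace E] {P : LiftedFace H p → Prop} {T₀ : LiftedFace H p}
    (h₀ : P T₀) (hadj : ∀ T i T' j, T.Adj i T' j → P T → P T') (T : LiftedFace H p) : P T := by
  classical
  obtain ⟨D, hD, hlift⟩ := exists_glued hp (fun T _ => decide (P T)) (fun T => continuous_const)
    fun T i T' j h _ => decide_eq_decide.2 ⟨hadj T i T' j h, hadj T' j T i h.symm⟩
  have hconst : D (T₀.lift (sidePoint 0 0)) = D (T.lift (sidePoint 0 0)) :=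
    PreconnectedSpace.constant ‹_› hD
  rw [hlift, hlift, decide_eq_decide] at hconst
  exact hconst.1 h₀

end LiftedFace

/-! ### Labels of the lifted triangles -/

/-- The points of the standard triangle that are nearest to the side `i`. -/
def collar (i : Fin 3) : Set StdTriangle :=
  {y | (stdBary y).1 i < (stdBary y).1 (i + 1) ∧ (stdBary y).1 i < (stdBary y).1 (i + 2)}

lemma continuous_stdBary_coord (k : Fin 3) : Continuous fun y => (stdBary y).1 k :=
  (Bary.continuous_coord k).comp stdBary.continuous

lemma isOpen_collar (i : Fin 3) : IsOpen (collar i) :=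
  (isOpen_lt (continuous_stdBary_coord _) (continuous_stdBary_coord _)).inter
    (isOpen_lt (continuous_stdBary_coord _) (continuous_stdBary_coord _))

lemma eq_of_mem_collar {i j : Fin 3} {y : StdTriangle} (hi : y ∈ collar i) (hj : y ∈ collar j) :
    i = j := by
  by_contra hne
  obtain rfl | rfl := fin_three_eq_add_of_ne (Ne.symm hne)
  · have hlt := hj.2
    rw [(fin_three_add_add i).2.1] at hlt
    exact lt_asymm hi.1 hlt
  · have hlt := hj.1
    rw [(fin_three_add_add i).2.2.1] at hlt
    exact lt_asymm hi.2 hlt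

lemma sidePoint_mem_collar (i : Fin 3) (s : ℝ) : sidePoint i s ∈ collar i := by
  constructor
  · rw [stdBary_sidePoint, Bary.side_self, Bary.side_add_one]
    positivity
  · rw [stdBary_sidePoint, Bary.side_self, Bary.side_add_two]
    positivity

lemma exists_eq_sidePoint {i : Fin 3} {y : StdTriangle} (h : (stdBary y).1 i = 0) :
    ∃ s, y = sidePoint i s := by
  obtain ⟨s, hs⟩ := Bary.coord_eq_zero_iff.1 h
  exact ⟨s, by rw [← stdBary_symm_side, ← hs, Homeomorph.symm_apply_apply]⟩

section Labels

variable {E F : Type*} [TopologicalSpace E] [TopologicalSpace F] {H : BrokenHyperbolicStructure F}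
  {p : E → F}

/-- The points of the faces that are nearest to the side `x`. -/
def sideCollar (H : BrokenHyperbolicStructure F) (x : H.Face × Fin 3) : Set H.FacePoint :=
  {r | r.1 = x.1 ∧ r.2 ∈ collar x.2}

lemma isOpen_sideCollar (x : H.Face × Fin 3) : IsOpen (sideCollar H x) := by
  refine isOpen_sigma_iff.2 fun f => ?_
  change IsOpen ({_y : StdTriangle | f = x.1} ∩ collar x.2)
  exact isOpen_const.inter (isOpen_collar x.2)

lemma eq_of_mem_sideCollar {x y : H.Face × Fin 3} {r : H.FacePoint}
    (hx : r ∈ sideCollar H x) (hy : r ∈ sideCollar H y) : x = y :=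
  Prod.ext (hx.1.symm.trans hy.1) (eq_of_mem_collar hx.2 hy.2)

lemma sidePoint_mem_sideCollar (f : H.Face) (i : Fin 3) (s : ℝ) :
    (⟨f, sidePoint i s⟩ : H.FacePoint) ∈ sideCollar H (f, i) :=
  ⟨rfl, sidePoint_mem_collar i s⟩

/-- The open saturated sets of the disjoint union of the faces over which labels are compared: the
interiors of the faces, and a neighbourhood of each edge. -/
def labelDom (H : BrokenHyperbolicStructure F) : Option (H.Face × Fin 3) → Set H.FacePoint
  | none => {r | ∀ k, 0 < (stdBary r.2).1 k}
  | some x => sideCollar H x ∪ sideCollar H (H.pair x)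

lemma isOpen_labelDom_none : IsOpen (labelDom H none) := by
  refine isOpen_sigma_iff.2 fun f => ?_
  change IsOpen {y : StdTriangle | ∀ k, 0 < (stdBary y).1 k}
  rw [Set.ofPred_forall]
  exact isOpen_iInter_of_finite fun k => isOpen_lt continuous_const (continuous_stdBary_coord k)

lemma sidePoint_notMem_labelDom_none (f : H.Face) (i : Fin 3) (s : ℝ) :
    (⟨f, sidePoint i s⟩ : H.FacePoint) ∉ labelDom H none := by
  intro h
  have hpos := h i
  simp only [stdBary_sidePoint, Bary.side_self, lt_irrefl] at hpos

lemma labelDom_saturated (k : Option (H.Face × Fin 3)) (r r' : H.FacePoint)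
    (h : H.chart r.1 r.2 = H.chart r'.1 r'.2) (hr : r ∈ labelDom H k) : r' ∈ labelDom H k := by
  obtain rfl | ⟨f, f', i, j, s, hpair, rfl, rfl⟩ :=
    BrokenHyperbolicStructure.eq_or_sidePoint_of_chart_eq h
  · exact hr
  have hmem := sidePoint_mem_sideCollar f' j (H.glue (f, i) s)
  rw [← hpair] at hmem
  cases k with
  | none => exact absurd hr (sidePoint_notMem_labelDom_none f i s)
  | some x =>
    obtain hr | hr := hr
    · obtain rfl := eq_of_mem_sideCollar hr (sidePoint_mem_sideCollar f i s)
      exact Or.inr hmem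
    · have hx : H.pair (f, i) = x := by
        rw [← eq_of_mem_sideCollar hr (sidePoint_mem_sideCollar f i s), H.pair_pair]
      exact Or.inl (hx ▸ hmem)

lemma exists_mem_labelDom (r : H.FacePoint) : ∃ k, r ∈ labelDom H k := by
  by_cases h : ∀ k, 0 < (stdBary r.2).1 k
  · exact ⟨none, h⟩
  push Not at h
  obtain ⟨i, hi⟩ := h
  obtain ⟨s, hs⟩ := exists_eq_sidePoint (le_antisymm hi ((stdBary r.2).nonneg i))
  exact ⟨some (r.1, i), Or.inl ⟨rfl, hs ▸ sidePoint_mem_collar i s⟩⟩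

variable {X : Type*} (g : H.Face × Fin 3 → Equiv.Perm X)

open Classical in
/-- The comparison of labels over `labelDom`: near an edge, labels are carried to one of its two
sides. -/
def labelPerm : Option (H.Face × Fin 3) → H.FacePoint → Equiv.Perm X
  | none, _ => 1
  | some x, r => if r ∈ sideCollar H x then 1 else g (H.pair x)

lemma labelPerm_of_mem {x : H.Face × Fin 3} {r : H.FacePoint} (hr : r ∈ sideCollar H x) :
    labelPerm g (some x) r = 1 := if_pos hr

lemma labelPerm_of_mem_pair {x : H.Face × Fin 3} {r : H.FacePoint}
    (hr : r ∈ sideCollar H (H.pair x)) : labelPerm g (some x) r = g (H.pair x) :=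
  if_neg fun hx => H.pair_ne x (eq_of_mem_sideCollar hr hx)

lemma isOpen_labelPerm (k : Option (H.Face × Fin 3)) (e : Equiv.Perm X) :
    IsOpen {r | r ∈ labelDom H k ∧ labelPerm g k r = e} := by
  cases k with
  | none => exact isOpen_labelDom_none.inter (isOpen_const (p := 1 = e))
  | some x =>
    convert ((isOpen_sideCollar x).inter (isOpen_const (p := 1 = e))).union
      ((isOpen_sideCollar (H.pair x)).inter (isOpen_const (p := g (H.pair x) = e))) using 1
    ext r
    constructor
    · rintro ⟨hr | hr, he⟩
      · exact Or.inl ⟨hr, (labelPerm_of_mem g hr).symm.trans he⟩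
      · exact Or.inr ⟨hr, (labelPerm_of_mem_pair g hr).symm.trans he⟩
    · rintro (⟨hr, he⟩ | ⟨hr, he⟩)
      · exact ⟨Or.inl hr, (labelPerm_of_mem g hr).trans he⟩
      · exact ⟨Or.inr hr, (labelPerm_of_mem_pair g hr).trans he⟩

variable (hg : ∀ x, g (H.pair x) * g x = 1)
include hg

lemma labelPerm_glue {f f' : H.Face} {i j : Fin 3} (h : H.pair (f, i) = (f', j)) (s : ℝ)
    {k : Option (H.Face × Fin 3)} (hk : ⟨f, sidePoint i s⟩ ∈ labelDom H k) :
    labelPerm g k ⟨f, sidePoint i s⟩ =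
      labelPerm g k ⟨f', sidePoint j (H.glue (f, i) s)⟩ * g (f, i) := by
  have hmem := sidePoint_mem_sideCollar f i s
  have hmem' := sidePoint_mem_sideCollar f' j (H.glue (f, i) s)
  cases k with
  | none => exact absurd hk (sidePoint_notMem_labelDom_none f i s)
  | some x =>
    obtain hk | hk := hk
    · obtain rfl := eq_of_mem_sideCollar hk hmem
      rw [← h] at hmem'
      rw [labelPerm_of_mem g hk, labelPerm_of_mem_pair g hmem', hg]
    · have hx : H.pair x = (f, i) := eq_of_mem_sideCollar hk hmem
      have hx' : x = (f', j) := by rw [← H.pair_pair x, hx, h]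
      rw [← hx'] at hmem'
      rw [labelPerm_of_mem_pair g hk, labelPerm_of_mem g hmem', hx, one_mul]

/-- The transport of labels in `X` over the surface in which crossing the side `x` acts by
`g x`. -/
def labelSystem : TransitionSystem (fun r : H.FacePoint => H.chart r.1 r.2)
      (Option (H.Face × Fin 3)) X where
  dom := labelDom H
  saturated := labelDom_saturated
  exists_mem := exists_mem_labelDom
  perm := labelPerm g
  isOpen_perm := isOpen_labelPerm g
  compat k l r r' h hk hl := by
    obtain rfl | ⟨f, f', i, j, s, hpair, rfl, rfl⟩ :=
      BrokenHyperbolicStructure.eq_or_sidePoint_of_chart_eq h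
    · rfl
    rw [labelPerm_glue g hg hpair s hk, labelPerm_glue g hg hpair s hl]
    group

/-- On a simply connected cover, a section of the transport of labels assigns a label to each lifted
triangle. -/
theorem exists_labelling [SimplyConnectedSpace E] (hp : IsCoveringMap p) (T₀ : LiftedFace H p)
    (x₀ : X) : ∃ l : LiftedFace H p → X, l T₀ = x₀ ∧
      ∀ T i T' j, T.Adj i T' j → l T' = g (T.face, i) (l T) := by
  have := (LiftedFace.isQuotientMap_lift (H := H) hp).locallyPathConnectedSpace
  let _ : TopologicalSpace X := ⊥
  have : DiscreteTopology X := ⟨rfl⟩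
  let A := labelSystem g hg
  have hπ := H.isQuotientMap_chart
  let y₀ := sidePoint 0 0
  obtain ⟨q, hq₀, hq⟩ := A.exists_section hπ hp.continuous (T₀.lift y₀)
    (A.perm (A.index hπ (p (T₀.lift y₀))) ⟨T₀.face, y₀⟩ x₀)
  let l (T : LiftedFace H p) (y : StdTriangle) : X :=
    (A.perm (A.index hπ (p (T.lift y))) ⟨T.face, y⟩)⁻¹ (q (T.lift y))
  have hconst (T : LiftedFace H p) (y y' : StdTriangle) : l T y = l T y' :=
    (hq (fun y => (⟨T.face, y⟩ : H.FacePoint)) T.lift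
      (continuous_sigmaMk (σ := fun _ : H.Face => StdTriangle)) T.continuous_lift
      T.lift_spec).apply_eq_of_preconnectedSpace y y'
  refine ⟨fun T => l T y₀, ?_, fun T i T' j h => ?_⟩
  · simp only [l, hq₀]
    exact Equiv.symm_apply_apply _ _
  · have hperm : A.perm (A.index hπ (p (T.lift (sidePoint i 0)))) ⟨T.face, sidePoint i 0⟩ =
        A.perm (A.index hπ (p (T.lift (sidePoint i 0))))
          ⟨T'.face, sidePoint j (H.glue (T.face, i) 0)⟩ * g (T.face, i) :=
      labelPerm_glue g hg h.1 0 (A.mem_dom_index hπ (T.lift_spec (sidePoint i 0)).symm)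
    beta_reduce
    rw [hconst T' y₀ (sidePoint j (H.glue (T.face, i) 0)), hconst T y₀ (sidePoint i 0)]
    simp only [l]
    rw [← h.lift_eq, hperm, mul_inv_rev, ← Equiv.Perm.mul_apply, mul_inv_cancel_left]

end Labels

end

noncomputable section

/-! ### Normalized developments -/

section

variable {E F : Type*} [TopologicalSpace E] [TopologicalSpace F] {H : BrokenHyperbolicStructure F}
  {p : E → F}

/-- The labels of the development: a rescaling factor and a triple of vectors. -/
abbrev DevelopLabel : Type := {c : ℝ // 0 < c} × (Fin 3 → Fin 3 → ℝ)

/-- The change of the rescaling factor and of the normalized triple across the side `x`. -/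
def developStep (H : BrokenHyperbolicStructure F) (x : H.Face × Fin 3) (a : DevelopLabel) :
    DevelopLabel :=
  (⟨a.1.1 / H.scale x, div_pos a.1.2 (H.scale_pos x)⟩,
    unfold (Real.exp (a.1.1 / H.scale x * H.shift x)) x.2 (H.pair x).2 a.2)

lemma developStep_pair (x : H.Face × Fin 3) (a : DevelopLabel) :
    developStep H (H.pair x) (developStep H x a) = a := by
  have hscale : a.1.1 / H.scale x / H.scale (H.pair x) = a.1.1 := by
    rw [div_div, mul_comm, H.scale_pair, div_one]
  have hshift : a.1.1 * H.shift (H.pair x) = a.1.1 / H.scale x * H.shift x := by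
    have hne := (H.scale_pos x).ne'
    rw [← H.shift_pair x]
    field_simp
  refine Prod.ext (Subtype.ext hscale) ?_
  simp only [developStep, hscale, H.pair_pair, hshift]
  exact unfold_unfold (Real.exp_pos _).ne' _ _ _

/-- `developStep` as a permutation. -/
def developPerm (H : BrokenHyperbolicStructure F) (x : H.Face × Fin 3) :
    Equiv.Perm DevelopLabel where
  toFun := developStep H x
  invFun := developStep H (H.pair x)
  left_inv := developStep_pair x
  right_inv a := by
    have h := developStep_pair (H.pair x) a
    rwa [H.pair_pair] at h

/-- Rescaling factors `c`, and normalized triples `Z` of light-like vectors, of the lifted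
triangles, related across the sides as in a development. The lifts of the vertices in a development
are obtained by rescaling the vectors of `Z` according to the decoration. -/
structure IsNormalizedDevelopment (p : E → F) (c : LiftedFace H p → ℝ)
    (Z : LiftedFace H p → Fin 3 → Fin 3 → ℝ) : Prop where
  scale_pos : ∀ T, 0 < c T
  normalized : ∀ T, IsNormalized (Z T)
  scale_adj : ∀ T i T' j, T.Adj i T' j → c T' * H.scale (T.face, i) = c T
  unfold_adj : ∀ T i T' j, T.Adj i T' j →
    Z T' = unfold (Real.exp (c T' * H.shift (T.face, i))) i j (Z T)

theorem exists_isNormalizedDevelopment [SimplyConnectedSpace E] (hp : IsCoveringMap p)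
    (T₀ : LiftedFace H p) {Z₀ : Fin 3 → Fin 3 → ℝ} (hZ₀ : IsNormalized Z₀) :
    ∃ c Z, IsNormalizedDevelopment (H := H) p c Z ∧ c T₀ = 1 ∧ Z T₀ = Z₀ := by
  obtain ⟨l, hl₀, hl⟩ := exists_labelling (developPerm H)
    (fun x => Equiv.ext fun a => developStep_pair x a) hp T₀ (⟨1, one_pos⟩, Z₀)
  have hscale T i T' j (hadj : T.Adj i T' j) : (l T').1.1 = (l T).1.1 / H.scale (T.face, i) := by
    rw [hl T i T' j hadj]
    rfl
  have hunfold T i T' j (hadj : T.Adj i T' j) :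
      (l T').2 = unfold (Real.exp ((l T').1.1 * H.shift (T.face, i))) i j (l T).2 := by
    have hj : (H.pair (T.face, i)).2 = j := by rw [hadj.1]
    rw [hscale T i T' j hadj, hl T i T' j hadj, ← hj]
    rfl
  refine ⟨fun T => (l T).1.1, fun T => (l T).2, ⟨fun T => (l T).1.2, ?_, ?_, hunfold⟩,
    by simp only [hl₀], by simp only [hl₀]⟩
  · refine LiftedFace.induction_adj hp (T₀ := T₀) (by rwa [hl₀]) fun T i T' j hadj hT => ?_
    rw [hunfold T i T' j hadj]
    exact hT.isNormalized_unfold (Real.exp_pos _) _ _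
  · intro T i T' j hadj
    rw [hscale T i T' j hadj, div_mul_cancel₀ _ (H.scale_pos _).ne']

/-! ### Existence and uniqueness of the development -/

namespace Decoration

variable (dec : Decoration H)

lemma depth_add_one {T T' : LiftedFace H p} {i j : Fin 3} (h : T.Adj i T' j) :
    dec.depth (T'.face, j + 1) =
      H.scale (T.face, i) * dec.depth (T.face, i + 2) + H.shift (T.face, i) := by
  have hnext := dec.depth_next (T.face, i + 2)
  simp only [GluingData.next, GluingData.exitSide, (fin_three_add_add i).2.2.1, h.1] at hnext
  exact hnext

lemma depth_add_two {T T' : LiftedFace H p} {i j : Fin 3} (h : T.Adj i T' j) :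
    dec.depth (T'.face, j + 2) =
      H.scale (T.face, i) * dec.depth (T.face, i + 1) - H.shift (T.face, i) := by
  have hscale := H.scale_pair (T.face, i)
  have hshift := H.shift_pair (T.face, i)
  rw [h.1] at hscale hshift
  rw [dec.depth_add_one h.symm]
  linear_combination (-dec.depth (T'.face, j + 2)) * hscale - hshift

end Decoration

lemma IsNormalizedDevelopment.isDevelopment {c : LiftedFace H p → ℝ}
    {Z : LiftedFace H p → Fin 3 → Fin 3 → ℝ} (hcZ : IsNormalizedDevelopment p c Z)
    (dec : Decoration H) {T₀ : LiftedFace H p} {r : Fin 3 → Fin 3 → ℝ} {t : Fin 3 → ℝ}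
    (ht : ∀ k, 0 < t k) (hc : c T₀ = 1) (hZ : Z T₀ = fun k => t k • r k) :
    IsDevelopment dec p T₀ r c fun T k => Real.exp (c T * dec.depth (T.face, k)) • Z T k where
  scale_base := hc
  scale_adj := hcZ.scale_adj
  mem_cone T k := smul_mem_lightCone (Real.exp_pos _) ((hcZ.normalized T).1 k)
  base k := ⟨Real.exp (c T₀ * dec.depth (T₀.face, k)) * t k,
    mul_pos (Real.exp_pos _) (ht k), by rw [hZ, smul_smul]⟩
  lambda T i := by
    rw [lambdaCone, lambdaOfDist, mink_smul_left, mink_smul_right,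
      (hcZ.normalized T).2 _ _ (fin_three_ne_add i).2.2.symm, horoDist, mul_add, Real.exp_add]
    congr 1
    ring
  share T i T' j h := by
    have hscale := hcZ.scale_adj T i T' j h
    constructor
    · rw [hcZ.unfold_adj T i T' j h, unfold_add_one, dec.depth_add_one h, smul_smul,
        ← Real.exp_neg, ← Real.exp_add, ← hscale]
      ring_nf
    · rw [hcZ.unfold_adj T i T' j h, unfold_add_two, dec.depth_add_two h, smul_smul,
        ← Real.exp_add, ← hscale]
      ring_nf
  opposite T i T' j h := by
    rw [hcZ.unfold_adj T i T' j h, det_smul, det_smul, det_unfold]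
    have hdet := sq_pos_of_ne_zero ((hcZ.normalized T).det_ne_zero i)
    rw [mul_mul_mul_comm, mul_neg, ← sq, mul_neg, neg_lt_zero]
    positivity

namespace IsDevelopment

variable {dec : Decoration H} {T₀ : LiftedFace H p} {r : Fin 3 → Fin 3 → ℝ}
  {c c' : LiftedFace H p → ℝ} {z z' : LiftedFace H p → Fin 3 → Fin 3 → ℝ}

lemma mink_eq (h : IsDevelopment dec p T₀ r c z) (T : LiftedFace H p) (i : Fin 3) :
    mink (z T (i + 1)) (z T (i + 2)) = -(2 * Real.exp (c T * horoDist dec (T.face, i))) := by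
  have hnonpos := mink_nonpos (h.mem_cone T (i + 1)) (h.mem_cone T (i + 2))
  rw [← (Real.sqrt_inj (neg_nonneg.2 hnonpos) (by positivity)).1 (h.lambda T i), neg_neg]

lemma eq_base (hr : IsIdealTriple r) (h : IsDevelopment dec p T₀ r c z)
    (h' : IsDevelopment dec p T₀ r c' z') : z T₀ = z' T₀ := by
  choose t ht hz using h.base
  choose t' ht' hz' using h'.base
  have htt' (k : Fin 3) : t k = t' k := eq_of_pairwise_mul_eq ht ht' (fun i => by
    have hmink := (h.mink_eq T₀ i).trans ((h'.mink_eq T₀ i).trans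
      (by rw [h.scale_base, h'.scale_base])).symm
    rw [hz, hz, hz', hz', mink_smul_left, mink_smul_right, mink_smul_left, mink_smul_right,
      ← mul_assoc, ← mul_assoc] at hmink
    exact mul_right_cancel₀ (hr.mink_neg (fin_three_ne_add i).2.2.symm).ne hmink) k
  funext k
  rw [hz, hz', htt']

lemma eq_adj (h : IsDevelopment dec p T₀ r c z) (h' : IsDevelopment dec p T₀ r c' z')
    {T T' : LiftedFace H p} {i j : Fin 3} (hadj : T.Adj i T' j) (hc : c T = c' T)
    (hz : z T = z' T) : c T' = c' T' ∧ z T' = z' T' := by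
  have hc' : c T' = c' T' := by
    refine mul_right_cancel₀ (H.scale_pos (T.face, i)).ne' ?_
    rw [h.scale_adj T i T' j hadj, h'.scale_adj T i T' j hadj, hc]
  obtain ⟨hz₁, hz₂⟩ := h.share T i T' j hadj
  obtain ⟨hz₁', hz₂'⟩ := h'.share T i T' j hadj
  have hopp := h.opposite T i T' j hadj
  obtain ⟨h₁₁, h₁₂, h₂₁, h₂₂⟩ := fin_three_add_add j
  have hmink₁ := h.mink_eq T' (j + 1)
  have hmink₁' := h'.mink_eq T' (j + 1)
  have hmink₂ := h.mink_eq T' (j + 2)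
  have hmink₂' := h'.mink_eq T' (j + 2)
  rw [hz] at hz₁ hz₂ hopp
  rw [h₁₁, h₁₂, mink_comm, hz₂] at hmink₁
  rw [h₁₁, h₁₂, mink_comm, hz₂'] at hmink₁'
  rw [h₂₁, h₂₂, hz₁] at hmink₂
  rw [h₂₁, h₂₂, hz₁'] at hmink₂'
  refine ⟨hc', funext ((fin_three_forall_iff j).2 ⟨?_, hz₁.trans hz₁'.symm, hz₂.trans hz₂'.symm⟩)⟩
  exact eq_of_mink_eq_of_det (h.mem_cone T' j).1 (h'.mem_cone T' j).1
    (hmink₁.trans (hc' ▸ hmink₁'.symm)) (hmink₂.trans (hc' ▸ hmink₂'.symm)) hopp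
    (h'.opposite T i T' j hadj)

theorem unique [PreconnectedSpace E] (hp : IsCoveringMap p) (hr : IsIdealTriple r)
    (h : IsDevelopment dec p T₀ r c z) (h' : IsDevelopment dec p T₀ r c' z') :
    c = c' ∧ z = z' := by
  have heq : ∀ T, c T = c' T ∧ z T = z' T :=
    LiftedFace.induction_adj hp (T₀ := T₀)
      ⟨h.scale_base.trans h'.scale_base.symm, h.eq_base hr h'⟩
      fun T i T' j hadj ⟨hc, hz⟩ => h.eq_adj h' hadj hc hz
  exact ⟨funext fun T => (heq T).1, funext fun T => (heq T).2⟩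

end IsDevelopment

end

/-! ### The developing map -/

lemma continuous_coord (W : Fin 3 → Fin 3 → ℝ) (k : Fin 3) :
    Continuous fun w : HypPlane => coord W w.1 k := by
  have happly (j : Fin 3) : Continuous fun w : HypPlane => w.1 j :=
    (continuous_apply j).comp continuous_subtype_val
  have hmink (v : Fin 3 → ℝ) : Continuous fun w : HypPlane => mink w.1 v :=
    (((happly 0).mul_const _).add ((happly 1).mul_const _)).sub ((happly 2).mul_const _)
  exact (((hmink _).sub (hmink _)).sub (hmink _)).div_const 4

namespace IsNormalized

variable {Z : Fin 3 → Fin 3 → ℝ} (hZ : IsNormalized Z)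
include hZ

lemma coord_add_pos (w : HypPlane) {i j : Fin 3} (hij : i ≠ j) :
    0 < coord Z w.1 i + coord Z w.1 j := by
  obtain ⟨h₁₁, h₁₂, h₂₁, h₂₂⟩ := fin_three_add_add i
  obtain rfl | rfl := fin_three_eq_add_of_ne hij.symm
  · rw [coord, coord, h₁₁, h₁₂]
    linarith [w.mink_neg (hZ.1 (i + 2))]
  · rw [coord, coord, h₂₁, h₂₂]
    linarith [w.mink_neg (hZ.1 (i + 1))]

lemma mem_idealTriangle {w : HypPlane} (h : ∀ k, 0 ≤ coord Z w.1 k) : w ∈ idealTriangle Z :=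
  ⟨_, h, (hZ.comb_coord w.1).symm⟩

lemma exists_side_of_coord_eq_zero {w : HypPlane} (hw : w ∈ idealTriangle Z) {i : Fin 3}
    (h : coord Z w.1 i = 0) : ∃ s, hZ.baryHomeo (Bary.side i s) = ⟨w, hw⟩ := by
  rw [← show (hZ.baryHomeo.symm ⟨w, hw⟩).1 i = coord Z w.1 i from
    congrFun (hZ.baryHomeo_symm_coe ⟨w, hw⟩) i] at h
  obtain ⟨s, hs⟩ := Bary.coord_eq_zero_iff.1 h
  exact ⟨s, by rw [← hs, Homeomorph.apply_symm_apply]⟩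

lemma side_mem_horocycle_head (i : Fin 3) (s : ℝ) :
    (hZ.baryHomeo (Bary.side i s)).1 ∈ horocycle (Real.exp s • Z (i + 2)) := by
  change mink (hZ.baryHomeo (Bary.side i s)).1.1 _ = -1
  rw [baryHomeo_coe, mink_smul_right, hZ.mink_comb_vertex, (fin_three_add_add i).2.2.1,
    (fin_three_add_add i).2.2.2, Bary.side_self, Bary.side_add_one, Real.exp_neg]
  field_simp
  ring

lemma side_mem_horocycle_tail (i : Fin 3) (s : ℝ) :
    (hZ.baryHomeo (Bary.side i (-s))).1 ∈ horocycle (Real.exp s • Z (i + 1)) := by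
  change mink (hZ.baryHomeo (Bary.side i (-s))).1.1 _ = -1
  rw [baryHomeo_coe, mink_smul_right, hZ.mink_comb_vertex, (fin_three_add_add i).1,
    (fin_three_add_add i).2.1, Bary.side_self, Bary.side_add_two, Real.exp_neg]
  field_simp
  ring

end IsNormalized

variable {E F : Type*} [TopologicalSpace E] [TopologicalSpace F] {H : BrokenHyperbolicStructure F}
  {p : E → F}

namespace LiftedFace

/-- Chains of adjacent lifted triangles without backtracking that start at `T` and enter the last
triangle through its side `j`. -/
inductive Chain (T : LiftedFace H p) : LiftedFace H p → Fin 3 → Prop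
  | step {i T' j} : T.Adj i T' j → Chain T T' j
  | cons {T' j i T'' k} : Chain T T' j → i ≠ j → T'.Adj i T'' k → Chain T T'' k

lemma eq_or_chain [PreconnectedSpace E] (hp : IsCoveringMap p) (T T' : LiftedFace H p) :
    T' = T ∨ ∃ j, T.Chain T' j := by
  refine induction_adj hp (P := fun T' => T' = T ∨ ∃ j, T.Chain T' j) (T₀ := T) (Or.inl rfl) ?_ T'
  rintro T' i T'' k hadj (rfl | ⟨j, hT'⟩)
  · exact Or.inr ⟨k, .step hadj⟩
  by_cases hij : i = j
  · subst hij
    cases hT' with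
    | step hback => exact Or.inl (Adj.unique hp hadj hback.symm).1
    | cons hchain _ hback =>
      obtain ⟨rfl, rfl⟩ := Adj.unique hp hadj hback.symm
      exact Or.inr ⟨_, hchain⟩
  · exact Or.inr ⟨k, .cons hT' hij hadj⟩

end LiftedFace

namespace IsNormalizedDevelopment

variable {c : LiftedFace H p → ℝ} {Z : LiftedFace H p → Fin 3 → Fin 3 → ℝ}
  (hcZ : IsNormalizedDevelopment p c Z)
include hcZ

/-- The homeomorphism of the standard triangle to the ideal triangle of a lifted triangle which
acts on the sides as a homothety with factor `c T`. -/
def triangleHomeo (T : LiftedFace H p) : StdTriangle ≃ₜ idealTriangle (Z T) :=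
  stdBary.trans ((Bary.stretch (Real.log (c T))).trans (hcZ.normalized T).baryHomeo)

lemma triangleHomeo_sidePoint (T : LiftedFace H p) (i : Fin 3) (s : ℝ) :
    hcZ.triangleHomeo T (sidePoint i s) =
      (hcZ.normalized T).baryHomeo (Bary.side i (c T * s)) := by
  rw [triangleHomeo, Homeomorph.trans_apply, Homeomorph.trans_apply, stdBary_sidePoint,
    Bary.stretch_side, Real.exp_log (hcZ.scale_pos T)]

lemma triangleHomeo_sidePoint_coe (T : LiftedFace H p) (i : Fin 3) (s : ℝ) :
    (hcZ.triangleHomeo T (sidePoint i s)).1.1 =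
      (Real.exp (-(c T * s)) / 2) • Z T (i + 1) + (Real.exp (c T * s) / 2) • Z T (i + 2) := by
  rw [hcZ.triangleHomeo_sidePoint, IsNormalized.baryHomeo_coe, comb_cyclic _ _ i, Bary.side_self,
    Bary.side_add_one, Bary.side_add_two, zero_smul, zero_add]

lemma triangleHomeo_adj {T T' : LiftedFace H p} {i j : Fin 3} (h : T.Adj i T' j) (s : ℝ) :
    (hcZ.triangleHomeo T (sidePoint i s)).1 =
      (hcZ.triangleHomeo T' (sidePoint j (H.glue (T.face, i) s))).1 := by
  refine Subtype.ext ?_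
  rw [triangleHomeo_sidePoint_coe, triangleHomeo_sidePoint_coe, hcZ.unfold_adj T i T' j h,
    unfold_add_one, unfold_add_two, smul_smul, smul_smul, ← Real.exp_neg,
    div_mul_eq_mul_div, div_mul_eq_mul_div, ← Real.exp_add, ← Real.exp_add, add_comm,
    ← hcZ.scale_adj T i T' j h, GluingData.glue]
  congr 4 <;> ring_nf

lemma exists_eq_triangleHomeo_sidePoint {T : LiftedFace H p} {w : HypPlane}
    (hw : w ∈ idealTriangle (Z T)) {i : Fin 3} (h : coord (Z T) w.1 i = 0) :
    ∃ s, (hcZ.triangleHomeo T (sidePoint i s)).1 = w := by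
  obtain ⟨s, hs⟩ := (hcZ.normalized T).exists_side_of_coord_eq_zero hw h
  refine ⟨s / c T, ?_⟩
  rw [hcZ.triangleHomeo_sidePoint, mul_div_cancel₀ _ (hcZ.scale_pos T).ne', hs]

lemma coord_adj {T T' : LiftedFace H p} {i j : Fin 3} (h : T.Adj i T' j) (w : Fin 3 → ℝ) :
    coord (Z T') w j = -coord (Z T) w i := by
  rw [hcZ.unfold_adj T i T' j h, coord_unfold]

/-- A point on the far side of the last edge of a chain is on the far side of all its edges, since
at most one of its three coordinates with respect to a triangle is nonpositive. -/
lemma adj_of_chain {T T' : LiftedFace H p} {j : Fin 3} (h : T.Chain T' j) {w : HypPlane}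
    (hw : w ∈ idealTriangle (Z T)) (hj : 0 ≤ coord (Z T') w.1 j) :
    ∃ i, T.Adj i T' j ∧ coord (Z T) w.1 i = 0 := by
  induction h with
  | @step i T' j hadj =>
    rw [hcZ.coord_adj hadj] at hj
    exact ⟨i, hadj, le_antisymm (neg_nonneg.1 hj) ((hcZ.normalized T).coord_nonneg hw i)⟩
  | @cons T' j i T'' k _ hij hadj ih =>
    rw [hcZ.coord_adj hadj] at hj
    have hpos := (hcZ.normalized T').coord_add_pos w hij
    obtain ⟨i', hadj', hi'⟩ := ih (by linarith)
    have hcoord := hcZ.coord_adj hadj' w.1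
    linarith

lemma lift_eq_of_triangleHomeo_eq [PreconnectedSpace E] (hp : IsCoveringMap p)
    {T T' : LiftedFace H p} {y y' : StdTriangle}
    (h : (hcZ.triangleHomeo T y).1 = (hcZ.triangleHomeo T' y').1) : T.lift y = T'.lift y' := by
  obtain rfl | ⟨j, hj⟩ := LiftedFace.eq_or_chain hp T T'
  · rw [(hcZ.triangleHomeo T').injective (Subtype.ext h)]
  have hw := (hcZ.triangleHomeo T y).2
  have hw' := (hcZ.triangleHomeo T' y').2
  rw [← h] at hw'
  obtain ⟨i, hadj, hi⟩ := hcZ.adj_of_chain hj hw ((hcZ.normalized T').coord_nonneg hw' j)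
  obtain ⟨s, hs⟩ := hcZ.exists_eq_triangleHomeo_sidePoint hw hi
  have hy : sidePoint i s = y := (hcZ.triangleHomeo T).injective (Subtype.ext hs)
  rw [hcZ.triangleHomeo_adj hadj] at hs
  have hy' : sidePoint j (H.glue (T.face, i) s) = y' :=
    (hcZ.triangleHomeo T').injective (Subtype.ext (hs.trans h))
  rw [← hy, ← hy', hadj.lift_eq]

lemma idealTriangle_mem_nhds {T : LiftedFace H p} {w : HypPlane}
    (h : ∀ k, 0 < coord (Z T) w.1 k) : idealTriangle (Z T) ∈ 𝓝 w := by
  have hev : ∀ᶠ v in 𝓝 w, ∀ k, 0 < coord (Z T) v.1 k := Filter.eventually_all.2 fun k =>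
    (continuous_coord (Z T) k).continuousAt.eventually (lt_mem_nhds (h k))
  filter_upwards [hev] with v hv
  exact (hcZ.normalized T).mem_idealTriangle fun k => (hv k).le

lemma eventually_coord_pos {T : LiftedFace H p} {w : HypPlane} {i : Fin 3}
    (h : coord (Z T) w.1 i = 0) :
    ∀ᶠ v in 𝓝 w, 0 < coord (Z T) v.1 (i + 1) ∧ 0 < coord (Z T) v.1 (i + 2) := by
  have hpos₁ := (hcZ.normalized T).coord_add_pos w (fin_three_ne_add i).1.symm
  have hpos₂ := (hcZ.normalized T).coord_add_pos w (fin_three_ne_add i).2.1.symm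
  rw [h, zero_add] at hpos₁ hpos₂
  exact ((continuous_coord (Z T) _).continuousAt.eventually (lt_mem_nhds hpos₁)).and
    ((continuous_coord (Z T) _).continuousAt.eventually (lt_mem_nhds hpos₂))

lemma idealTriangle_union_mem_nhds {T T' : LiftedFace H p} {i j : Fin 3} (hadj : T.Adj i T' j)
    {w : HypPlane} (h : coord (Z T) w.1 i = 0) :
    idealTriangle (Z T) ∪ idealTriangle (Z T') ∈ 𝓝 w := by
  have h' : coord (Z T') w.1 j = 0 := by rw [hcZ.coord_adj hadj, h, neg_zero]
  filter_upwards [hcZ.eventually_coord_pos h, hcZ.eventually_coord_pos h'] with v hv hv'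
  obtain hi | hi := le_total 0 (coord (Z T) v.1 i)
  · exact Or.inl ((hcZ.normalized T).mem_idealTriangle
      ((fin_three_forall_iff i).2 ⟨hi, hv.1.le, hv.2.le⟩))
  · rw [← neg_nonneg, ← hcZ.coord_adj hadj] at hi
    exact Or.inr ((hcZ.normalized T').mem_idealTriangle
      ((fin_three_forall_iff j).2 ⟨hi, hv'.1.le, hv'.2.le⟩))

lemma mem_nhds_of_forall (hp : IsCoveringMap p) (T : LiftedFace H p) (y : StdTriangle)
    {N : Set HypPlane} (h : ∀ T' y', T'.lift y' = T.lift y →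
      ∀ᶠ v in 𝓝 (hcZ.triangleHomeo T y).1, v ∈ idealTriangle (Z T') → v ∈ N) :
    N ∈ 𝓝 (hcZ.triangleHomeo T y).1 := by
  have hw := (hcZ.triangleHomeo T y).2
  by_cases hpos : ∀ k, 0 < coord (Z T) (hcZ.triangleHomeo T y).1.1 k
  · filter_upwards [h T y rfl, hcZ.idealTriangle_mem_nhds hpos] with v hv hvT
    exact hv hvT
  · push Not at hpos
    obtain ⟨i, hi⟩ := hpos
    have hi₀ := le_antisymm hi ((hcZ.normalized T).coord_nonneg hw i)
    obtain ⟨T', j, hadj⟩ := LiftedFace.exists_adj hp T i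
    obtain ⟨s, hs⟩ := hcZ.exists_eq_triangleHomeo_sidePoint hw hi₀
    have hy : sidePoint i s = y := (hcZ.triangleHomeo T).injective (Subtype.ext hs)
    filter_upwards [h T y rfl,
      h T' (sidePoint j (H.glue (T.face, i) s)) (by rw [← hy, hadj.lift_eq]),
      hcZ.idealTriangle_union_mem_nhds hadj hi₀] with v hv hv' hvT
    exact hvT.elim hv hv'

section DevelopingMap

variable {D : E → HypPlane} (hDT : ∀ T y, D (T.lift y) = (hcZ.triangleHomeo T y).1)
include hDT

lemma eventually_mem_image {U : Set E} (hU : IsOpen U) {T : LiftedFace H p} {y : StdTriangle}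
    (hy : T.lift y ∈ U) : ∀ᶠ v in 𝓝 (D (T.lift y)), v ∈ idealTriangle (Z T) → v ∈ D '' U := by
  have himage : IsOpen (hcZ.triangleHomeo T '' (T.lift ⁻¹' U)) :=
    (hcZ.triangleHomeo T).isOpenMap _ (hU.preimage T.continuous_lift)
  have hmem := mem_nhds_subtype_iff_nhdsWithin.1 (himage.mem_nhds ⟨y, hy, rfl⟩)
  rw [hDT]
  filter_upwards [mem_nhdsWithin_iff_eventually.1 hmem] with v hv hvT
  obtain ⟨_, ⟨x, hx, rfl⟩, rfl⟩ := hv hvT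
  exact ⟨T.lift x, hx, hDT T x⟩

lemma isOpenMap_developingMap (hp : IsCoveringMap p) : IsOpenMap D := by
  refine fun U hU => isOpen_iff_mem_nhds.2 ?_
  rintro _ ⟨e, he, rfl⟩
  obtain ⟨T, y, rfl⟩ := LiftedFace.exists_lift_eq (H := H) hp e
  rw [hDT]
  refine hcZ.mem_nhds_of_forall hp T y fun T' y' hy' => ?_
  rw [← hDT, ← hy']
  exact hcZ.eventually_mem_image hDT hU (hy' ▸ he)

lemma injective_developingMap [PreconnectedSpace E] (hp : IsCoveringMap p) :
    Function.Injective D := by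
  intro e e' h
  obtain ⟨T, y, rfl⟩ := LiftedFace.exists_lift_eq (H := H) hp e
  obtain ⟨T', y', rfl⟩ := LiftedFace.exists_lift_eq (H := H) hp e'
  rw [hDT, hDT] at h
  exact hcZ.lift_eq_of_triangleHomeo_eq hp h

lemma range_lift (T : LiftedFace H p) :
    Set.range (fun x => D (T.lift x)) = idealTriangle (Z T) := by
  rw [funext (hDT T)]
  exact ((hcZ.triangleHomeo T).surjective.range_comp Subtype.val).trans Subtype.range_coe

lemma range_side (T : LiftedFace H p) (i : Fin 3) :
    Set.range (fun s => D (T.lift (sidePoint i s))) = idealSide (Z T) i := by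
  ext w
  constructor
  · rintro ⟨s, rfl⟩
    simp only [hDT, hcZ.triangleHomeo_sidePoint]
    exact (hcZ.normalized T).baryHomeo_mem_idealSide.2 (Bary.side_self i _)
  · intro hw
    have hwT := idealSide_subset_idealTriangle _ _ hw
    obtain ⟨s, hs⟩ := hcZ.exists_eq_triangleHomeo_sidePoint hwT
      ((hcZ.normalized T).mem_idealSide_iff (w := ⟨w, hwT⟩).1 hw)
    exact ⟨s, (hDT _ _).trans hs⟩

lemma realizesDevelopment (dec : Decoration H) (hD : IsOpenEmbedding D) :
    RealizesDevelopment dec p c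
      (fun T k => Real.exp (c T * dec.depth (T.face, k)) • Z T k) D where
  isOpenEmbedding := hD
  image_face T := by
    rw [hcZ.range_lift hDT, idealTriangle_smul fun k => Real.exp_pos _]
  image_side T i := by
    rw [hcZ.range_side hDT, idealSide_smul fun k => Real.exp_pos _]
  homothety T i s t := by
    rw [hDT, hDT, hcZ.triangleHomeo_sidePoint, hcZ.triangleHomeo_sidePoint,
      IsNormalized.hdist_baryHomeo, Bary.hypDist_side, hdist_sidePoint, ← mul_sub, abs_mul,
      abs_of_pos (hcZ.scale_pos T)]
  horocycle_head T i := by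
    rw [hDT, hcZ.triangleHomeo_sidePoint]
    exact (hcZ.normalized T).side_mem_horocycle_head i _
  horocycle_tail T i := by
    rw [hDT, hcZ.triangleHomeo_sidePoint, mul_neg]
    exact (hcZ.normalized T).side_mem_horocycle_tail i _

end DevelopingMap

theorem exists_developingMap [PreconnectedSpace E] (hp : IsCoveringMap p) :
    ∃ D : E → HypPlane, IsOpenEmbedding D ∧ ∀ T y, D (T.lift y) = (hcZ.triangleHomeo T y).1 := by
  obtain ⟨D, hD, hDT⟩ := LiftedFace.exists_glued (H := H) hp
    (fun T y => (hcZ.triangleHomeo T y).1)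
    (fun T => continuous_subtype_val.comp (hcZ.triangleHomeo T).continuous)
    (fun T i T' j hadj s => hcZ.triangleHomeo_adj hadj s)
  exact ⟨D, .of_continuous_injective_isOpenMap hD (hcZ.injective_developingMap hDT hp)
    (hcZ.isOpenMap_developingMap hDT hp), hDT⟩

end IsNormalizedDevelopment

end

noncomputable section

/-! ### The action of the covering translations -/

variable {E F : Type*} [TopologicalSpace E] [TopologicalSpace F] {H : BrokenHyperbolicStructure F}
  {p : E → F}

namespace LiftedFace

/-- The image of a lifted triangle under a covering translation. -/
def translate (α : coveringTranslations p) (T : LiftedFace H p) : LiftedFace H p where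
  face := T.face
  lift x := α.1 (T.lift x)
  continuous_lift := α.1.continuous.comp T.continuous_lift
  lift_spec x := (α.2 _).trans (T.lift_spec x)

lemma Adj.translate {T T' : LiftedFace H p} {i j : Fin 3} (h : T.Adj i T' j)
    (α : coveringTranslations p) : (T.translate α).Adj i (T'.translate α) j :=
  ⟨h.1, fun s => congrArg α.1 (h.2 s)⟩

end LiftedFace

namespace IsNormalizedDevelopment

variable {c : LiftedFace H p → ℝ} {Z : LiftedFace H p → Fin 3 → Fin 3 → ℝ}
  (hcZ : IsNormalizedDevelopment p c Z)
include hcZ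

lemma scale_translate_div [PreconnectedSpace E] (hp : IsCoveringMap p)
    (α : coveringTranslations p) (T₀ T : LiftedFace H p) :
    c (T.translate α) / c T = c (T₀.translate α) / c T₀ := by
  refine LiftedFace.induction_adj hp
    (P := fun T => c (T.translate α) / c T = c (T₀.translate α) / c T₀) (T₀ := T₀) rfl ?_ T
  intro T i T' j h hT
  rw [← hT, ← hcZ.scale_adj T i T' j h, ← hcZ.scale_adj _ i _ j (h.translate α)]
  exact (mul_div_mul_right _ _ (H.scale_pos (T.face, i)).ne').symm

/-- The homomorphism that takes a covering translation `α` to the factor `c (α T) / c T`, which is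
the same for all lifted triangles `T`. -/
def stretchHom [PreconnectedSpace E] (hp : IsCoveringMap p) (T₀ : LiftedFace H p) :
    coveringTranslations p →* {t : ℝ // 0 < t} where
  toFun α := ⟨c (T₀.translate α) / c T₀, div_pos (hcZ.scale_pos _) (hcZ.scale_pos _)⟩
  map_one' := Subtype.ext (div_self (hcZ.scale_pos T₀).ne')
  map_mul' α β := by
    refine Subtype.ext ?_
    change c ((T₀.translate β).translate α) / c T₀ =
      c (T₀.translate α) / c T₀ * (c (T₀.translate β) / c T₀)
    rw [← hcZ.scale_translate_div hp α T₀ (T₀.translate β),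
      div_mul_div_cancel₀ (hcZ.scale_pos _).ne']

lemma coe_stretchHom [PreconnectedSpace E] (hp : IsCoveringMap p) (T₀ T : LiftedFace H p)
    (α : coveringTranslations p) :
    (hcZ.stretchHom hp T₀ α : ℝ) = c (T.translate α) / c T :=
  (hcZ.scale_translate_div hp α T₀ T).symm

lemma stretchMap_triangleHomeo (T T' : LiftedFace H p) (x : StdTriangle) :
    stretchMap (hcZ.normalized T) (hcZ.normalized T') (Real.log (c T' / c T))
      (hcZ.triangleHomeo T x) = hcZ.triangleHomeo T' x := by
  simp only [stretchMap, triangleHomeo, Homeomorph.trans_apply, Homeomorph.symm_apply_apply]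
  rw [← Bary.stretch_add, Real.log_div (hcZ.scale_pos _).ne' (hcZ.scale_pos _).ne',
    add_sub_cancel]

theorem isCoveringHyperbolicStructure [PreconnectedSpace E] (hp : IsCoveringMap p)
    (T₀ : LiftedFace H p) {D : E → HypPlane} (hD : IsOpenEmbedding D)
    (hDT : ∀ T y, D (T.lift y) = (hcZ.triangleHomeo T y).1) :
    IsCoveringHyperbolicStructure H p (hcZ.stretchHom hp T₀) D where
  isLocalHomeomorph := hD.isLocalHomeomorph
  geodesic T := by
    refine ⟨?_, Z T, (hcZ.normalized T).isIdealTriple, hcZ.range_lift hDT T, hcZ.range_side hDT T⟩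
    rw [funext (hDT T)]
    exact Subtype.val_injective.comp (hcZ.triangleHomeo T).injective
  stretch α T := by
    have hstretch : IsStretchMap (hcZ.stretchHom hp T₀ α : ℝ)
        (stretchMap (hcZ.normalized T) (hcZ.normalized (T.translate α))
          (Real.log (c (T.translate α) / c T))) := by
      rw [hcZ.coe_stretchHom hp T₀ T α]
      have h := isStretchMap_stretchMap (hcZ.normalized T) (hcZ.normalized (T.translate α))
        (Real.log (c (T.translate α) / c T))
      rwa [Real.exp_log (div_pos (hcZ.scale_pos _) (hcZ.scale_pos _))] at h
    refine ⟨Z T, Z (T.translate α), (hcZ.normalized _).isIdealTriple,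
      (hcZ.normalized _).isIdealTriple, hcZ.range_lift hDT T,
      hcZ.range_lift hDT (T.translate α), _, hstretch, fun x hx => ?_⟩
    rw [show (⟨D (T.lift x), hx⟩ : idealTriangle (Z T)) = hcZ.triangleHomeo T x from
      Subtype.ext (hDT T x), stretchMap_triangleHomeo, ← hDT]
    rfl

end IsNormalizedDevelopment

end

/-- Let `H` be a broken hyperbolic structure on the ideally triangulated connected surface `F` with
a decoration, `p : E → F` the universal covering, `T₀` a lifted triangle and `r` the vertices of an
ideal triangle. Then the development exists and is unique, and it is realized by a map to the
hyperbolic plane whose hyperbolic structure is a covering hyperbolic structure. -/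
theorem propositionB10 {E F : Type*} [TopologicalSpace E] [TopologicalSpace F]
    [ConnectedSpace F] [SimplyConnectedSpace E]
    (H : BrokenHyperbolicStructure F) (dec : Decoration H)
    (p : E → F) (hp : IsCoveringMap p)
    (T₀ : LiftedFace H p) (r : Fin 3 → Fin 3 → ℝ) (hr : IsIdealTriple r) :
    (∃! cz : (LiftedFace H p → ℝ) × (LiftedFace H p → Fin 3 → Fin 3 → ℝ),
      IsDevelopment dec p T₀ r cz.1 cz.2) ∧
    ∀ c z, IsDevelopment dec p T₀ r c z →
      ∃ (D : E → HypPlane) (φ : coveringTranslations p →* {t : ℝ // 0 < t}),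
        RealizesDevelopment dec p c z D ∧ IsCoveringHyperbolicStructure H p φ D := by
  obtain ⟨t, ht, hZ₀⟩ := hr.exists_normalized
  obtain ⟨c, Z, hcZ, hc, hZ⟩ := exists_isNormalizedDevelopment hp T₀ hZ₀
  have hdev := hcZ.isDevelopment dec ht hc hZ
  refine ⟨⟨(c, _), hdev, fun _ h => ?_⟩, fun _ _ h => ?_⟩
  · obtain ⟨hc_eq, hz_eq⟩ := h.unique hp hr hdev
    exact Prod.ext hc_eq hz_eq
  · obtain ⟨rfl, rfl⟩ := h.unique hp hr hdev
    obtain ⟨D, hD, hDT⟩ := hcZ.exists_developingMap hp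
    exact ⟨D, hcZ.stretchHom hp T₀, hcZ.realizesDevelopment hDT dec hD,
      hcZ.isCoveringHyperbolicStructure hp T₀ hD hDT⟩
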